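/- **Setting.** Fix $d, M, N_1\in\mathbb N$ with $M, N_1\ge 1$, exponents $\gamma_1\in[1/2,1]$, $\gamma_2\in(3/4,1)$, a time horizon $0<T<\infty$, a data set $(x^{(i)},y^{(i)})_{i=1}^M\subset\mathbb R^d\times\mathbb R$ with empirical distribution $\pi=\frac1M\sum_{i=1}^M\delta_{(x^{(i)},y^{(i)})}$, and an infinitely differentiable bounded function $\sigma:\mathbb R\to\mathbb R$. On a probability space let $C^i_0\in\mathbb R$, $W^{2,j,i}_0\in\mathbb R$, $W^{1,j}_0\in\mathbb R^d$ ($i\in\mathbb N$, $1\le j\le N_1$) and $(x_k,y_k)$ ($k\ge0$) be mutually independent random variables such that: the $C_0^i$ have a common law $\mu_C$, the $W^{2,j,i}_0$ a common law $\mu_{W^2}$ and the $W^{1,j}_0$ a common law $\mu_{W^1}$, all three with mean zero and supported in compact sets; each $(x_k,y_k)$ has law $\pi$. For $N_2\in\mathbb N$ the network of widths $(N_1,N_2)$ with parameters $C^i,W^{2,j,i},W^{1,j}$ ($i\le N_2$, $j\le N_1$) has output $g(x)=N_2^{-\gamma_2}\sum_{i=1}^{N_2} C^iH^{2,i}(x)$,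 where $H^{1,j}(x)=\sigma(W^{1,j}\cdot x)$, $Z^{2,i}(x)=N_1^{-\gamma_1}\sum_{j=1}^{N_1}W^{2,j,i}H^{1,j}(x)$, $H^{2,i}(x)=\sigma(Z^{2,i}(x))$. Started from $C^i_0,W^{2,j,i}_0,W^{1,j}_0$ it is trained by stochastic gradient descent (a subscript $k$ denotes the values after $k$ steps): $$C^i_{k+1}=C^i_k+\tfrac{\alpha_C}{N_2^{\gamma_2}}(y_k-g_k(x_k))H^{2,i}_k(x_k),$$ $$W^{1,j}_{k+1}=W^{1,j}_k+\tfrac{\alpha_{W,1}}{N_1^{\gamma_1}}(y_k-g_k(x_k))\Big(\tfrac1{N_2^{\gamma_2}}\sum_{i=1}^{N_2}C^i_k\sigma'(Z^{2,i}_k(x_k))W^{2,j,i}_k\Big)\sigma'(W^{1,j}_k\cdot x_k)\,x_k,$$ $$W^{2,j,i}_{k+1}=W^{2,j,i}_k+\tfrac{\alpha_{W,2}}{N_1^{\gamma_1}N_2^{\gamma_2}}(y_k-g_k(x_k))C^i_k\sigma'(Z^{2,i}_k(x_k))H^{1,j}_k(x_k),$$ with learning rates $\alpha_C=N_2^{-(2-2\gamma_2)}$,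 $\alpha_{W,1}=N_1^{-(1-2\gamma_1)}N_2^{-(3-2\gamma_2)}$, $\alpha_{W,2}=N_1^{-(1-2\gamma_1)}N_2^{-(2-2\gamma_2)}$. Write $\theta=(c,w^2,w^1)\in\mathbb R\times\mathbb R^{N_1}\times(\mathbb R^d)^{N_1}=\mathbb R^{1+N_1(1+d)}$ and $\langle f,\nu\rangle=\int f\,d\nu$. Let $\gamma^{N_1,N_2}_t$ be the empirical measure $\frac1{N_2}\sum_{i=1}^{N_2}\delta_{(C^i_k,(W^{2,j,i}_k)_j,(W^{1,j}_k)_j)}$ at $k=\lfloor N_2t\rfloor$, and let $\gamma_0^{N_1}=\mu_C\times\mu_{W^2}^{\otimes N_1}\times\delta_{(W_0^{1,1},\dots,W_0^{1,N_1})}$ (a random measure, through the initial inner weights $W_0^{1,j}$). **Limit objects.** Let $Z_x(\theta)=N_1^{-\gamma_1}\sum_jw^{2,j}\sigma(w^{1,j}\cdot x)$ and $$B^1_{x,x'}=\sigma(Z_{x'})\sigma(Z_x),\quad B^{2,j}_{x,x'}=c^2\sigma'(Z_{x'})\sigma'(Z_x)\sigma(w^{1,j}\cdot x')\sigma(w^{1,j}\cdot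 x),\quad B^{3,j}_x=c\,w^{2,j}\sigma'(w^{1,j}\cdot x)\sigma'(Z_x),$$ $$A_{x,x'}=\langle B^1_{x,x'},\gamma_0^{N_1}\rangle+\tfrac1{N_1}\sum_{j}\big[\langle B^{2,j}_{x,x'},\gamma_0^{N_1}\rangle+(x\cdot x')\langle B^{3,j}_x,\gamma_0^{N_1}\rangle\langle B^{3,j}_{x'},\gamma_0^{N_1}\rangle\big].$$ For differentiable $f$ and $a\in\mathbb R^{N_1}$ put $$D^C_{x'}f=\partial_cf\,\sigma(Z_{x'}),\quad D^{2}_{x'}f=\sum_jc\,\sigma'(Z_{x'})\sigma(w^{1,j}\cdot x')\,\partial_{w^{2,j}}f,\quad D^{1,a}_{x'}f=\sum_ja_j\,\nabla_{w^{1,j}}f\cdot x',$$ $$C^f_{x'}=D^C_{x'}f+N_1^{-(1-\gamma_1)}D^2_{x'}f+N_1^{-(1-\gamma_1)}D^{1,b(x')}_{x'}f,\qquad b_j(x')=\langle B^{3,j}_{x'},\gamma_0^{N_1}\rangle .$$ Let $h_t(x)$ be the unique continuous solution ($t\ge0$, $x\in\mathbb R^d$) of $h_t(x)=\int_0^t\!\int(y-h_s(x'))A_{x,x'}\,\pi(dx',dy)\,ds$;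 let $l_t(f)=\int_0^t\!\int(y-h_s(x'))\langle C^f_{x'},\gamma_0^{N_1}\rangle\,\pi(dx',dy)\,ds$; and let $K_t(x)$ be the unique continuous solution of $$\begin{aligned}K_t(x)=&\int_0^t\!\!\int(y-h_s(x'))\Big[l_s(B^1_{x,x'})+\tfrac1{N_1}\sum_jl_s(B^{2,j}_{x,x'})\Big]\pi(dx',dy)ds\\&+\tfrac1{N_1}\sum_j\int_0^t\!\!\int(y-h_s(x'))(x\cdot x')\big[l_s(B^{3,j}_x)\,b_j(x')+b_j(x)\,l_s(B^{3,j}_{x'})\big]\pi(dx',dy)ds\\&-\int_0^t\!\!\int K_s(x')A_{x,x'}\,\pi(dx',dy)ds.\end{aligned}$$ **Statement.** Let $\varphi=1-\gamma_2$, let $\zeta\le2\varphi$ be real, and let $f\in C^3_b(\mathbb R^{1+N_1(1+d)})$ (three times continuously differentiable and bounded). Put $$l^{N_1,N_2}_t(f)=N_2^{\varphi}\langle f,\gamma^{N_1,N_2}_t-\gamma_0^{N_1}\rangle,\qquad L^{N_1,N_2}_t(f)=N_2^{\zeta-\varphi}\big(l^{N_1,N_2}_t(f)-l_t(f)\big),\quad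 t\in[0,T].$$ Then, as $N_2\to\infty$, the processes $L^{N_1,N_2}(f)$ converge in probability in the Skorokhod space $D_{\mathbb R}([0,T])$: 1. if $\zeta<2\varphi=2-2\gamma_2$, the limit is $0$; 2. if $\zeta=2\varphi=2-2\gamma_2$, the limit is the process $$\begin{aligned}L_t(f)=&\int_0^t\!\!\int(y-h_s(x'))\,l_s\big(D^C_{x'}f\big)\,\pi(dx',dy)ds+N_1^{-(1-\gamma_1)}\int_0^t\!\!\int(y-h_s(x'))\,l_s\big(D^2_{x'}f\big)\,\pi(dx',dy)ds\\&+N_1^{-(1-\gamma_1)}\int_0^t\!\!\int(y-h_s(x'))\,l_s\big(D^{1,b(x')}_{x'}f\big)\,\pi(dx',dy)ds\\&+N_1^{-(1-\gamma_1)}\int_0^t\!\!\int(y-h_s(x'))\,\big\langle D^{1,\,(l_s(B^{3,j}_{x'}))_j}_{x'}f,\gamma_0^{N_1}\big\rangle\,\pi(dx',dy)ds-\int_0^t\!\!\int K_s(x')\langle C^f_{x'},\gamma_0^{N_1}\rangle\,\pi(dx',dy)ds,\end{aligned}$$ which is a deterministic function of the initial inner weights $(W^{1,j}_0)_{j\le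 N_1}$. -/

import Mathlib

open MeasureTheory ProbabilityTheory Filter Topology
open scoped ENNReal

namespace DeepNet

noncomputable section

/-- `ℝᵈ` with its `ℓ²` inner product. -/
abbrev Vec (d : ℕ) := EuclideanSpace ℝ (Fin d)

/-- The parameter space `ℝ^{1+N₁(1+d)}`: a point is `θ = (c, w², w¹)` with `c ∈ ℝ`,
`w² = (w^{2,1}, …, w^{2,N₁})` and `w¹ = (w^{1,1}, …, w^{1,N₁})`, each `w^{1,j} ∈ ℝᵈ`. -/
abbrev Theta (d N₁ : ℕ) := ℝ × (Fin N₁ → ℝ) × (Fin N₁ → Vec d)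

/-- `C_b^n`: `n` times continuously differentiable and bounded. (No bound on the derivatives is
asked for, so this contains the functions all of whose derivatives are bounded as well.) -/
def IsCb {E : Type*} [NormedAddCommGroup E] [NormedSpace ℝ E] (n : WithTop ℕ∞) (g : E → ℝ) :
    Prop :=
  ContDiff ℝ n g ∧ ∃ B : ℝ, ∀ θ, |g θ| ≤ B

/-! ### The Skorokhod space -/

/-- `x` is càdlàg on `[0,T]`: right continuous with left limits. -/
def IsCadlag {T : ℝ} (x : Set.Icc (0 : ℝ) T → ℝ) : Prop :=
  ∀ t, ContinuousWithinAt x (Set.Ici t) t ∧ ∃ l : ℝ, Tendsto x (𝓝[<] t) (𝓝 l)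

/-- The Skorokhod (`J₁`) distance on `D_ℝ([0,T])`: the infimum, over all increasing
homeomorphisms `τ` of `[0,T]`, of `max (sup_t |τ t - t|) (sup_t |x t - y (τ t)|)`. -/
def skorokhodDist {T : ℝ} (x y : Set.Icc (0 : ℝ) T → ℝ) : ℝ≥0∞ :=
  ⨅ τ : Set.Icc (0 : ℝ) T ≃o Set.Icc (0 : ℝ) T,
    max (⨆ t, edist (τ t) t) (⨆ t, edist (x t) (y (τ t)))

/-- The processes `X n` have paths in `D_ℝ([0,T])` and converge, in probability in that space
with its Skorokhod distance, to the process `Y`, which has paths in `D_ℝ([0,T])` too. -/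
def TendstoInProbabilityD {Ω : Type*} [MeasurableSpace Ω] (P : Measure Ω) (T : ℝ)
    (X : ℕ → Ω → ℝ → ℝ) (Y : Ω → ℝ → ℝ) : Prop :=
  (∀ n ω, IsCadlag (fun t : Set.Icc (0 : ℝ) T => X n ω t)) ∧
  (∀ ω, IsCadlag (fun t : Set.Icc (0 : ℝ) T => Y ω t)) ∧
  ∀ ε : ℝ≥0∞, 0 < ε →
    Tendsto (fun n => P {ω | ε ≤ skorokhodDist (fun t : Set.Icc (0 : ℝ) T => X n ω t)
      (fun t : Set.Icc (0 : ℝ) T => Y ω t)}) atTop (𝓝 0)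

/-! ### The network and its training -/

/-- The data of the problem: activation function, scaling exponents, data set, and the laws of the
initial parameters. -/
structure Model (d N₁ M : ℕ) where
  /-- activation function -/
  σ : ℝ → ℝ
  /-- scaling exponent of the inner layer -/
  γ₁ : ℝ
  /-- scaling exponent of the outer layer -/
  γ₂ : ℝ
  /-- inputs of the data set -/
  x : Fin M → Vec d
  /-- outputs of the data set -/
  y : Fin M → ℝ
  /-- law of the initial `C^i` -/
  μC : Measure ℝ
  /-- law of the initial `W^{2,j,i}` -/
  μW₂ : Measure ℝ
  /-- law of the initial `W^{1,j}` -/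
  μW₁ : Measure (Vec d)

variable {d N₁ M : ℕ}

/-- The parameters of a network with `N₂` units in the outer hidden layer. -/
structure Params (d N₁ N₂ : ℕ) where
  /-- `C^i` -/
  C : Fin N₂ → ℝ
  /-- `W^{2,j,i}` -/
  W₂ : Fin N₁ → Fin N₂ → ℝ
  /-- `W^{1,j}` -/
  W₁ : Fin N₁ → Vec d

namespace Model

variable (m : Model d N₁ M)

/-- The empirical distribution `π = M⁻¹ ∑ᵢ δ_{(x⁽ⁱ⁾, y⁽ⁱ⁾)}` of the data set. -/
def π : Measure (Vec d × ℝ) :=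
  (M : ℝ≥0∞)⁻¹ • ∑ i, Measure.dirac (m.x i, m.y i)

/-- `H^{1,j}(x) = σ(W^{1,j} x)`. -/
def H₁ {N₂ : ℕ} (p : Params d N₁ N₂) (j : Fin N₁) (x : Vec d) : ℝ :=
  m.σ (inner ℝ (p.W₁ j) x)

/-- `Z^{2,i}(x) = N₁^{-γ₁} ∑ⱼ W^{2,j,i} H^{1,j}(x)`. -/
def Z₂ {N₂ : ℕ} (p : Params d N₁ N₂) (i : Fin N₂) (x : Vec d) : ℝ :=
  1 / (N₁ : ℝ) ^ m.γ₁ * ∑ j, p.W₂ j i * m.H₁ p j x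

/-- `H^{2,i}(x) = σ(Z^{2,i}(x))`. -/
def H₂ {N₂ : ℕ} (p : Params d N₁ N₂) (i : Fin N₂) (x : Vec d) : ℝ :=
  m.σ (m.Z₂ p i x)

/-- The network output `g_θ(x) = N₂^{-γ₂} ∑ᵢ C^i H^{2,i}(x)`. -/
def output {N₂ : ℕ} (p : Params d N₁ N₂) (x : Vec d) : ℝ :=
  1 / (N₂ : ℝ) ^ m.γ₂ * ∑ i, p.C i * m.H₂ p i x

/-- Learning rate of the `C^i`. -/
def αC (N₂ : ℕ) : ℝ := 1 / (N₂ : ℝ) ^ (2 - 2 * m.γ₂)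

/-- Learning rate of the `W^{1,j}`. -/
def αW₁ (N₂ : ℕ) : ℝ := 1 / ((N₁ : ℝ) ^ (1 - 2 * m.γ₁) * (N₂ : ℝ) ^ (3 - 2 * m.γ₂))

/-- Learning rate of the `W^{2,j,i}`. -/
def αW₂ (N₂ : ℕ) : ℝ := 1 / ((N₁ : ℝ) ^ (1 - 2 * m.γ₁) * (N₂ : ℝ) ^ (2 - 2 * m.γ₂))

/-- One step of stochastic gradient descent with the sample `z = (x_k, y_k)`. -/
def sgdStep {N₂ : ℕ} (p : Params d N₁ N₂) (z : Vec d × ℝ) : Params d N₁ N₂ where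
  C i := p.C i + m.αC N₂ / (N₂ : ℝ) ^ m.γ₂ * (z.2 - m.output p z.1) * m.H₂ p i z.1
  W₂ j i := p.W₂ j i + m.αW₂ N₂ / ((N₁ : ℝ) ^ m.γ₁ * (N₂ : ℝ) ^ m.γ₂) *
    (z.2 - m.output p z.1) * p.C i * deriv m.σ (m.Z₂ p i z.1) * m.H₁ p j z.1
  W₁ j := p.W₁ j + (m.αW₁ N₂ / (N₁ : ℝ) ^ m.γ₁ * (z.2 - m.output p z.1) *
    (1 / (N₂ : ℝ) ^ m.γ₂ * ∑ i, p.C i * deriv m.σ (m.Z₂ p i z.1) * p.W₂ j i) *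
    deriv m.σ (inner ℝ (p.W₁ j) z.1)) • z.1

/-- The parameters after `k` steps of stochastic gradient descent, started from `p` and run along
the samples `z 0, z 1, …`. -/
def sgd {N₂ : ℕ} (p : Params d N₁ N₂) (z : ℕ → Vec d × ℝ) : ℕ → Params d N₁ N₂
  | 0 => p
  | k + 1 => m.sgdStep (sgd p z k) (z k)

end Model

/-- The empirical measure `N₂⁻¹ ∑ᵢ δ_{(C^i, W^{2,1,i}, …, W^{2,N₁,i}, W^{1,1}, …, W^{1,N₁})}`. -/
def Params.empirical {N₂ : ℕ} (p : Params d N₁ N₂) : Measure (Theta d N₁) :=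
  (N₂ : ℝ≥0∞)⁻¹ • ∑ i, Measure.dirac (p.C i, fun j => p.W₂ j i, p.W₁)

/-! ### Randomness -/

/-- The random inputs: the initial parameters (the first `N₂` of the `C^i`, `W^{2,j,i}` initialize
the network of width `N₂`) and the samples drawn by stochastic gradient descent. -/
structure Noise (d N₁ : ℕ) (Ω : Type*) where
  /-- `C^i_0` -/
  C : ℕ → Ω → ℝ
  /-- `W^{2,j,i}_0` -/
  W₂ : Fin N₁ → ℕ → Ω → ℝ
  /-- `W^{1,j}_0` -/
  W₁ : Fin N₁ → Ω → Vec d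
  /-- `(x_k, y_k)` -/
  z : ℕ → Ω → Vec d × ℝ

/-- Names of the elementary random variables. -/
inductive NoiseIndex (N₁ : ℕ)
  | C (i : ℕ)
  | W₂ (j : Fin N₁) (i : ℕ)
  | W₁ (j : Fin N₁)
  | z (k : ℕ)

/-- The σ-algebra generated by an elementary random variable. -/
@[reducible] def Noise.sigma {Ω : Type*} (W : Noise d N₁ Ω) : NoiseIndex N₁ → MeasurableSpace Ω
  | .C i => MeasurableSpace.comap (W.C i) inferInstance
  | .W₂ j i => MeasurableSpace.comap (W.W₂ j i) inferInstance
  | .W₁ j => MeasurableSpace.comap (W.W₁ j) inferInstance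
  | .z k => MeasurableSpace.comap (W.z k) inferInstance

/-- The standing assumptions: smooth bounded activation function; mutually independent initial
parameters and samples; in each layer identically distributed, mean-zero, compactly supported
initial parameters; samples distributed according to `π`. -/
structure Assumptions {Ω : Type*} [MeasurableSpace Ω] (P : Measure Ω) (m : Model d N₁ M)
    (W : Noise d N₁ Ω) : Prop where
  activation : IsCb ((⊤ : ℕ∞) : WithTop ℕ∞) m.σ
  measurable_C : ∀ i, Measurable (W.C i)
  measurable_W₂ : ∀ j i, Measurable (W.W₂ j i)
  measurable_W₁ : ∀ j, Measurable (W.W₁ j)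
  measurable_z : ∀ k, Measurable (W.z k)
  independent : iIndep W.sigma P
  law_C : ∀ i, P.map (W.C i) = m.μC
  law_W₂ : ∀ j i, P.map (W.W₂ j i) = m.μW₂
  law_W₁ : ∀ j, P.map (W.W₁ j) = m.μW₁
  law_z : ∀ k, P.map (W.z k) = m.π
  mean_C : ∫ c, c ∂m.μC = 0
  mean_W₂ : ∫ w, w ∂m.μW₂ = 0
  mean_W₁ : ∫ w, w ∂m.μW₁ = 0
  compact_C : ∃ S, IsCompact S ∧ ∀ᵐ c ∂m.μC, c ∈ S
  compact_W₂ : ∃ S, IsCompact S ∧ ∀ᵐ w ∂m.μW₂, w ∈ S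
  compact_W₁ : ∃ S, IsCompact S ∧ ∀ᵐ w ∂m.μW₁, w ∈ S

/-- The initial parameters of the network of width `N₂`. -/
def Noise.init {Ω : Type*} (W : Noise d N₁ Ω) (N₂ : ℕ) (ω : Ω) : Params d N₁ N₂ where
  C i := W.C i ω
  W₂ j i := W.W₂ j i ω
  W₁ j := W.W₁ j ω

namespace Model

variable (m : Model d N₁ M)

/-- The time-scaled empirical measure `γ_t^{N₁,N₂}`: the empirical measure of the parameters after
`⌊N₂ t⌋` steps. -/
def γ {Ω : Type*} (W : Noise d N₁ Ω) (N₂ : ℕ) (ω : Ω) (t : ℝ) : Measure (Theta d N₁) :=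
  (m.sgd (W.init N₂ ω) (fun k => W.z k ω) ⌊(N₂ : ℝ) * t⌋₊).empirical

/-- The limit `γ₀^{N₁} = μ_C × μ_{W²}^{N₁} × δ_{w¹}` of the initial empirical measures, given the
initial inner weights `w¹ = (W^{1,1}_0, …, W^{1,N₁}_0)`. -/
def γ₀ (w₁ : Fin N₁ → Vec d) : Measure (Theta d N₁) :=
  m.μC.prod ((Measure.pi fun _ : Fin N₁ => m.μW₂).prod (Measure.dirac w₁))

/-- `l_t^{N₁,N₂}(f) = N₂^φ ⟨f, γ_t^{N₁,N₂} - γ₀^{N₁}⟩`. -/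
def lPre {Ω : Type*} (W : Noise d N₁ Ω) (φ : ℝ) (f : Theta d N₁ → ℝ) (N₂ : ℕ) (ω : Ω) (t : ℝ) :
    ℝ :=
  (N₂ : ℝ) ^ φ * (∫ θ, f θ ∂(m.γ W N₂ ω t) - ∫ θ, f θ ∂(m.γ₀ fun j => W.W₁ j ω))

/-! ### Limiting quantities

In what follows `ν` plays the role of `γ₀^{N₁}`. -/

/-- `Z^{2,N₁}(x)` as a function of `θ`. -/
def Z (x : Vec d) (θ : Theta d N₁) : ℝ :=
  1 / (N₁ : ℝ) ^ m.γ₁ * ∑ j, θ.2.1 j * m.σ (inner ℝ (θ.2.2 j) x)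

/-- `B¹_{x,x'}(θ) = σ(Z(x')) σ(Z(x))`. -/
def B₁ (x x' : Vec d) (θ : Theta d N₁) : ℝ :=
  m.σ (m.Z x' θ) * m.σ (m.Z x θ)

/-- `B^{2,j}_{x,x'}(θ) = c² σ'(Z(x')) σ'(Z(x)) σ(w^{1,j} x') σ(w^{1,j} x)`. -/
def B₂ (j : Fin N₁) (x x' : Vec d) (θ : Theta d N₁) : ℝ :=
  θ.1 ^ 2 * deriv m.σ (m.Z x' θ) * deriv m.σ (m.Z x θ) * m.σ (inner ℝ (θ.2.2 j) x') *
    m.σ (inner ℝ (θ.2.2 j) x)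

/-- `B^{3,j}_x(θ) = c w^{2,j} σ'(w^{1,j} x) σ'(Z(x))`. -/
def B₃ (j : Fin N₁) (x : Vec d) (θ : Theta d N₁) : ℝ :=
  θ.1 * θ.2.1 j * deriv m.σ (inner ℝ (θ.2.2 j) x) * deriv m.σ (m.Z x θ)

/-- The kernel `A^{N₁}_{x,x'}`. -/
def A (ν : Measure (Theta d N₁)) (x x' : Vec d) : ℝ :=
  (∫ θ, m.B₁ x x' θ ∂ν) + 1 / (N₁ : ℝ) * ∑ j, ((∫ θ, m.B₂ j x x' θ ∂ν) +
    inner ℝ x x' * (∫ θ, m.B₃ j x θ ∂ν) * (∫ θ, m.B₃ j x' θ ∂ν))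

end Model

/-- `∂_c f(θ)`. -/
def dC (f : Theta d N₁ → ℝ) (θ : Theta d N₁) : ℝ :=
  fderiv ℝ f θ (1, 0, 0)

/-- `∂_{w^{2,j}} f(θ)`. -/
def dW₂ (j : Fin N₁) (f : Theta d N₁ → ℝ) (θ : Theta d N₁) : ℝ :=
  fderiv ℝ f θ (0, Pi.single j 1, 0)

/-- `∇_{w^{1,j}} f(θ) · x`. -/
def dW₁ (j : Fin N₁) (x : Vec d) (f : Theta d N₁ → ℝ) (θ : Theta d N₁) : ℝ :=
  fderiv ℝ f θ (0, 0, Pi.single j x)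

/-- `a · ∇_{w¹} f(θ) x'` for a vector `a ∈ ℝ^{N₁}`. -/
def driftW₁ (a : Fin N₁ → ℝ) (f : Theta d N₁ → ℝ) (x' : Vec d) (θ : Theta d N₁) : ℝ :=
  ∑ j, a j * dW₁ j x' f θ

namespace Model

variable (m : Model d N₁ M)

/-- `∂_c f(θ) σ(Z(x'))`. -/
def driftC (f : Theta d N₁ → ℝ) (x' : Vec d) (θ : Theta d N₁) : ℝ :=
  dC f θ * m.σ (m.Z x' θ)

/-- `c σ'(Z(x')) σ(w¹ x') · ∂_{w²} f(θ)`. -/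
def driftW₂ (f : Theta d N₁ → ℝ) (x' : Vec d) (θ : Theta d N₁) : ℝ :=
  ∑ j, θ.1 * deriv m.σ (m.Z x' θ) * m.σ (inner ℝ (θ.2.2 j) x') * dW₂ j f θ

/-- The vector `⟨c σ'(Z(x')) σ'(w¹ x') w², ν⟩ ∈ ℝ^{N₁}`, with entries `⟨B^{3,j}_{x'}, ν⟩`. -/
def meanB₃ (ν : Measure (Theta d N₁)) (x' : Vec d) (j : Fin N₁) : ℝ :=
  ∫ θ, m.B₃ j x' θ ∂ν

/-- `C^{N₁,f}_{x'}(θ)`. -/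
def Cf (ν : Measure (Theta d N₁)) (f : Theta d N₁ → ℝ) (x' : Vec d) (θ : Theta d N₁) : ℝ :=
  m.driftC f x' θ + 1 / (N₁ : ℝ) ^ (1 - m.γ₁) * m.driftW₂ f x' θ +
    1 / (N₁ : ℝ) ^ (1 - m.γ₁) * driftW₁ (m.meanB₃ ν x') f x' θ

/-- `h` is a continuous solution of the evolution equation
`h_t(x) = ∫₀ᵗ ∫ (y - h_s(x')) A_{x,x'} π(dx',dy) ds`, `t ≥ 0`. -/
def IsOutputLimit (ν : Measure (Theta d N₁)) (h : ℝ → Vec d → ℝ) : Prop :=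
  (∀ x, ContinuousOn (fun t => h t x) (Set.Ici 0)) ∧
  ∀ t, 0 ≤ t → ∀ x, h t x =
    ∫ s in (0 : ℝ)..t, (∫ z, (z.2 - h s z.1) * m.A ν x z.1 ∂m.π)

/-- `l_t(f) = ∫₀ᵗ ∫ (y - h_s(x')) ⟨C^f_{x'}, ν⟩ π(dx',dy) ds`. -/
def lOf (ν : Measure (Theta d N₁)) (h : ℝ → Vec d → ℝ) (t : ℝ) (f : Theta d N₁ → ℝ) : ℝ :=
  ∫ s in (0 : ℝ)..t, (∫ z, (z.2 - h s z.1) * (∫ θ, m.Cf ν f z.1 θ ∂ν) ∂m.π)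

/-- `K` is a continuous solution of the evolution equation of the first order fluctuations of the
network output (with `K_0 = 0`), for given `h`. -/
def IsFluctuationLimit (ν : Measure (Theta d N₁)) (h K : ℝ → Vec d → ℝ) : Prop :=
  (∀ x, ContinuousOn (fun t => K t x) (Set.Ici 0)) ∧
  ∀ t, 0 ≤ t → ∀ x, K t x =
    (∫ s in (0 : ℝ)..t, (∫ z, (z.2 - h s z.1) *
      (m.lOf ν h s (m.B₁ x z.1) + 1 / (N₁ : ℝ) * ∑ j, m.lOf ν h s (m.B₂ j x z.1)) ∂m.π))
    + 1 / (N₁ : ℝ) * (∑ j, ∫ s in (0 : ℝ)..t, (∫ z, (z.2 - h s z.1) *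
      inner ℝ x z.1 * m.lOf ν h s (m.B₃ j x) * m.meanB₃ ν z.1 j ∂m.π))
    + 1 / (N₁ : ℝ) * (∑ j, ∫ s in (0 : ℝ)..t, (∫ z, (z.2 - h s z.1) *
      inner ℝ x z.1 * m.meanB₃ ν x j * m.lOf ν h s (m.B₃ j z.1) ∂m.π))
    - (∫ s in (0 : ℝ)..t, (∫ z, K s z.1 * m.A ν x z.1 ∂m.π))

/-! ### Existence of the limits `h` and `K` -/

theorem integral_π (F : Vec d × ℝ → ℝ) :
    ∫ z, F z ∂m.π = (M : ℝ)⁻¹ * ∑ i, F (m.x i, m.y i) := by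
  unfold π
  rw [integral_smul_measure, integral_finsetSum_measure]
  · simp
  · intro i _
    exact (integrable_dirac (by simp))

/-- A linear Volterra equation with a continuous source on `[0,∞)` has a continuous solution. -/
theorem exists_linear (a : Vec d → Vec d → ℝ) (g : ℝ → Vec d → ℝ)
    (hg : ∀ x, ContinuousOn (fun t => g t x) (Set.Ici 0)) :
    ∃ u : ℝ → Vec d → ℝ, (∀ x, Continuous fun t => u t x) ∧
      ∀ t, 0 ≤ t → ∀ x, u t x =
        ∫ s in (0 : ℝ)..t, (g s x - ∫ z, u s z.1 * a x z.1 ∂m.π) := by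
  -- extend the source to a continuous function on the whole line
  set G : ℝ → Vec d → ℝ := fun t x => g (max t 0) x with hG
  have hGc : ∀ x, Continuous fun t => G t x := fun x =>
    (hg x).comp_continuous (by fun_prop) (fun t => le_max_right t 0)
  -- the operator on the values at the data points
  let L : (Fin M → ℝ) →L[ℝ] (Fin M → ℝ) := LinearMap.toContinuousLinearMap
    (Matrix.toLin' (Matrix.of fun i j => (M : ℝ)⁻¹ * a (m.x i) (m.x j)))
  have hL : ∀ v i, L v i = (M : ℝ)⁻¹ * ∑ j, v j * a (m.x i) (m.x j) := by
    intro v i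
    simp only [L, LinearMap.coe_toContinuousLinearMap', Matrix.toLin'_apply, Matrix.mulVec,
      dotProduct, Matrix.of_apply, Finset.mul_sum]
    exact Finset.sum_congr rfl fun j _ => by ring
  let Gv : ℝ → Fin M → ℝ := fun t i => G t (m.x i)
  have hGv : Continuous Gv := continuous_pi fun i => hGc _
  let E : ℝ → ((Fin M → ℝ) →L[ℝ] (Fin M → ℝ)) := fun t => NormedSpace.exp (t • L)
  have hE : ∀ t, HasDerivAt E (L * E t) t := fun t => hasDerivAt_exp_smul_const' L t
  have hEc : Continuous E := continuous_iff_continuousAt.2 fun t => (hE t).continuousAt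
  have hEinv : ∀ t, E t * E (-t) = 1 := by
    intro t
    let _ : NormedAlgebra ℚ ((Fin M → ℝ) →L[ℝ] (Fin M → ℝ)) := NormedAlgebra.restrictScalars ℚ ℝ _
    have h1 : E t * E (-t) = NormedSpace.exp (t • L + (-t) • L) :=
      (NormedSpace.exp_add_of_commute
        (((Commute.refl L).smul_left t).smul_right (-t))).symm
    rw [h1, ← add_smul, add_neg_cancel, zero_smul, NormedSpace.exp_zero]
  let I : ℝ → Fin M → ℝ := fun t => ∫ s in (0 : ℝ)..t, E s (Gv s)
  have hcI : Continuous fun s => E s (Gv s) := hEc.clm_apply hGv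
  have hI : ∀ t, HasDerivAt I (E t (Gv t)) t := fun t =>
    intervalIntegral.integral_hasDerivAt_right (hcI.intervalIntegrable _ _)
      hcI.aestronglyMeasurable.stronglyMeasurableAtFilter hcI.continuousAt
  let v : ℝ → Fin M → ℝ := fun t => E (-t) (I t)
  have hv : ∀ t, HasDerivAt v (Gv t - L (v t)) t := by
    intro t
    have h1 : HasDerivAt (fun t => E (-t)) (-(L * E (-t))) t := by
      have h0 := (hE (-t)).scomp t (hasDerivAt_neg t)
      rw [neg_one_smul] at h0
      exact h0
    have h2 := h1.clm_apply (hI t)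
    have h3 : E (-t) (E t (Gv t)) = Gv t := by
      have := hEinv (-t)
      rw [neg_neg] at this
      exact congrArg (fun T : (Fin M → ℝ) →L[ℝ] (Fin M → ℝ) => T (Gv t)) this
    rw [h3] at h2
    refine h2.congr_deriv ?_
    change -(L (E (-t) (I t))) + Gv t = Gv t - L (E (-t) (I t))
    abel
  have hv0 : v 0 = 0 := by simp [v, I]
  have hvc : Continuous v := continuous_iff_continuousAt.2 fun t => (hv t).continuousAt
  have hvi : ∀ i t, HasDerivAt (fun t => v t i)
      (G t (m.x i) - (M : ℝ)⁻¹ * ∑ j, v t j * a (m.x i) (m.x j)) t := by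
    intro i t
    have := (hasDerivAt_pi.1 (hv t)) i
    simpa [Gv, hL] using this
  have hcont : ∀ x, Continuous fun s => G s x - (M : ℝ)⁻¹ * ∑ j, v s j * a x (m.x j) := by
    intro x
    have := hGc x
    fun_prop
  let u : ℝ → Vec d → ℝ := fun t x =>
    ∫ s in (0 : ℝ)..t, (G s x - (M : ℝ)⁻¹ * ∑ j, v s j * a x (m.x j))
  have huv : ∀ t i, u t (m.x i) = v t i := by
    intro t i
    have := intervalIntegral.integral_eq_sub_of_hasDerivAt (a := 0) (b := t)
      (fun s _ => hvi i s) ((hcont (m.x i)).intervalIntegrable _ _)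
    simpa [u, hv0] using this
  refine ⟨u, fun x => intervalIntegral.continuous_primitive
    (fun b c => (hcont x).intervalIntegrable b c) 0, fun t ht x => ?_⟩
  refine intervalIntegral.integral_congr fun s hs => ?_
  rw [Set.uIcc_of_le ht] at hs
  simp only [integral_π, huv, hG, max_eq_left hs.1]

theorem exists_isOutputLimit (ν : Measure (Theta d N₁)) : ∃ h, m.IsOutputLimit ν h := by
  obtain ⟨u, hu, hu'⟩ := m.exists_linear (m.A ν) (fun _ x => ∫ z, z.2 * m.A ν x z.1 ∂m.π)
    (fun x => continuousOn_const)
  refine ⟨u, fun x => (hu x).continuousOn, fun t ht x => ?_⟩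
  rw [hu' t ht x]
  refine intervalIntegral.integral_congr fun s _ => ?_
  simp only [integral_π, sub_mul, Finset.sum_sub_distrib, mul_sub]

theorem lOf_continuousOn (ν : Measure (Theta d N₁)) {h : ℝ → Vec d → ℝ}
    (hh : ∀ x, ContinuousOn (fun t => h t x) (Set.Ici 0)) (f : Theta d N₁ → ℝ) :
    ContinuousOn (fun t => m.lOf ν h t f) (Set.Ici 0) := by
  have hc : ∀ x, Continuous fun t => h (max t 0) x := fun x =>
    (hh x).comp_continuous (by fun_prop) (fun t => le_max_right t 0)
  have hF : Continuous fun s => (M : ℝ)⁻¹ * ∑ i, (m.y i - h (max s 0) (m.x i)) *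
      ∫ θ, m.Cf ν f (m.x i) θ ∂ν := by
    exact continuous_const.mul (continuous_finsetSum _ fun i _ =>
      (continuous_const.sub (hc (m.x i))).mul continuous_const)
  refine (intervalIntegral.continuous_primitive
    (μ := volume) (fun b c => hF.intervalIntegrable b c) 0).continuousOn.congr fun t ht => ?_
  refine intervalIntegral.integral_congr fun s hs => ?_
  rw [Set.uIcc_of_le ht] at hs
  simp only [integral_π, max_eq_left hs.1]

theorem exists_isFluctuationLimit (ν : Measure (Theta d N₁)) {h : ℝ → Vec d → ℝ}
    (hh : ∀ x, ContinuousOn (fun t => h t x) (Set.Ici 0)) :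
    ∃ K, m.IsFluctuationLimit ν h K := by
  have hl := m.lOf_continuousOn ν hh
  have c1 : ∀ x, ContinuousOn (fun s => ∫ z, (z.2 - h s z.1) *
      (m.lOf ν h s (m.B₁ x z.1) + 1 / (N₁ : ℝ) * ∑ j, m.lOf ν h s (m.B₂ j x z.1)) ∂m.π)
      (Set.Ici 0) := by
    intro x
    simp only [integral_π]
    fun_prop
  have c2 : ∀ x j, ContinuousOn (fun s => ∫ z, (z.2 - h s z.1) *
      inner ℝ x z.1 * m.lOf ν h s (m.B₃ j x) * m.meanB₃ ν z.1 j ∂m.π) (Set.Ici 0) := by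
    intro x j
    simp only [integral_π]
    fun_prop
  have c3 : ∀ x j, ContinuousOn (fun s => ∫ z, (z.2 - h s z.1) *
      inner ℝ x z.1 * m.meanB₃ ν x j * m.lOf ν h s (m.B₃ j z.1) ∂m.π) (Set.Ici 0) := by
    intro x j
    simp only [integral_π]
    fun_prop
  obtain ⟨u, hu, hu'⟩ := m.exists_linear (m.A ν) (fun s x =>
    (∫ z, (z.2 - h s z.1) *
      (m.lOf ν h s (m.B₁ x z.1) + 1 / (N₁ : ℝ) * ∑ j, m.lOf ν h s (m.B₂ j x z.1)) ∂m.π)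
    + 1 / (N₁ : ℝ) * (∑ j, (∫ z, (z.2 - h s z.1) *
      inner ℝ x z.1 * m.lOf ν h s (m.B₃ j x) * m.meanB₃ ν z.1 j ∂m.π))
    + 1 / (N₁ : ℝ) * (∑ j, (∫ z, (z.2 - h s z.1) *
      inner ℝ x z.1 * m.meanB₃ ν x j * m.lOf ν h s (m.B₃ j z.1) ∂m.π)))
    (fun x => by
      have := c1 x
      have := c2 x
      have := c3 x
      fun_prop)
  refine ⟨u, fun x => (hu x).continuousOn, fun t ht x => ?_⟩
  have hsub : Set.uIcc 0 t ⊆ Set.Ici 0 := by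
    rw [Set.uIcc_of_le ht]
    exact Set.Icc_subset_Ici_self
  have ii : ∀ {F : ℝ → ℝ}, ContinuousOn F (Set.Ici 0) → IntervalIntegrable F volume 0 t :=
    fun hF => (hF.mono hsub).intervalIntegrable
  have c4 : ContinuousOn (fun s => ∫ z, u s z.1 * m.A ν x z.1 ∂m.π) (Set.Ici 0) := by
    simp only [integral_π]
    fun_prop
  have i2 : IntervalIntegrable (fun s => ∑ j, (∫ z, (z.2 - h s z.1) *
      inner ℝ x z.1 * m.lOf ν h s (m.B₃ j x) * m.meanB₃ ν z.1 j ∂m.π)) volume 0 t :=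
    ii (by have := c2 x; fun_prop)
  have i3 : IntervalIntegrable (fun s => ∑ j, (∫ z, (z.2 - h s z.1) *
      inner ℝ x z.1 * m.meanB₃ ν x j * m.lOf ν h s (m.B₃ j z.1) ∂m.π)) volume 0 t :=
    ii (by have := c3 x; fun_prop)
  rw [hu' t ht x, intervalIntegral.integral_sub
      (((ii (c1 x)).add (i2.const_mul _)).add (i3.const_mul _)) (ii c4),
    intervalIntegral.integral_add ((ii (c1 x)).add (i2.const_mul _)) (i3.const_mul _),
    intervalIntegral.integral_add (ii (c1 x)) (i2.const_mul _),
    intervalIntegral.integral_const_mul, intervalIntegral.integral_const_mul,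
    intervalIntegral.integral_finsetSum (fun j _ => ii (c2 x j)),
    intervalIntegral.integral_finsetSum (fun j _ => ii (c3 x j))]

/-- The limit `h_t^{N₁}(x)` of the network output: the solution of its evolution equation. -/
def h (ν : Measure (Theta d N₁)) : ℝ → Vec d → ℝ :=
  (m.exists_isOutputLimit ν).choose

theorem h_spec (ν : Measure (Theta d N₁)) : m.IsOutputLimit ν (m.h ν) :=
  (m.exists_isOutputLimit ν).choose_spec

/-- The limit `l_t^{N₁}(f)` of `l_t^{N₁,N₂}(f)` for `φ = 1 - γ₂`. -/
def l (ν : Measure (Theta d N₁)) (t : ℝ) (f : Theta d N₁ → ℝ) : ℝ :=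
  m.lOf ν (m.h ν) t f

/-- The limit `K_t^{N₁}(x)` of the first order fluctuations of the network output for
`φ = 1 - γ₂`: the solution of its evolution equation. -/
def K (ν : Measure (Theta d N₁)) : ℝ → Vec d → ℝ :=
  (m.exists_isFluctuationLimit ν (m.h_spec ν).1).choose

theorem K_spec (ν : Measure (Theta d N₁)) : m.IsFluctuationLimit ν (m.h ν) (m.K ν) :=
  (m.exists_isFluctuationLimit ν (m.h_spec ν).1).choose_spec

/-- The limit `L_t^{N₁}(f)` of the second order fluctuations for `ζ = 2φ`. -/
def L (ν : Measure (Theta d N₁)) (f : Theta d N₁ → ℝ) (t : ℝ) : ℝ :=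
  (∫ s in (0 : ℝ)..t, (∫ z, (z.2 - m.h ν s z.1) * m.l ν s (m.driftC f z.1) ∂m.π))
  + 1 / (N₁ : ℝ) ^ (1 - m.γ₁) * (∫ s in (0 : ℝ)..t, (∫ z, (z.2 - m.h ν s z.1) *
      m.l ν s (m.driftW₂ f z.1) ∂m.π))
  + 1 / (N₁ : ℝ) ^ (1 - m.γ₁) * (∫ s in (0 : ℝ)..t, (∫ z, (z.2 - m.h ν s z.1) *
      m.l ν s (driftW₁ (m.meanB₃ ν z.1) f z.1) ∂m.π))
  + 1 / (N₁ : ℝ) ^ (1 - m.γ₁) * (∫ s in (0 : ℝ)..t, (∫ z, (z.2 - m.h ν s z.1) *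
      (∫ θ, driftW₁ (fun j => m.l ν s (m.B₃ j z.1)) f z.1 θ ∂ν) ∂m.π))
  - (∫ s in (0 : ℝ)..t, (∫ z, m.K ν s z.1 * (∫ θ, m.Cf ν f z.1 θ ∂ν) ∂m.π))

/-- The second order fluctuation
`L_t^{N₁,N₂}(f) = N₂^{ζ-φ} (l_t^{N₁,N₂}(f) - l_t^{N₁}(f))`. -/
def LPre {Ω : Type*} (W : Noise d N₁ Ω) (φ ζ : ℝ) (f : Theta d N₁ → ℝ) (N₂ : ℕ) (ω : Ω)
    (t : ℝ) : ℝ :=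
  (N₂ : ℝ) ^ (ζ - φ) * (m.lPre W φ f N₂ ω t - m.l (m.γ₀ fun j => W.W₁ j ω) t f)

end Model

end

end DeepNet

open DeepNet

set_option linter.unusedSectionVars false

/-! Write N = N₂ and β = N^φ. The unit (C^i, W^{2,·,i}, W¹) is regarded as a particle; the inner
weights are common to all particles. The learning rates are tuned so that one step moves a particle
by O(1/(βN)). After NT steps it is therefore only O(1/β) away from its starting point, and the
fluctuation β⟨F, γ_k − γ₀⟩ (`fluct`) is of order one. The output on the i-th data point is β⟨G_i⟩
with G_i = c σ(Z). Since c is centred and independent of the other coordinates, ⟨G_i, γ₀⟩ = 0, so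
the output is itself a fluctuation. Hence the equations close on the finitely many observables G_i,
and h and K are exactly the first and second order limits for F = G_i.

Randomness enters through two estimates. The initial error β²⟨F, γ_0^{N₁,N₂} − γ₀⟩ is of order
N^{2φ−1/2} by Chebyshev's inequality, which is where γ₂ > 3/4 is needed. The averages N⁻¹ ∑_{m<k}
(w_m − π) of the sample weights are o(1/β) uniformly in k ≤ NT, by Hoeffding's inequality and a
union bound. Everything else is deterministic and takes place on events whose probability tends to
one. These events form a filter (`inProb`); `upTo` and `before` add uniformity in the number of
steps, so the argument becomes a calculus of O and o along a filter.

A Taylor expansion of one step (`fluct_succ`) gives a recursion for `fluct F`. The sample weights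
are replaced by their means by summation by parts (`avg_mul_isLittleO`), because their coefficients
vary slowly. For e_F = β(`fluct F` − `lim F`), the quantity `fluct₂`, this yields e_F = N⁻¹ ∑_{m<k}
∑_i π_i ((y_i − out_i) β(drift − driftMean) − e_{G_i} driftMean) + o(1). By `driftFluct_eq` the
fluctuation of the drift is linear in first order fluctuations, up to O(1/β). A discrete Gronwall
inequality (`gronwall_bound`) is used twice. It first bounds e_{G_i}, hence every e_F; dividing by β
shows that `fluct` converges to `lim`, so the drift fluctuations converge as well. The difference
e_F − `lim₂ F` then solves a linear recursion with o(1) source, and the second use of Gronwall sends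
it to zero. Passing from F to its drift costs one derivative and the Taylor expansion costs two,
whence C³. All particles stay in one ball, so no bounds on derivatives are required.

It remains to check that the network fits this scheme (`sgdRun_step`, `exists_admissible`) and that
the abstract limits are h, K and L (`sgdRun_h_eq`, `sgdRun_κ_eq`, `L_eq_lim₂`). The process in
question is N^{ζ−2φ} e_f, up to the passage from steps to continuous time. -/

namespace DeepNet

open Asymptotics

/-! ### Uniformity in the number of steps -/

section Steps

variable {ι : Type*}

/-- `P` holds eventually along `unifFilter 𝓕 S` if, eventually along `𝓕`, it holds at `(a, k)` for
every `k ∈ S a`. -/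
def unifFilter (𝓕 : Filter ι) (S : ι → Set ℕ) : Filter (ι × ℕ) :=
  𝓕.bind fun a => 𝓟 (Prod.mk a '' S a)

theorem eventually_unifFilter {𝓕 : Filter ι} {S : ι → Set ℕ} {P : ι × ℕ → Prop} :
    (∀ᶠ p in unifFilter 𝓕 S, P p) ↔ ∀ᶠ a in 𝓕, ∀ k ∈ S a, P (a, k) := by
  simp [unifFilter, eventually_bind]

/-- Uniformity over the steps `0, …, n a`. -/
def upTo (𝓕 : Filter ι) (n : ι → ℕ) : Filter (ι × ℕ) := unifFilter 𝓕 fun a => Set.Iic (n a)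

/-- Uniformity over the steps `0, …, n a - 1`. -/
def before (𝓕 : Filter ι) (n : ι → ℕ) : Filter (ι × ℕ) := unifFilter 𝓕 fun a => Set.Iio (n a)

variable {𝓕 : Filter ι} {n : ι → ℕ}

theorem eventually_upTo {P : ι × ℕ → Prop} :
    (∀ᶠ p in upTo 𝓕 n, P p) ↔ ∀ᶠ a in 𝓕, ∀ k ≤ n a, P (a, k) := by
  simp [upTo, eventually_unifFilter]

theorem eventually_before {P : ι × ℕ → Prop} :
    (∀ᶠ p in before 𝓕 n, P p) ↔ ∀ᶠ a in 𝓕, ∀ k < n a, P (a, k) := by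
  simp [before, eventually_unifFilter]

theorem before_le_upTo : before 𝓕 n ≤ upTo 𝓕 n := fun s hs => by
  have := eventually_upTo.1 (show ∀ᶠ p in upTo 𝓕 n, p ∈ s from hs)
  exact eventually_before.2 (this.mono fun a ha k hk => ha k hk.le)

theorem tendsto_fst_upTo : Tendsto Prod.fst (upTo 𝓕 n) 𝓕 := fun _ hs =>
  eventually_upTo.2 (mem_of_superset hs fun _ ha _ _ => ha)

theorem tendsto_fst_before : Tendsto Prod.fst (before 𝓕 n) 𝓕 :=
  tendsto_fst_upTo.mono_left before_le_upTo

theorem tendsto_succ_before :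
    Tendsto (fun p : ι × ℕ => (p.1, p.2 + 1)) (before 𝓕 n) (upTo 𝓕 n) := fun s hs => by
  have := eventually_upTo.1 (show ∀ᶠ p in upTo 𝓕 n, p ∈ s from hs)
  exact eventually_before.2 (this.mono fun a ha k hk => ha (k + 1) hk)

theorem isBigO_upTo {X : ι × ℕ → ℝ} {b : ι → ℝ} :
    X =O[upTo 𝓕 n] (fun p => b p.1) ↔ ∃ K, 0 ≤ K ∧ ∀ᶠ a in 𝓕, ∀ k ≤ n a, |X (a, k)| ≤ K * |b a| := by
  constructor
  · intro h
    obtain ⟨K, hK, h⟩ := h.exists_nonneg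
    exact ⟨K, hK, by simpa using eventually_upTo.1 h.bound⟩
  · rintro ⟨K, -, h⟩
    exact IsBigO.of_bound K (eventually_upTo.2 (by simpa using h))

theorem isBigO_before {X : ι × ℕ → ℝ} {b : ι → ℝ} :
    X =O[before 𝓕 n] (fun p => b p.1) ↔ ∃ K, 0 ≤ K ∧ ∀ᶠ a in 𝓕, ∀ k < n a, |X (a, k)| ≤ K * |b a| := by
  constructor
  · intro h
    obtain ⟨K, hK, h⟩ := h.exists_nonneg
    exact ⟨K, hK, by simpa using eventually_before.1 h.bound⟩
  · rintro ⟨K, -, h⟩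
    exact IsBigO.of_bound K (eventually_before.2 (by simpa using h))

theorem isLittleO_upTo {X : ι × ℕ → ℝ} {b : ι → ℝ} :
    X =o[upTo 𝓕 n] (fun p => b p.1) ↔ ∀ δ > 0, ∀ᶠ a in 𝓕, ∀ k ≤ n a, |X (a, k)| ≤ δ * |b a| := by
  simp [isLittleO_iff, eventually_upTo]

theorem isLittleO_before {X : ι × ℕ → ℝ} {b : ι → ℝ} :
    X =o[before 𝓕 n] (fun p => b p.1) ↔ ∀ δ > 0, ∀ᶠ a in 𝓕, ∀ k < n a, |X (a, k)| ≤ δ * |b a| := by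
  simp [isLittleO_iff, eventually_before]

theorem isBigO_one_upTo {X : ι × ℕ → ℝ} :
    X =O[upTo 𝓕 n] (fun _ => (1 : ℝ)) ↔ ∃ K, 0 ≤ K ∧ ∀ᶠ a in 𝓕, ∀ k ≤ n a, |X (a, k)| ≤ K := by
  simpa using isBigO_upTo (𝓕 := 𝓕) (n := n) (X := X) (b := fun _ => 1)

theorem isBigO_one_before {X : ι × ℕ → ℝ} :
    X =O[before 𝓕 n] (fun _ => (1 : ℝ)) ↔ ∃ K, 0 ≤ K ∧ ∀ᶠ a in 𝓕, ∀ k < n a, |X (a, k)| ≤ K := by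
  simpa using isBigO_before (𝓕 := 𝓕) (n := n) (X := X) (b := fun _ => 1)

theorem isLittleO_one_upTo {X : ι × ℕ → ℝ} :
    X =o[upTo 𝓕 n] (fun _ => (1 : ℝ)) ↔ ∀ δ > 0, ∀ᶠ a in 𝓕, ∀ k ≤ n a, |X (a, k)| ≤ δ := by
  simpa using isLittleO_upTo (𝓕 := 𝓕) (n := n) (X := X) (b := fun _ => 1)

/-- The normalized partial sums `N⁻¹ ∑_{m < k} X_m`. -/
noncomputable def avg (N : ι → ℕ) (X : ι × ℕ → ℝ) (p : ι × ℕ) : ℝ :=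
  (N p.1 : ℝ)⁻¹ * ∑ m ∈ Finset.range p.2, X (p.1, m)

variable {N : ι → ℕ} {T : ℝ}

theorem avg_sub (X Y : ι × ℕ → ℝ) : avg N (fun p => X p - Y p) = fun p => avg N X p - avg N Y p := by
  funext p; simp [avg, Finset.sum_sub_distrib, mul_sub]

theorem avg_mul_left (c : ι → ℝ) (X : ι × ℕ → ℝ) :
    avg N (fun p => c p.1 * X p) = fun p => c p.1 * avg N X p := by
  funext p; simp only [avg, ← Finset.mul_sum]; ring

theorem avg_sum {I : Type*} (s : Finset I) (X : I → ι × ℕ → ℝ) :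
    avg N (fun p => ∑ i ∈ s, X i p) = fun p => ∑ i ∈ s, avg N (X i) p := by
  funext p
  simp only [avg]
  rw [Finset.sum_comm, Finset.mul_sum]

theorem abs_avg_le {X : ι × ℕ → ℝ} {a : ι} {k : ℕ} {K : ℝ} (hK : 0 ≤ K) (hN : 0 < N a)
    (hn : (n a : ℝ) ≤ N a * T) (hk : k ≤ n a) (hX : ∀ m < n a, |X (a, m)| ≤ K) :
    |avg N X (a, k)| ≤ T * K := by
  have hN' : (0 : ℝ) < N a := by exact_mod_cast hN
  have h1 : |∑ m ∈ Finset.range k, X (a, m)| ≤ k * K := by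
    refine (Finset.abs_sum_le_sum_abs _ _).trans ?_
    refine (Finset.sum_le_card_nsmul _ _ K fun m hm =>
      hX m ((Finset.mem_range.1 hm).trans_le hk)).trans ?_
    simp
  have h2 : (k : ℝ) ≤ N a * T := le_trans (by exact_mod_cast hk) hn
  rw [avg, abs_mul, abs_of_nonneg (by positivity), inv_mul_le_iff₀ hN']
  calc _ ≤ k * K := h1
    _ ≤ N a * T * K := by gcongr
    _ = _ := by ring

theorem avg_isBigO {X : ι × ℕ → ℝ} {b : ι → ℝ} (hN : ∀ᶠ a in 𝓕, 0 < N a)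
    (hn : ∀ᶠ a in 𝓕, (n a : ℝ) ≤ N a * T) (hT : 0 ≤ T) (hX : X =O[before 𝓕 n] fun p => b p.1) :
    avg N X =O[upTo 𝓕 n] fun p => b p.1 := by
  obtain ⟨K, hK, h⟩ := isBigO_before.1 hX
  refine isBigO_upTo.2 ⟨T * K, by positivity, ?_⟩
  filter_upwards [hN, hn, h] with a h1 h2 h3 k hk
  rw [mul_assoc]
  exact abs_avg_le (by positivity) h1 h2 hk h3

theorem avg_isLittleO {X : ι × ℕ → ℝ} {b : ι → ℝ} (hN : ∀ᶠ a in 𝓕, 0 < N a)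
    (hn : ∀ᶠ a in 𝓕, (n a : ℝ) ≤ N a * T) (hT : 0 < T) (hX : X =o[before 𝓕 n] fun p => b p.1) :
    avg N X =o[upTo 𝓕 n] fun p => b p.1 := by
  refine isLittleO_upTo.2 fun δ hδ => ?_
  filter_upwards [hN, hn, isLittleO_before.1 hX (δ / T) (by positivity)] with a h1 h2 h3 k hk
  refine (abs_avg_le (by positivity) h1 h2 hk h3).trans_eq ?_
  field_simp

/-- A discrete Gronwall inequality. -/
theorem le_mul_exp_of_le_add_sum {x : ℕ → ℝ} {ρ c : ℝ} {k : ℕ} (hc : 0 ≤ c) (hρ : 0 ≤ ρ)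
    (h : ∀ j ≤ k, x j ≤ ρ + c * ∑ m ∈ Finset.range j, x m) : x k ≤ ρ * Real.exp (c * k) := by
  -- The induction is run on the right-hand side of the hypothesis, which satisfies a one-step
  -- recursion; `x` itself is only bounded by it.
  have key : ∀ j ≤ k, ρ + c * ∑ m ∈ Finset.range j, x m ≤ ρ * (1 + c) ^ j := by
    intro j
    induction j with
    | zero => simp
    | succ j ih =>
      intro hj
      have h1 := ih (by omega)
      have h2 := h j (by omega)
      rw [Finset.sum_range_succ, pow_succ]
      have : c * x j ≤ c * (ρ * (1 + c) ^ j) := by gcongr; linarith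
      nlinarith
  refine (h k le_rfl).trans ((key k le_rfl).trans ?_)
  gcongr
  rw [mul_comm, Real.exp_nat_mul]
  gcongr
  linarith [Real.add_one_le_exp c]

/-- The discrete Gronwall inequality for a linear system of recursions, uniformly in the step. -/
theorem gronwall_bound {I : Type*} [Fintype I] {e r : I → ι × ℕ → ℝ}
    {c : I → I → ι × ℕ → ℝ} (hN : ∀ᶠ a in 𝓕, 0 < N a)
    (hn : ∀ᶠ a in 𝓕, (n a : ℝ) ≤ N a * T)
    (hc : ∀ i j, c i j =O[before 𝓕 n] fun _ => (1 : ℝ))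
    (he : ∀ i, ∀ᶠ p in upTo 𝓕 n, e i p = r i p + avg N (fun p => ∑ j, c i j p * e j p) p) :
    ∃ C, 0 < C ∧ ∀ᶠ a in 𝓕, ∀ ρ, 0 ≤ ρ → (∀ i, ∀ k ≤ n a, |r i (a, k)| ≤ ρ) →
      ∀ i, ∀ k ≤ n a, |e i (a, k)| ≤ C * ρ := by
  have hc' : ∀ i j, ∃ K, 0 ≤ K ∧ ∀ᶠ a in 𝓕, ∀ k < n a, |c i j (a, k)| ≤ K := fun i j =>
    isBigO_one_before.1 (hc i j)
  choose K hK0 hK using hc'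
  set Km := ∑ i, ∑ j, K i j with hKm
  have hKm0 : 0 ≤ Km := Finset.sum_nonneg fun i _ => Finset.sum_nonneg fun j _ => hK0 i j
  have hle : ∀ j, ∑ i, K i j ≤ Km := fun j => by
    rw [hKm, Finset.sum_comm]
    exact Finset.single_le_sum (f := fun j => ∑ i, K i j)
      (fun j _ => Finset.sum_nonneg fun i _ => hK0 i j) (Finset.mem_univ j)
  -- The constant is fixed before `ρ`, so that both the O and the o versions follow. Gronwall is
  -- applied to `∑ i, |e i|`, whose source is at most `card I * ρ`; the `+ 1` keeps the constant
  -- positive when `I` is empty.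
  refine ⟨(Fintype.card I + 1) * Real.exp (Km * T), by positivity, ?_⟩
  have he' : ∀ᶠ a in 𝓕, ∀ i, ∀ k ≤ n a,
      e i (a, k) = r i (a, k) + avg N (fun p => ∑ j, c i j p * e j p) (a, k) :=
    eventually_all.2 fun i => eventually_upTo.1 (he i)
  have hK' : ∀ᶠ a in 𝓕, ∀ i j, ∀ k < n a, |c i j (a, k)| ≤ K i j :=
    eventually_all.2 fun i => eventually_all.2 fun j => hK i j
  filter_upwards [hN, hn, he', hK'] with a h1 h2 h3 h4 ρ hρ hr i k hk
  have hN' : (0 : ℝ) < N a := by exact_mod_cast h1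
  have hx : ∀ j ≤ k, ∑ i, |e i (a, j)| ≤
      (Fintype.card I * ρ) + ((N a : ℝ)⁻¹ * Km) * ∑ m ∈ Finset.range j, ∑ i, |e i (a, m)| := by
    intro j hj
    have h5 : ∀ i, |e i (a, j)| ≤
        ρ + (N a : ℝ)⁻¹ * ∑ m ∈ Finset.range j, ∑ i', K i i' * |e i' (a, m)| := by
      intro i
      rw [h3 i j (hj.trans hk)]
      refine (abs_add_le _ _).trans (add_le_add (hr i j (hj.trans hk)) ?_)
      rw [avg, abs_mul, abs_of_nonneg (by positivity)]
      gcongr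
      refine (Finset.abs_sum_le_sum_abs _ _).trans (Finset.sum_le_sum fun m hm => ?_)
      refine (Finset.abs_sum_le_sum_abs _ _).trans (Finset.sum_le_sum fun i' _ => ?_)
      rw [abs_mul]
      gcongr
      exact h4 i i' m ((Finset.mem_range.1 hm).trans_le (hj.trans hk))
    refine (Finset.sum_le_sum fun i _ => h5 i).trans ?_
    rw [Finset.sum_add_distrib, Finset.sum_const, Finset.card_univ, nsmul_eq_mul,
      ← Finset.mul_sum, mul_assoc]
    gcongr
    rw [Finset.sum_comm, Finset.mul_sum]
    refine Finset.sum_le_sum fun m _ => ?_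
    rw [Finset.sum_comm, Finset.mul_sum]
    refine Finset.sum_le_sum fun i' _ => ?_
    rw [← Finset.sum_mul]
    gcongr
    exact hle i'
  have hg := le_mul_exp_of_le_add_sum (x := fun j => ∑ i, |e i (a, j)|)
    (by positivity) (by positivity) hx
  have hkT : (N a : ℝ)⁻¹ * Km * k ≤ Km * T := by
    have : (k : ℝ) ≤ N a * T := le_trans (by exact_mod_cast hk) h2
    calc (N a : ℝ)⁻¹ * Km * k ≤ (N a : ℝ)⁻¹ * Km * (N a * T) := by gcongr
      _ = _ := by field_simp
  calc |e i (a, k)| ≤ ∑ i, |e i (a, k)| :=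
        Finset.single_le_sum (f := fun i => |e i (a, k)|) (fun _ _ => abs_nonneg _)
          (Finset.mem_univ i)
    _ ≤ Fintype.card I * ρ * Real.exp ((N a : ℝ)⁻¹ * Km * k) := hg
    _ ≤ (Fintype.card I + 1) * ρ * Real.exp (Km * T) := by gcongr; linarith
    _ = _ := by ring

theorem gronwall_isBigO {I : Type*} [Fintype I] {e r : I → ι × ℕ → ℝ}
    {c : I → I → ι × ℕ → ℝ} (hN : ∀ᶠ a in 𝓕, 0 < N a)
    (hn : ∀ᶠ a in 𝓕, (n a : ℝ) ≤ N a * T)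
    (hc : ∀ i j, c i j =O[before 𝓕 n] fun _ => (1 : ℝ))
    (he : ∀ i, ∀ᶠ p in upTo 𝓕 n, e i p = r i p + avg N (fun p => ∑ j, c i j p * e j p) p)
    (hr : ∀ i, r i =O[upTo 𝓕 n] fun _ => (1 : ℝ)) (i : I) :
    e i =O[upTo 𝓕 n] fun _ => (1 : ℝ) := by
  obtain ⟨C, hC, h⟩ := gronwall_bound hN hn hc he
  choose K hK0 hK using fun i => isBigO_one_upTo.1 (hr i)
  refine isBigO_one_upTo.2 ⟨C * ∑ i, K i,
    mul_nonneg hC.le (Finset.sum_nonneg fun i _ => hK0 i), ?_⟩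
  filter_upwards [h, eventually_all.2 hK] with a h1 h2 k hk
  refine h1 _ (Finset.sum_nonneg fun i _ => hK0 i) (fun i k hk => (h2 i k hk).trans ?_) i k hk
  exact Finset.single_le_sum (f := K) (fun i _ => hK0 i) (Finset.mem_univ i)

theorem gronwall_isLittleO {I : Type*} [Fintype I] {e r : I → ι × ℕ → ℝ}
    {c : I → I → ι × ℕ → ℝ} (hN : ∀ᶠ a in 𝓕, 0 < N a)
    (hn : ∀ᶠ a in 𝓕, (n a : ℝ) ≤ N a * T)
    (hc : ∀ i j, c i j =O[before 𝓕 n] fun _ => (1 : ℝ))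
    (he : ∀ i, ∀ᶠ p in upTo 𝓕 n, e i p = r i p + avg N (fun p => ∑ j, c i j p * e j p) p)
    (hr : ∀ i, r i =o[upTo 𝓕 n] fun _ => (1 : ℝ)) (i : I) :
    e i =o[upTo 𝓕 n] fun _ => (1 : ℝ) := by
  obtain ⟨C, hC, h⟩ := gronwall_bound hN hn hc he
  refine isLittleO_one_upTo.2 fun δ hδ => ?_
  filter_upwards [h, eventually_all.2 fun i => isLittleO_one_upTo.1 (hr i) (δ / C) (by positivity)]
    with a h1 h2 k hk
  refine (h1 _ (by positivity) h2 i k hk).trans_eq ?_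
  field_simp

/-- Summation by parts: if the partial sums of `u` are small and `X` is slowly varying, then the
partial sums of `u X` are small. -/
theorem avg_mul_isLittleO {u X : ι × ℕ → ℝ} {b : ι → ℝ} (hN : ∀ᶠ a in 𝓕, 0 < N a)
    (hn : ∀ᶠ a in 𝓕, (n a : ℝ) ≤ N a * T) (hT : 0 < T)
    (hu : avg N u =o[upTo 𝓕 n] fun p => b p.1) (hX : X =O[upTo 𝓕 n] fun _ => (1 : ℝ))
    (hX' : (fun p : ι × ℕ => X (p.1, p.2 + 1) - X p) =O[before 𝓕 n] fun p => (N p.1 : ℝ)⁻¹) :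
    avg N (fun p => u p * X p) =o[upTo 𝓕 n] fun p => b p.1 := by
  -- Abel summation. The increment of `X` is multiplied by `N` to compensate the `N⁻¹` in `avg`. For
  -- `N a = 0` every average vanishes because `0⁻¹ = 0`.
  have abel : ∀ a k, avg N (fun p => u p * X p) (a, k) = avg N u (a, k) * X (a, k) -
      avg N (fun p => avg N u (p.1, p.2 + 1) * (N p.1 * (X (p.1, p.2 + 1) - X p))) (a, k) := by
    intro a k
    rcases Nat.eq_zero_or_pos (N a) with h0 | h0
    · simp [avg, h0]
    have h0' : (N a : ℝ) ≠ 0 := by positivity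
    induction k with
    | zero => simp [avg]
    | succ k ih =>
      have step : ∀ Y : ι × ℕ → ℝ, avg N Y (a, k + 1) = avg N Y (a, k) + (N a : ℝ)⁻¹ * Y (a, k) := by
        intro Y; simp [avg, Finset.sum_range_succ, mul_add]
      rw [step (fun p => u p * X p), ih, step (fun p => avg N u (p.1, p.2 + 1) * _)]
      simp only
      rw [step u]
      field_simp
      ring
  have h1 : (fun p : ι × ℕ => avg N u (p.1, p.2 + 1) * (N p.1 * (X (p.1, p.2 + 1) - X p)))
      =o[before 𝓕 n] fun p => b p.1 := by
    have hu' : (fun p : ι × ℕ => avg N u (p.1, p.2 + 1)) =o[before 𝓕 n] fun p => b p.1 :=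
      hu.comp_tendsto tendsto_succ_before
    have h2 : (fun p : ι × ℕ => (N p.1 : ℝ) * (X (p.1, p.2 + 1) - X p)) =O[before 𝓕 n]
        fun _ => (1 : ℝ) := by
      refine ((isBigO_refl (fun p : ι × ℕ => (N p.1 : ℝ)) _).mul hX').trans_eventuallyEq ?_
      filter_upwards [tendsto_fst_before.eventually hN] with p hp
      exact mul_inv_cancel₀ (by exact_mod_cast hp.ne')
    simpa using hu'.mul_isBigO h2
  have h3 : (fun p => avg N u p * X p) =o[upTo 𝓕 n] fun p => b p.1 := by
    simpa using hu.mul_isBigO hX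
  exact (h3.sub (avg_isLittleO hN hn hT h1)).congr_left fun p => (abel p.1 p.2).symm

end Steps

/-! ### Families of Lipschitz functions of time -/

section Time

variable {ι : Type*}

/-- The functions `X a` are, eventually along `𝓕`, uniformly bounded and uniformly Lipschitz on
`[0,T]`. -/
def UnifLip (𝓕 : Filter ι) (T : ℝ) (X : ι → ℝ → ℝ) : Prop :=
  ∃ K, 0 ≤ K ∧ ∀ᶠ a in 𝓕, ∀ s ∈ Set.Icc 0 T, |X a s| ≤ K ∧
    ∀ s' ∈ Set.Icc 0 T, |X a s - X a s'| ≤ K * |s - s'|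

variable {𝓕 : Filter ι} {T : ℝ} {X Y : ι → ℝ → ℝ}

theorem UnifLip.const {c : ι → ℝ} (hc : c =O[𝓕] fun _ => (1 : ℝ)) :
    UnifLip 𝓕 T fun a _ => c a := by
  obtain ⟨K, hK, h⟩ := hc.exists_nonneg
  refine ⟨K, hK, ?_⟩
  filter_upwards [h.bound] with a ha s _
  refine ⟨by simpa using ha, fun s' _ => ?_⟩
  simp only [sub_self, abs_zero]
  positivity

theorem UnifLip.add (hX : UnifLip 𝓕 T X) (hY : UnifLip 𝓕 T Y) :
    UnifLip 𝓕 T fun a s => X a s + Y a s := by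
  obtain ⟨K, hK, h⟩ := hX
  obtain ⟨K', hK', h'⟩ := hY
  refine ⟨K + K', by positivity, ?_⟩
  filter_upwards [h, h'] with a h1 h2 s hs
  refine ⟨(abs_add_le _ _).trans (add_le_add (h1 s hs).1 (h2 s hs).1), fun s' hs' => ?_⟩
  rw [add_sub_add_comm, add_mul]
  exact (abs_add_le _ _).trans (add_le_add ((h1 s hs).2 s' hs') ((h2 s hs).2 s' hs'))

theorem UnifLip.mul (hX : UnifLip 𝓕 T X) (hY : UnifLip 𝓕 T Y) :
    UnifLip 𝓕 T fun a s => X a s * Y a s := by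
  obtain ⟨K, hK, h⟩ := hX
  obtain ⟨K', hK', h'⟩ := hY
  refine ⟨K * K' + (K * K' + K * K'), by positivity, ?_⟩
  filter_upwards [h, h'] with a h1 h2 s hs
  constructor
  · rw [abs_mul]
    have : |X a s| * |Y a s| ≤ K * K' := mul_le_mul (h1 s hs).1 (h2 s hs).1 (abs_nonneg _) hK
    nlinarith [mul_nonneg hK hK']
  · intro s' hs'
    have e : X a s * Y a s - X a s' * Y a s' =
        (X a s - X a s') * Y a s + X a s' * (Y a s - Y a s') := by ring
    rw [e]
    have e1 : |(X a s - X a s') * Y a s| ≤ K * |s - s'| * K' := by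
      rw [abs_mul]
      exact mul_le_mul ((h1 s hs).2 s' hs') (h2 s hs).1 (abs_nonneg _) (by positivity)
    have e2 : |X a s' * (Y a s - Y a s')| ≤ K * (K' * |s - s'|) := by
      rw [abs_mul]
      exact mul_le_mul (h1 s' hs').1 ((h2 s hs).2 s' hs') (abs_nonneg _) (by positivity)
    have := abs_add_le ((X a s - X a s') * Y a s) (X a s' * (Y a s - Y a s'))
    nlinarith [mul_nonneg (mul_nonneg hK hK') (abs_nonneg (s - s'))]

theorem UnifLip.const_mul {c : ι → ℝ} (hc : c =O[𝓕] fun _ => (1 : ℝ)) (hX : UnifLip 𝓕 T X) :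
    UnifLip 𝓕 T fun a s => c a * X a s :=
  (UnifLip.const hc).mul hX

theorem UnifLip.sub (hX : UnifLip 𝓕 T X) (hY : UnifLip 𝓕 T Y) :
    UnifLip 𝓕 T fun a s => X a s - Y a s := by
  have := hX.add ((UnifLip.const (c := fun _ => -1) (isBigO_refl _ _ |>.neg_left)).mul hY)
  refine (by simpa [sub_eq_add_neg] using this)

theorem UnifLip.sum {I : Type*} (t : Finset I) {X : I → ι → ℝ → ℝ}
    (hX : ∀ i ∈ t, UnifLip 𝓕 T (X i)) : UnifLip 𝓕 T fun a s => ∑ i ∈ t, X i a s := by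
  classical
  induction t using Finset.induction_on with
  | empty => simpa using UnifLip.const (c := fun _ => 0) (isBigO_zero _ _)
  | insert i t hi ih =>
    simp only [Finset.sum_insert hi]
    exact (hX i (by simp)).add (ih fun j hj => hX j (by simp [hj]))

theorem continuousOn_of_abs_sub_le {f : ℝ → ℝ} {s : Set ℝ} {K : ℝ} (hK : 0 ≤ K)
    (h : ∀ x ∈ s, ∀ y ∈ s, |f x - f y| ≤ K * |x - y|) : ContinuousOn f s := by
  have : LipschitzOnWith ⟨K, hK⟩ f s := LipschitzOnWith.of_dist_le_mul fun x hx y hy => by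
    exact h x hx y hy
  exact this.continuousOn

theorem intervalIntegrable_of_continuousOn {f : ℝ → ℝ} {b c : ℝ}
    (hf : ContinuousOn f (Set.Icc 0 T)) (hb : b ∈ Set.Icc 0 T) (hc : c ∈ Set.Icc 0 T) :
    IntervalIntegrable f volume b c :=
  (hf.mono (Set.uIcc_subset_Icc hb hc)).intervalIntegrable

/-- Integrals of bounded continuous functions are Lipschitz. -/
theorem UnifLip.of_integral (hT : 0 ≤ T) {K : ℝ} (hK : 0 ≤ K)
    (hc : ∀ᶠ a in 𝓕, ContinuousOn (X a) (Set.Icc 0 T))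
    (hX : ∀ᶠ a in 𝓕, ∀ s ∈ Set.Icc 0 T, |X a s| ≤ K) :
    UnifLip 𝓕 T fun a t => ∫ s in (0 : ℝ)..t, X a s := by
  -- `K * T` bounds the values and `K` the slopes; their sum serves for both.
  refine ⟨K + K * T, by positivity, ?_⟩
  filter_upwards [hc, hX] with a h1 h2 s hs
  have h0 : (0 : ℝ) ∈ Set.Icc 0 T := ⟨le_rfl, hT⟩
  have key : ∀ b ∈ Set.Icc 0 T, ∀ c ∈ Set.Icc 0 T, |∫ s in b..c, X a s| ≤ K * |c - b| := by
    intro b hb c hc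
    exact intervalIntegral.norm_integral_le_of_norm_le_const (f := X a) (C := K) fun x hx =>
      h2 x ((Set.uIcc_subset_Icc hb hc) (Set.uIoc_subset_uIcc hx))
  constructor
  · refine (key 0 h0 s hs).trans ?_
    rw [sub_zero, abs_of_nonneg hs.1]
    nlinarith [hs.2]
  · intro s' hs'
    rw [intervalIntegral.integral_interval_sub_left
      (intervalIntegrable_of_continuousOn h1 h0 hs) (intervalIntegrable_of_continuousOn h1 h0 hs')]
    refine (key s' hs' s hs).trans ?_
    gcongr
    nlinarith

theorem UnifLip.eventually_continuousOn (hX : UnifLip 𝓕 T X) :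
    ∀ᶠ a in 𝓕, ContinuousOn (X a) (Set.Icc 0 T) := by
  obtain ⟨K, hK, h⟩ := hX
  filter_upwards [h] with a ha
  exact continuousOn_of_abs_sub_le hK fun x hx y hy => (ha x hx).2 y hy

theorem UnifLip.integral (hT : 0 ≤ T) (hX : UnifLip 𝓕 T X) :
    UnifLip 𝓕 T fun a t => ∫ s in (0 : ℝ)..t, X a s := by
  obtain ⟨K, hK, h⟩ := hX
  exact UnifLip.of_integral hT hK (UnifLip.eventually_continuousOn ⟨K, hK, h⟩)
    (h.mono fun a ha s hs => (ha s hs).1)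

theorem UnifLip.congr (hX : UnifLip 𝓕 T X)
    (h : ∀ᶠ a in 𝓕, ∀ s ∈ Set.Icc 0 T, X a s = Y a s) : UnifLip 𝓕 T Y := by
  obtain ⟨K, hK, h'⟩ := hX
  refine ⟨K, hK, ?_⟩
  filter_upwards [h, h'] with a h1 h2 s hs
  rw [← h1 s hs]
  refine ⟨(h2 s hs).1, fun s' hs' => ?_⟩
  rw [← h1 s' hs']
  exact (h2 s hs).2 s' hs'

variable {n N : ι → ℕ}

/-- The values of a family of functions of time at the times `k / N`. -/
noncomputable def atStep (N : ι → ℕ) (X : ι → ℝ → ℝ) (p : ι × ℕ) : ℝ := X p.1 (p.2 / N p.1)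

theorem step_mem_Icc {a : ι} {k : ℕ} (hN : 0 < N a) (hn : (n a : ℝ) ≤ N a * T) (hk : k ≤ n a) :
    ((k : ℝ) / N a) ∈ Set.Icc 0 T := by
  have hN' : (0 : ℝ) < N a := by exact_mod_cast hN
  refine ⟨by positivity, ?_⟩
  rw [div_le_iff₀ hN', mul_comm]
  exact le_trans (by exact_mod_cast hk) hn

theorem UnifLip.atStep_isBigO (hN : ∀ᶠ a in 𝓕, 0 < N a) (hn : ∀ᶠ a in 𝓕, (n a : ℝ) ≤ N a * T)
    (hX : UnifLip 𝓕 T X) : atStep N X =O[upTo 𝓕 n] fun _ => (1 : ℝ) := by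
  obtain ⟨K, hK, h⟩ := hX
  refine isBigO_one_upTo.2 ⟨K, hK, ?_⟩
  filter_upwards [hN, hn, h] with a h1 h2 h3 k hk
  exact (h3 _ (step_mem_Icc h1 h2 hk)).1

/-- Riemann sums of Lipschitz functions. -/
theorem UnifLip.integral_sub_avg_isBigO (hT : 0 ≤ T) (hN : ∀ᶠ a in 𝓕, 0 < N a)
    (hn : ∀ᶠ a in 𝓕, (n a : ℝ) ≤ N a * T) (hX : UnifLip 𝓕 T X) :
    (fun p => atStep N (fun a t => ∫ s in (0 : ℝ)..t, X a s) p - avg N (atStep N X) p)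
      =O[upTo 𝓕 n] fun p => (N p.1 : ℝ)⁻¹ := by
  have hcont := hX.eventually_continuousOn
  obtain ⟨K, hK, h⟩ := hX
  refine isBigO_upTo (b := fun a => (N a : ℝ)⁻¹).2 ⟨T * K, by positivity, ?_⟩
  filter_upwards [hN, hn, h, hcont] with a h1 h2 h3 h4 k hk
  have hN' : (0 : ℝ) < N a := by exact_mod_cast h1
  have e1 : ∫ s in (0 : ℝ)..(k / N a), X a s =
      ∑ m ∈ Finset.range k, ∫ s in ((m : ℝ) / N a)..(((m + 1 : ℕ) : ℝ) / N a), X a s := by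
    rw [intervalIntegral.sum_integral_adjacent_intervals (a := fun m : ℕ => (m : ℝ) / N a)]
    · simp
    · intro m hm
      exact intervalIntegrable_of_continuousOn h4 (step_mem_Icc h1 h2 (by omega))
        (step_mem_Icc h1 h2 (by omega))
  -- The error is an average of local errors, one per cell of length 1/N. Each is at most K/N
  -- because the integrand varies by at most K/N on a cell.
  have e2 : atStep N (fun a t => ∫ s in (0 : ℝ)..t, X a s) (a, k) - avg N (atStep N X) (a, k) =
      avg N (fun p => N a * (∫ s in ((p.2 : ℝ) / N a)..(((p.2 + 1 : ℕ) : ℝ) / N a), X a s) -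
        X a (p.2 / N a)) (a, k) := by
    simp only [atStep, avg, e1]
    rw [Finset.sum_sub_distrib, ← Finset.mul_sum]
    field_simp
  rw [e2, mul_assoc]
  refine abs_avg_le (n := n) (by positivity) h1 h2 hk fun m hm => ?_
  have hm1 := step_mem_Icc h1 h2 (show m ≤ n a by omega)
  have hm2 := step_mem_Icc h1 h2 (show m + 1 ≤ n a by omega)
  have hdiff : ((m + 1 : ℕ) : ℝ) / N a - m / N a = (N a : ℝ)⁻¹ := by push_cast; field_simp; ring
  have hb : |∫ s in ((m : ℝ) / N a)..(((m + 1 : ℕ) : ℝ) / N a), (X a s - X a (m / N a))| ≤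
      K * (N a : ℝ)⁻¹ * |((m + 1 : ℕ) : ℝ) / N a - m / N a| := by
    refine intervalIntegral.norm_integral_le_of_norm_le_const
      (f := fun s => X a s - X a (m / N a)) (C := K * (N a : ℝ)⁻¹) fun x hx => ?_
    have hx' := Set.uIoc_subset_uIcc hx
    have hxT := (Set.uIcc_subset_Icc hm1 hm2) hx'
    refine ((h3 x hxT).2 _ hm1).trans ?_
    refine mul_le_mul_of_nonneg_left ?_ hK
    rw [Set.uIcc_of_le (by rw [← sub_nonneg, hdiff]; positivity)] at hx'
    rw [abs_of_nonneg (by linarith [hx'.1])]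
    linarith [hx'.2]
  rw [intervalIntegral.integral_sub (intervalIntegrable_of_continuousOn h4 hm1 hm2) (by simp),
    intervalIntegral.integral_const, hdiff, smul_eq_mul] at hb
  have e3 : (N a : ℝ) * (∫ s in ((m : ℝ) / N a)..(((m + 1 : ℕ) : ℝ) / N a), X a s) - X a (m / N a)
      = N a * ((∫ s in ((m : ℝ) / N a)..(((m + 1 : ℕ) : ℝ) / N a), X a s) -
        (N a : ℝ)⁻¹ * X a (m / N a)) := by
    field_simp
  simp only
  rw [e3, abs_mul, abs_of_pos hN']
  have hinv : |(N a : ℝ)⁻¹| = (N a : ℝ)⁻¹ := abs_of_pos (by positivity)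
  rw [hinv] at hb ⊢
  calc _ ≤ (N a : ℝ) * (K * (N a : ℝ)⁻¹ * (N a : ℝ)⁻¹) := by gcongr
    _ = _ := by field_simp

end Time

end DeepNet

namespace DeepNet

open Asymptotics

/-! ### Slowly varying sequences -/

section Slow

variable {ι : Type*}

/-- `X` is bounded, with increments of order `1 / N`. -/
def Slow (𝓕 : Filter ι) (n N : ι → ℕ) (X : ι × ℕ → ℝ) : Prop :=
  X =O[upTo 𝓕 n] (fun _ => (1 : ℝ)) ∧
    (fun p : ι × ℕ => X (p.1, p.2 + 1) - X p) =O[before 𝓕 n] fun p => (N p.1 : ℝ)⁻¹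

variable {𝓕 : Filter ι} {n N : ι → ℕ} {X Y : ι × ℕ → ℝ}

theorem Slow.const (c : ℝ) : Slow 𝓕 n N fun _ => c :=
  ⟨isBigO_const_one ℝ c _, by simpa using isBigO_zero _ _⟩

theorem Slow.add (hX : Slow 𝓕 n N X) (hY : Slow 𝓕 n N Y) : Slow 𝓕 n N fun p => X p + Y p :=
  ⟨hX.1.add hY.1, (hX.2.add hY.2).congr_left fun _ => by ring⟩

theorem Slow.sub (hX : Slow 𝓕 n N X) (hY : Slow 𝓕 n N Y) : Slow 𝓕 n N fun p => X p - Y p :=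
  ⟨hX.1.sub hY.1, (hX.2.sub hY.2).congr_left fun _ => by ring⟩

theorem Slow.mul (hX : Slow 𝓕 n N X) (hY : Slow 𝓕 n N Y) : Slow 𝓕 n N fun p => X p * Y p := by
  refine ⟨by simpa using hX.1.mul hY.1, ?_⟩
  have h1 := hX.2.mul (hY.1.comp_tendsto tendsto_succ_before)
  have h2 := (hX.1.mono before_le_upTo).mul hY.2
  simp only [Function.comp_def, one_mul, mul_one] at h1 h2
  exact (h1.add h2).congr_left fun _ => by ring

theorem Slow.sum {I : Type*} (t : Finset I) {X : I → ι × ℕ → ℝ}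
    (hX : ∀ i ∈ t, Slow 𝓕 n N (X i)) : Slow 𝓕 n N fun p => ∑ i ∈ t, X i p := by
  classical
  induction t using Finset.induction_on with
  | empty => simpa using Slow.const 0
  | insert i t hi ih =>
    simp only [Finset.sum_insert hi]
    exact (hX i (by simp)).add (ih fun j hj => hX j (by simp [hj]))

end Slow

/-! ### Bounds on balls -/

section Calculus

variable {E V : Type*} [NormedAddCommGroup E] [NormedSpace ℝ E] [ProperSpace E]
  [NormedAddCommGroup V] [NormedSpace ℝ V]

/-- Particles and limiting measures live in a fixed ball, which is compact. Continuity thus yields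
the uniform constants that would otherwise require global bounds on test functions and their
derivatives. -/
theorem exists_bound_of_continuous {F : E → V} (hF : Continuous F) (R : ℝ) :
    ∃ K, 0 ≤ K ∧ ∀ θ, ‖θ‖ ≤ R → ‖F θ‖ ≤ K := by
  obtain ⟨K, hK⟩ := (isCompact_closedBall (0 : E) R).exists_bound_of_continuousOn hF.continuousOn
  exact ⟨max K 0, le_max_right _ _, fun θ hθ => (hK θ (by simpa using hθ)).trans (le_max_left _ _)⟩

theorem exists_lipschitz_of_contDiff {F : E → V} (hF : ContDiff ℝ 1 F) (R : ℝ) :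
    ∃ K, 0 ≤ K ∧ ∀ θ θ', ‖θ‖ ≤ R → ‖θ'‖ ≤ R → ‖F θ' - F θ‖ ≤ K * ‖θ' - θ‖ := by
  obtain ⟨K, hK0, hK⟩ := exists_bound_of_continuous (hF.continuous_fderiv one_ne_zero) R
  refine ⟨K, hK0, fun θ θ' h h' => ?_⟩
  exact (convex_closedBall (0 : E) R).norm_image_sub_le_of_norm_fderiv_le
    (fun x _ => hF.differentiable one_ne_zero x) (fun x hx => hK x (by simpa using hx))
    (by simpa using h) (by simpa using h')

/-- The derivative is Lipschitz on the ball, and the mean value inequality is applied to `F` minus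
its linearization at `θ`. -/
theorem exists_taylor_of_contDiff {F : E → V} (hF : ContDiff ℝ 2 F) (R : ℝ) :
    ∃ K, 0 ≤ K ∧ ∀ θ θ', ‖θ‖ ≤ R → ‖θ'‖ ≤ R →
      ‖F θ' - F θ - fderiv ℝ F θ (θ' - θ)‖ ≤ K * ‖θ' - θ‖ ^ 2 := by
  obtain ⟨K, hK0, hK⟩ := exists_lipschitz_of_contDiff
    (hF.fderiv_right (m := 1) (by norm_num)) R
  refine ⟨K, hK0, fun θ θ' h h' => ?_⟩
  -- The mean value inequality is used on the segment rather than on the ball: there the distance to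
  -- `θ` is at most `‖θ' - θ‖`, which produces the square.
  have hseg : segment ℝ θ θ' ⊆ Metric.closedBall (0 : E) R :=
    (convex_closedBall (0 : E) R).segment_subset (by simpa using h) (by simpa using h')
  rw [pow_two, ← mul_assoc]
  refine (convex_segment θ θ').norm_image_sub_le_of_norm_fderiv_le'
    (fun x _ => hF.differentiable two_ne_zero x) (fun x hx => ?_)
    (left_mem_segment ℝ θ θ') (right_mem_segment ℝ θ θ')
  refine (hK θ x h (by simpa using hseg hx)).trans ?_
  gcongr
  exact norm_sub_le_of_mem_segment hx

end Calculus

/-! ### Stochastic gradient descent as a mean-field particle system -/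

/-- The coefficients of a mean-field particle system: the particle `θ` is driven, on the `i`-th
data point, by `(y i - output) (p i θ + ∑ j, ⟨B i j⟩ q i j)`, and `⟨G i⟩` is the (unscaled)
output on the `i`-th data point. -/
structure MeanField (I J E : Type*) where
  /-- the part of the drift which depends on the particle -/
  p : I → E → E
  /-- the directions of the common drift -/
  q : I → J → E
  /-- the observables which govern the common drift -/
  B : I → J → E → ℝ
  /-- the output -/
  G : I → E → ℝ
  /-- the targets -/
  y : I → ℝ
  /-- the weights of the data points -/
  π : I → ℝ

/-- A family of runs of a mean-field particle system, with `N a` particles and `n a` steps. -/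
structure MFRun (ι I E : Type*) [MeasurableSpace E] where
  /-- number of particles -/
  N : ι → ℕ
  /-- number of steps -/
  n : ι → ℕ
  /-- scale of the fluctuations -/
  β : ι → ℝ
  /-- particles -/
  θ : (a : ι) → ℕ → Fin (N a) → E
  /-- weights of the data points at each step -/
  w : ι → ℕ → I → ℝ
  /-- limit of the initial empirical measures -/
  ν : ι → Measure E
  /-- limit of the output -/
  h : ι → ℝ → I → ℝ
  /-- limit of the fluctuations of the output -/
  κ : ι → ℝ → I → ℝ

namespace MeanField

variable {I J E : Type*} [NormedAddCommGroup E] [NormedSpace ℝ E] (s : MeanField I J E)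

/-- The derivative along `p i`. -/
noncomputable def P (i : I) (F : E → ℝ) (θ : E) : ℝ := fderiv ℝ F θ (s.p i θ)

/-- The derivative along `q i j`. -/
noncomputable def Q (i : I) (j : J) (F : E → ℝ) (θ : E) : ℝ := fderiv ℝ F θ (s.q i j)

/-- The coefficients are three times continuously differentiable. -/
structure Smooth : Prop where
  p : ∀ i, ContDiff ℝ 3 (s.p i)
  B : ∀ i j, ContDiff ℝ 3 (s.B i j)
  G : ∀ i, ContDiff ℝ 3 (s.G i)

variable {s}

theorem Smooth.contDiff_P (hs : s.Smooth) (i : I) {F : E → ℝ} {m l : WithTop ℕ∞}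
    (hF : ContDiff ℝ l F) (hl : m + 1 ≤ l) (hm : m ≤ 3) : ContDiff ℝ m (s.P i F) :=
  (hF.fderiv_right hl).clm_apply ((hs.p i).of_le hm)

theorem contDiff_Q (i : I) (j : J) {F : E → ℝ} {m l : WithTop ℕ∞}
    (hF : ContDiff ℝ l F) (hl : m + 1 ≤ l) : ContDiff ℝ m (s.Q i j F) :=
  (hF.fderiv_right hl).clm_apply contDiff_const

end MeanField

namespace MFRun

variable {ι I J E : Type*} [Fintype I] [Fintype J] [NormedAddCommGroup E] [NormedSpace ℝ E]
  [MeasurableSpace E] (r : MFRun ι I E) (s : MeanField I J E)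

/-- The average of `F` over the particles. -/
noncomputable def emp (F : E → ℝ) (p : ι × ℕ) : ℝ :=
  (r.N p.1 : ℝ)⁻¹ * ∑ m, F (r.θ p.1 p.2 m)

/-- The integral of `F` with respect to the limiting initial distribution. -/
noncomputable def mean (F : E → ℝ) (a : ι) : ℝ := ∫ θ, F θ ∂r.ν a

/-- The fluctuation of the empirical measure around the limiting initial distribution. -/
noncomputable def fluct (F : E → ℝ) (p : ι × ℕ) : ℝ := r.β p.1 * (r.emp F p - r.mean F p.1)

/-- The output. -/
noncomputable def out (i : I) (p : ι × ℕ) : ℝ := r.β p.1 * r.emp (s.G i) p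

/-- The drift of `⟨F⟩` under the empirical measure. -/
noncomputable def drift (i : I) (F : E → ℝ) (p : ι × ℕ) : ℝ :=
  r.emp (s.P i F) p + ∑ j, r.emp (s.B i j) p * r.emp (s.Q i j F) p

/-- The drift of `⟨F⟩` under the limiting initial distribution. -/
noncomputable def driftMean (i : I) (F : E → ℝ) (a : ι) : ℝ :=
  r.mean (s.P i F) a + ∑ j, r.mean (s.B i j) a * r.mean (s.Q i j F) a

/-- The limit of the fluctuations of `⟨F⟩`. -/
noncomputable def lim (F : E → ℝ) (a : ι) (t : ℝ) : ℝ :=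
  ∫ u in (0 : ℝ)..t, ∑ i, s.π i * ((s.y i - r.h a u i) * r.driftMean s i F a)

/-- The limit of the fluctuations of the drift of `⟨F⟩`. -/
noncomputable def driftLim (i : I) (F : E → ℝ) (a : ι) (t : ℝ) : ℝ :=
  r.lim s (s.P i F) a t + ∑ j, r.mean (s.B i j) a * r.lim s (s.Q i j F) a t +
    ∑ j, r.lim s (s.B i j) a t * r.mean (s.Q i j F) a

/-- The limit of the second order fluctuations of `⟨F⟩`. -/
noncomputable def lim₂ (F : E → ℝ) (a : ι) (t : ℝ) : ℝ :=
  ∫ u in (0 : ℝ)..t, ∑ i, s.π i *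
    ((s.y i - r.h a u i) * r.driftLim s i F a u - r.κ a u i * r.driftMean s i F a)

/-- The assumptions on a family of runs. -/
structure Admissible (𝓕 : Filter ι) (T R : ℝ) : Prop where
  T_pos : 0 < T
  scale : Tendsto r.β 𝓕 atTop
  scale_N : Tendsto (fun a => r.β a / r.N a) 𝓕 (𝓝 0)
  N_pos : ∀ᶠ a in 𝓕, 0 < r.N a
  n_le : ∀ᶠ a in 𝓕, (r.n a : ℝ) ≤ r.N a * T
  init_bdd : ∀ᶠ a in 𝓕, ∀ m, ‖r.θ a 0 m‖ ≤ R
  prob : ∀ a, IsProbabilityMeasure (r.ν a)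
  supp : ∀ᶠ a in 𝓕, ∀ᵐ θ ∂r.ν a, ‖θ‖ ≤ R
  centred : ∀ a i, r.mean (s.G i) a = 0
  w_bdd : ∀ᶠ a in 𝓕, ∀ k i, |r.w a k i| ≤ 1
  step : ∀ᶠ a in 𝓕, ∀ k m, r.θ a (k + 1) m = r.θ a k m + (r.β a * r.N a)⁻¹ •
    ∑ i, (r.w a k i * (s.y i - r.out s i (a, k))) •
      (s.p i (r.θ a k m) + ∑ j, r.emp (s.B i j) (a, k) • s.q i j)
  -- `fluct` already contains one factor `β`; the second one is needed because second order
  -- fluctuations are observed. For the same reason the sampling error below must be small compared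
  -- with `1 / β`.
  init : ∀ F, Continuous F → Tendsto (fun a => r.β a * r.fluct F (a, 0)) 𝓕 (𝓝 0)
  noise : ∀ i, (avg r.N fun p => r.w p.1 p.2 i - s.π i) =o[upTo 𝓕 r.n] fun p => (r.β p.1)⁻¹
  h_continuousOn : ∀ a i, ContinuousOn (fun t => r.h a t i) (Set.Icc 0 T)
  h_eq : ∀ a, ∀ t ∈ Set.Icc 0 T, ∀ i, r.h a t i = r.lim s (s.G i) a t
  κ_continuousOn : ∀ a i, ContinuousOn (fun t => r.κ a t i) (Set.Icc 0 T)
  κ_eq : ∀ a, ∀ t ∈ Set.Icc 0 T, ∀ i, r.κ a t i = r.lim₂ s (s.G i) a t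

variable {r s} {𝓕 : Filter ι} {T R : ℝ}

theorem abs_emp_le {F : E → ℝ} {a : ι} {k : ℕ} {K : ℝ} (hN : 0 < r.N a)
    (h : ∀ m, |F (r.θ a k m)| ≤ K) : |r.emp F (a, k)| ≤ K := by
  have hN' : (0 : ℝ) < r.N a := by exact_mod_cast hN
  rw [emp, abs_mul, abs_of_nonneg (by positivity), inv_mul_le_iff₀ hN']
  refine (Finset.abs_sum_le_sum_abs _ _).trans
    ((Finset.sum_le_card_nsmul _ _ K fun m _ => h m).trans ?_)
  simp

theorem abs_emp_sub_le {F : E → ℝ} {a : ι} {k l : ℕ} {K : ℝ} (hN : 0 < r.N a)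
    (h : ∀ m, |F (r.θ a l m) - F (r.θ a k m)| ≤ K) : |r.emp F (a, l) - r.emp F (a, k)| ≤ K := by
  have hN' : (0 : ℝ) < r.N a := by exact_mod_cast hN
  rw [emp, emp, ← mul_sub, ← Finset.sum_sub_distrib, abs_mul, abs_of_nonneg (by positivity),
    inv_mul_le_iff₀ hN']
  refine (Finset.abs_sum_le_sum_abs _ _).trans
    ((Finset.sum_le_card_nsmul _ _ K fun m _ => h m).trans ?_)
  simp

/-- Centring of `G i` makes the output a fluctuation. This is what closes the system of equations on
the observables `G i`. -/
theorem out_eq_fluct (h : r.Admissible s 𝓕 T R) (i : I) : r.out s i = r.fluct (s.G i) := by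
  funext p
  simp [out, fluct, h.centred]

variable [ProperSpace E]

/-- A priori bounds. -/
theorem Admissible.apriori (h : r.Admissible s 𝓕 T R) (hs : s.Smooth) :
    ∃ K, 0 ≤ K ∧ ∀ᶠ a in 𝓕, (∀ k ≤ r.n a, ∀ m, ‖r.θ a k m‖ ≤ R + 1) ∧
      (∀ k ≤ r.n a, ∀ m, ‖r.θ a k m - r.θ a 0 m‖ ≤ K * (r.β a)⁻¹) ∧
      (∀ k < r.n a, ∀ m, ‖r.θ a (k + 1) m - r.θ a k m‖ ≤ K * (r.β a * r.N a)⁻¹) ∧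
      (∀ k ≤ r.n a, ∀ i, |r.out s i (a, k)| ≤ K) := by
  have hT := h.T_pos
  obtain ⟨Kp, hKp0, hKp⟩ := exists_bound_of_continuous (F := fun θ i => s.p i θ)
    (continuous_pi fun i => (hs.p i).continuous) (R + 1)
  obtain ⟨KB, hKB0, hKB⟩ := exists_bound_of_continuous (F := fun θ i j => s.B i j θ)
    (continuous_pi fun i => continuous_pi fun j => (hs.B i j).continuous) (R + 1)
  obtain ⟨LG, hLG0, hLG⟩ := exists_lipschitz_of_contDiff (F := fun θ i => s.G i θ)
    (contDiff_pi.2 fun i => (hs.G i).of_le (by norm_num)) (R + 1)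
  -- `K1` bounds the velocity of a particle per unit of residual, `K2` is the resulting growth rate
  -- of the residuals, `x0` bounds the initial residuals (the initial outputs are eventually at most
  -- 1), and `X` is the bound which Gronwall's argument gives up to time `T`.
  set K1 := Kp + ∑ _j : J, KB * ‖s.q‖ with hK1
  have hK10 : 0 ≤ K1 := by positivity
  set K2 := Fintype.card I * (LG * K1) with hK2
  have hK20 : 0 ≤ K2 := by positivity
  set x0 := ∑ i, (|s.y i| + 1) with hx0
  have hx00 : 0 ≤ x0 := by positivity
  set X := x0 * Real.exp (K2 * T) with hX
  have hX0 : 0 ≤ X := by positivity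
  refine ⟨T * (K1 * X) + K1 * X + X, by positivity, ?_⟩
  -- The total displacement is O(1/β), hence eventually at most 1. This keeps the particles in the
  -- ball of radius `R + 1` on which the constants were chosen.
  have hsmall : ∀ᶠ a in 𝓕, T * (K1 * X) * (r.β a)⁻¹ ≤ 1 := by
    have h1 : Tendsto (fun a => T * (K1 * X) * (r.β a)⁻¹) 𝓕 (𝓝 (T * (K1 * X) * 0)) :=
      h.scale.inv_tendsto_atTop.const_mul _
    rw [mul_zero] at h1
    exact h1.eventually_le_const one_pos
  have hinit : ∀ᶠ a in 𝓕, ∀ i, |r.β a * r.fluct (s.G i) (a, 0)| ≤ 1 :=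
    eventually_all.2 fun i =>
      ((h.init _ (hs.G i).continuous).abs.eventually_le_const (by simp))
  filter_upwards [h.N_pos, h.n_le, h.init_bdd, h.w_bdd, h.step, hsmall, hinit,
    h.scale.eventually_ge_atTop 1] with a hN hn hi hw hstep hsm hin hβ
  have hN' : (0 : ℝ) < r.N a := by exact_mod_cast hN
  have hβ' : 0 < r.β a := by linarith
  set x : ℕ → ℝ := fun k => ∑ i, (|s.y i| + |r.out s i (a, k)|) with hx
  have hx_0 : x 0 ≤ x0 := by
    refine Finset.sum_le_sum fun i _ => ?_
    gcongr
    have := hin i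
    rw [abs_mul, abs_of_pos hβ'] at this
    rw [out_eq_fluct h]
    nlinarith [abs_nonneg (r.fluct (s.G i) (a, 0))]
  have hdelta : ∀ k, (∀ m, ‖r.θ a k m‖ ≤ R + 1) → ∀ m,
      ‖r.θ a (k + 1) m - r.θ a k m‖ ≤ (r.β a * r.N a)⁻¹ * (K1 * x k) := by
    intro k hk m
    rw [hstep k m, add_sub_cancel_left, norm_smul, Real.norm_of_nonneg (by positivity)]
    gcongr
    rw [hx, Finset.mul_sum]
    refine (norm_sum_le _ _).trans (Finset.sum_le_sum fun i _ => ?_)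
    rw [norm_smul, mul_comm]
    gcongr
    · refine (norm_add_le _ _).trans (add_le_add ?_ ?_)
      · exact (norm_le_pi_norm (fun i => s.p i (r.θ a k m)) i).trans (hKp _ (hk m))
      · refine (norm_sum_le _ _).trans (Finset.sum_le_sum fun j _ => ?_)
        rw [norm_smul]
        gcongr
        · refine abs_emp_le hN fun m => ?_
          exact ((norm_le_pi_norm (fun j => s.B i j (r.θ a k m)) j).trans
            (norm_le_pi_norm (fun i j => s.B i j (r.θ a k m)) i)).trans (hKB _ (hk m))
        · exact (norm_le_pi_norm (s.q i) j).trans (norm_le_pi_norm s.q i)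
    · rw [Real.norm_eq_abs, abs_mul]
      calc _ ≤ 1 * |s.y i - r.out s i (a, k)| := by gcongr; exact hw k i
        _ ≤ _ := by rw [one_mul]; exact abs_sub _ _
  have hgrow : ∀ k, (∀ m, ‖r.θ a k m‖ ≤ R + 1) → (∀ m, ‖r.θ a (k + 1) m‖ ≤ R + 1) →
      x (k + 1) ≤ (1 + K2 * (r.N a : ℝ)⁻¹) * x k := by
    intro k hk hk'
    have h1 : ∀ i, |r.out s i (a, k + 1)| ≤ |r.out s i (a, k)| +
        LG * K1 * (r.N a : ℝ)⁻¹ * x k := by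
      intro i
      have h2 : |r.emp (s.G i) (a, k + 1) - r.emp (s.G i) (a, k)| ≤
          LG * ((r.β a * r.N a)⁻¹ * (K1 * x k)) := by
        refine abs_emp_sub_le hN fun m => ?_
        refine (norm_le_pi_norm ((fun i => s.G i (r.θ a (k + 1) m)) - fun i => s.G i (r.θ a k m))
          i).trans ((hLG _ _ (hk m) (hk' m)).trans ?_)
        gcongr
        exact hdelta k hk m
      -- The factor `β` in the output cancels the `β⁻¹` in the step size: the output changes by
      -- O(1/N) per step.
      have h3 : |r.out s i (a, k + 1) - r.out s i (a, k)| ≤ LG * K1 * (r.N a : ℝ)⁻¹ * x k := by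
        rw [out, out, ← mul_sub, abs_mul, abs_of_pos hβ']
        calc _ ≤ r.β a * (LG * ((r.β a * r.N a)⁻¹ * (K1 * x k))) := by gcongr
          _ = _ := by field_simp
      have := abs_sub_abs_le_abs_sub (r.out s i (a, k + 1)) (r.out s i (a, k))
      linarith
    calc x (k + 1) ≤ ∑ i, ((|s.y i| + |r.out s i (a, k)|) + LG * K1 * (r.N a : ℝ)⁻¹ * x k) :=
          Finset.sum_le_sum fun i _ => by linarith [h1 i]
      _ = _ := by
          rw [Finset.sum_add_distrib, Finset.sum_const, Finset.card_univ, nsmul_eq_mul]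
          simp only [hx, hK2]
          ring
  have hpow : ∀ k ≤ r.n a, x0 * (1 + K2 * (r.N a : ℝ)⁻¹) ^ k ≤ X := by
    intro k hk
    have hk' : (k : ℝ) ≤ r.N a * T := le_trans (by exact_mod_cast hk) hn
    rw [hX]
    gcongr
    calc (1 + K2 * (r.N a : ℝ)⁻¹) ^ k ≤ Real.exp (K2 * (r.N a : ℝ)⁻¹) ^ k := by
          gcongr
          linarith [Real.add_one_le_exp (K2 * (r.N a : ℝ)⁻¹)]
      _ = Real.exp (k * (K2 * (r.N a : ℝ)⁻¹)) := (Real.exp_nat_mul _ _).symm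
      _ ≤ Real.exp (K2 * T) := by
          refine Real.exp_le_exp.2 ?_
          calc (k : ℝ) * (K2 * (r.N a : ℝ)⁻¹) ≤ r.N a * T * (K2 * (r.N a : ℝ)⁻¹) := by gcongr
            _ = _ := by field_simp
  have hfar : ∀ k ≤ r.n a, k * ((r.β a * r.N a)⁻¹ * (K1 * X)) ≤ T * (K1 * X) * (r.β a)⁻¹ := by
    intro k hk
    have hk' : (k : ℝ) ≤ r.N a * T := le_trans (by exact_mod_cast hk) hn
    calc _ ≤ r.N a * T * ((r.β a * r.N a)⁻¹ * (K1 * X)) := by gcongr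
      _ = _ := by field_simp
  have hball : ∀ k ≤ r.n a, (∀ m, ‖r.θ a k m - r.θ a 0 m‖ ≤
      k * ((r.β a * r.N a)⁻¹ * (K1 * X))) → ∀ m, ‖r.θ a k m‖ ≤ R + 1 := by
    intro k hk hd m
    have := norm_le_insert' (r.θ a k m) (r.θ a 0 m)
    linarith [hi m, hd m, hfar k hk]
  -- A bootstrap: the step bound needs the particles in the ball and the residuals under control,
  -- and the growth of the residuals needs the particles in the ball before and after the step. Both
  -- statements are therefore propagated together.
  have main : ∀ k ≤ r.n a, (∀ m, ‖r.θ a k m - r.θ a 0 m‖ ≤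
      k * ((r.β a * r.N a)⁻¹ * (K1 * X))) ∧ x k ≤ x0 * (1 + K2 * (r.N a : ℝ)⁻¹) ^ k := by
    intro k
    induction k with
    | zero => intro _; simpa using hx_0
    | succ k ih =>
      intro hk
      have hk' : k ≤ r.n a := by omega
      obtain ⟨h1, h2⟩ := ih hk'
      have hb := hball k hk' h1
      have h3 : ∀ m, ‖r.θ a (k + 1) m - r.θ a 0 m‖ ≤
          (k + 1 : ℕ) * ((r.β a * r.N a)⁻¹ * (K1 * X)) := by
        intro m
        have e1 : ‖r.θ a (k + 1) m - r.θ a k m‖ ≤ (r.β a * r.N a)⁻¹ * (K1 * X) := by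
          refine (hdelta k hb m).trans ?_
          gcongr
          exact h2.trans (hpow k hk')
        have e2 := norm_add_le (r.θ a (k + 1) m - r.θ a k m) (r.θ a k m - r.θ a 0 m)
        rw [sub_add_sub_cancel] at e2
        push_cast
        rw [add_one_mul]
        linarith [h1 m]
      refine ⟨h3, (hgrow k hb (hball (k + 1) hk h3)).trans ?_⟩
      rw [pow_succ]
      calc _ ≤ (1 + K2 * (r.N a : ℝ)⁻¹) * (x0 * (1 + K2 * (r.N a : ℝ)⁻¹) ^ k) := by gcongr
        _ = _ := by ring
  have hxX : ∀ k ≤ r.n a, x k ≤ X := fun k hk => (main k hk).2.trans (hpow k hk)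
  refine ⟨fun k hk => hball k hk (main k hk).1, fun k hk m => ?_, fun k hk m => ?_, fun k hk i => ?_⟩
  · refine ((main k hk).1 m).trans ((hfar k hk).trans ?_)
    gcongr
    have : 0 ≤ K1 * X := by positivity
    linarith
  · refine (hdelta k (hball k hk.le (main k hk.le).1) m).trans ?_
    rw [mul_comm]
    gcongr
    have h1 : K1 * x k ≤ K1 * X := by gcongr; exact hxX k hk.le
    have h2 : 0 ≤ T * (K1 * X) := by positivity
    linarith
  · have h1 : |s.y i| + |r.out s i (a, k)| ≤ x k :=
      Finset.single_le_sum (f := fun i => |s.y i| + |r.out s i (a, k)|)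
        (fun i _ => by positivity) (Finset.mem_univ i)
    have h2 : 0 ≤ T * (K1 * X) := by positivity
    have h3 : 0 ≤ K1 * X := by positivity
    linarith [hxX k hk, abs_nonneg (s.y i)]

end MFRun

end DeepNet

namespace DeepNet

open Asymptotics

/-! ### Gronwall in continuous time and linear Volterra equations -/

/-- Gronwall's inequality in integral form. -/
theorem le_mul_exp_of_le_add_integral {x : ℝ → ℝ} {b c T : ℝ} (hb : 0 ≤ b) (hc : 0 ≤ c)
    (hx : ContinuousOn x (Set.Icc 0 T)) (hx0 : ∀ t ∈ Set.Icc 0 T, 0 ≤ x t)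
    (h : ∀ t ∈ Set.Icc 0 T, x t ≤ b + c * ∫ s in (0 : ℝ)..t, x s) {t : ℝ}
    (ht : t ∈ Set.Icc 0 T) : x t ≤ b * Real.exp (c * T) := by
  have hT : (0 : ℝ) ≤ T := ht.1.trans ht.2
  -- Constant extension beyond the endpoints makes the primitive differentiable at every point, in
  -- particular at 0.
  set z : ℝ → ℝ := Set.IccExtend hT (Set.domRestrict (Set.Icc 0 T) x)
  have hz : Continuous z := hx.domRestrict.Icc_extend'
  have hzx : ∀ s ∈ Set.Icc 0 T, z s = x s := fun s hs => by
    simp [z, Set.IccExtend_of_mem hT _ hs]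
  have hint : ∀ t ∈ Set.Icc 0 T, ∫ s in (0 : ℝ)..t, x s = ∫ s in (0 : ℝ)..t, z s := by
    intro t ht
    refine intervalIntegral.integral_congr fun s hs => (hzx s ?_).symm
    rw [Set.uIcc_of_le ht.1] at hs
    exact ⟨hs.1, hs.2.trans ht.2⟩
  set f : ℝ → ℝ := fun t => b + c * ∫ s in (0 : ℝ)..t, z s
  have hf : ∀ t, HasDerivAt f (c * z t) t := fun t =>
    ((hz.integral_hasStrictDerivAt 0 t).hasDerivAt.const_mul c).const_add b
  have hfx : ∀ t ∈ Set.Icc 0 T, x t ≤ f t := fun t ht => by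
    simpa [f, hint t ht] using h t ht
  have := norm_le_gronwallBound_of_norm_deriv_right_le (f := f) (f' := fun t => c * z t)
    (δ := b) (K := c) (ε := 0) (a := 0) (b := T)
    (fun t _ => (hf t).continuousAt.continuousWithinAt) (fun t _ => (hf t).hasDerivWithinAt)
    (by simp [f, abs_of_nonneg hb]) (fun t ht => by
      have ht' := Set.Ico_subset_Icc_self ht
      have h1 := hx0 t ht'
      rw [hzx t ht', norm_mul, Real.norm_of_nonneg hc, Real.norm_of_nonneg h1, add_zero]
      gcongr
      exact (hfx t ht').trans (le_abs_self _)) t ht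
  rw [gronwallBound_ε0, sub_zero] at this
  refine (hfx t ht).trans ((le_abs_self _).trans (this.trans ?_))
  gcongr
  exact ht.2

section

variable {ι : Type*} {𝓕 : Filter ι} {T : ℝ}

/-- Continuous solutions of linear Volterra equations are uniformly Lipschitz. -/
theorem unifLip_of_volterra {I : Type*} [Fintype I] (hT : 0 ≤ T) {u b : ι → ℝ → I → ℝ}
    {A : I → I → ι → ℝ} (hu : ∀ a i, ContinuousOn (fun t => u a t i) (Set.Icc 0 T))
    (hb : ∀ i, UnifLip 𝓕 T fun a t => b a t i) (hA : ∀ i j, A i j =O[𝓕] fun _ => (1 : ℝ))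
    (h : ∀ a, ∀ t ∈ Set.Icc 0 T, ∀ i,
      u a t i = ∫ s in (0 : ℝ)..t, (b a s i - ∑ j, A i j a * u a s j)) (i : I) :
    UnifLip 𝓕 T fun a t => u a t i := by
  choose Kb hKb0 hKb using hb
  choose KA hKA0 hKA using fun i j => (hA i j).exists_nonneg
  have hbc : ∀ i, ∀ᶠ a in 𝓕, ContinuousOn (fun t => b a t i) (Set.Icc 0 T) := fun i =>
    UnifLip.eventually_continuousOn ⟨Kb i, hKb0 i, hKb i⟩
  have hKb1 : 0 ≤ ∑ i, Kb i := Finset.sum_nonneg fun i _ => hKb0 i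
  have hKA1 : 0 ≤ ∑ i, ∑ j, KA i j := Finset.sum_nonneg fun i _ => Finset.sum_nonneg fun j _ => hKA0 i j
  set C := (∑ i, T * Kb i) * Real.exp ((∑ i, ∑ j, KA i j) * T) with hC
  have hTK : 0 ≤ ∑ i, T * Kb i := Finset.sum_nonneg fun i _ => mul_nonneg hT (hKb0 i)
  have hC0 : 0 ≤ C := by positivity
  -- Gronwall for the sum of all components gives a bound uniform in `a`. The integrand is then
  -- bounded, and its primitive is uniformly Lipschitz.
  have hbound : ∀ᶠ a in 𝓕, ∀ t ∈ Set.Icc 0 T, ∑ i, |u a t i| ≤ C := by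
    filter_upwards [eventually_all.2 hKb, eventually_all.2 hbc,
      eventually_all.2 fun i => eventually_all.2 fun j => (hKA i j).bound] with a h1 h2 h3 t ht
    have hxc : ContinuousOn (fun t => ∑ i, |u a t i|) (Set.Icc 0 T) :=
      continuousOn_finsetSum _ fun i _ => (hu a i).abs
    refine le_mul_exp_of_le_add_integral hTK hKA1 hxc
      (fun t _ => Finset.sum_nonneg fun i _ => abs_nonneg _) (fun t ht => ?_) ht
    have h0 : (0 : ℝ) ∈ Set.Icc 0 T := ⟨le_rfl, hT⟩
    have hsub : Set.Icc 0 t ⊆ Set.Icc 0 T := Set.Icc_subset_Icc_right ht.2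
    have key : ∀ i, |u a t i| ≤ T * Kb i + ∫ s in (0 : ℝ)..t, ∑ j, KA i j * |u a s j| := by
      intro i
      have i1 : IntervalIntegrable (fun s => b a s i) volume 0 t :=
        intervalIntegrable_of_continuousOn (h2 i) h0 ht
      have i2 : IntervalIntegrable (fun s => ∑ j, A i j a * u a s j) volume 0 t :=
        intervalIntegrable_of_continuousOn
          (continuousOn_finsetSum _ fun j _ => (hu a j).const_smul (A i j a)) h0 ht
      have i3 : IntervalIntegrable (fun s => ∑ j, KA i j * |u a s j|) volume 0 t :=
        intervalIntegrable_of_continuousOn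
          (continuousOn_finsetSum _ fun j _ => (hu a j).abs.const_smul (KA i j)) h0 ht
      rw [h a t ht i, intervalIntegral.integral_sub i1 i2]
      refine (abs_sub _ _).trans (add_le_add ?_ ?_)
      · refine (intervalIntegral.norm_integral_le_of_norm_le_const (f := fun s => b a s i)
          (C := Kb i) fun s hs => ?_).trans ?_
        · rw [Set.uIoc_of_le ht.1] at hs
          exact (h1 i s ⟨hs.1.le, hs.2.trans ht.2⟩).1
        · rw [sub_zero, abs_of_nonneg ht.1, mul_comm]
          exact mul_le_mul_of_nonneg_right ht.2 (hKb0 i)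
      · refine intervalIntegral.norm_integral_le_of_norm_le (f := fun s => ∑ j, A i j a * u a s j)
          ht.1 (Eventually.of_forall fun s _ => ?_) i3
        refine (Finset.abs_sum_le_sum_abs _ _).trans (Finset.sum_le_sum fun j _ => ?_)
        rw [abs_mul]
        gcongr
        simpa using h3 i j
    refine (Finset.sum_le_sum fun i _ => key i).trans ?_
    rw [Finset.sum_add_distrib, ← intervalIntegral.integral_finsetSum,
      ← intervalIntegral.integral_const_mul]
    · gcongr
      refine intervalIntegral.integral_mono_on ht.1 ?_ ?_ fun s hs => ?_
      · exact intervalIntegrable_of_continuousOn (continuousOn_finsetSum _ fun i _ =>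
          continuousOn_finsetSum _ fun j _ => (hu a j).abs.const_smul (KA i j)) h0 ht
      · exact intervalIntegrable_of_continuousOn (hxc.const_smul (∑ i, ∑ j, KA i j)) h0 ht
      · rw [Finset.sum_comm, Finset.mul_sum]
        refine Finset.sum_le_sum fun j _ => ?_
        rw [← Finset.sum_mul]
        gcongr with i
        exact Finset.single_le_sum (f := fun j => KA i j) (fun j _ => hKA0 i j) (Finset.mem_univ j)
    · intro i _
      exact intervalIntegrable_of_continuousOn
        (continuousOn_finsetSum _ fun j _ => (hu a j).abs.const_smul (KA i j)) h0 ht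
  have hI : UnifLip 𝓕 T fun a t => ∫ s in (0 : ℝ)..t, (b a s i - ∑ j, A i j a * u a s j) := by
    refine UnifLip.of_integral hT (K := Kb i + ∑ j, KA i j * C)
      (add_nonneg (hKb0 i) (Finset.sum_nonneg fun j _ => mul_nonneg (hKA0 i j) hC0)) ?_ ?_
    · filter_upwards [hbc i] with a ha
      exact ha.sub (continuousOn_finsetSum _ fun j _ => (hu a j).const_smul (A i j a))
    · filter_upwards [hKb i, hbound, eventually_all.2 fun j => (hKA i j).bound] with a h1 h2 h3 t ht
      refine (abs_sub _ _).trans (add_le_add (h1 t ht).1 ?_)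
      refine (Finset.abs_sum_le_sum_abs _ _).trans (Finset.sum_le_sum fun j _ => ?_)
      rw [abs_mul]
      gcongr
      · exact hKA0 i j
      · simpa using h3 j
      · exact (Finset.single_le_sum (f := fun j => |u a t j|) (fun _ _ => abs_nonneg _)
          (Finset.mem_univ j)).trans (h2 t ht)
  exact hI.congr (Eventually.of_forall fun a t ht => (h a t ht i).symm)

end

/-! ### Consequences of the a priori bounds -/

namespace MFRun

variable {ι I J E : Type*} [Fintype I] [Fintype J] [NormedAddCommGroup E] [NormedSpace ℝ E]
  [MeasurableSpace E] {r : MFRun ι I E} {s : MeanField I J E} {𝓕 : Filter ι} {T R : ℝ}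
  [ProperSpace E] {F : E → ℝ}

theorem Admissible.mean_isBigO (h : r.Admissible s 𝓕 T R) (hF : Continuous F) :
    r.mean F =O[𝓕] fun _ => (1 : ℝ) := by
  obtain ⟨K, hK0, hK⟩ := exists_bound_of_continuous hF R
  refine IsBigO.of_bound K ?_
  filter_upwards [h.supp] with a ha
  have := h.prob a
  have h1 : ‖∫ θ, F θ ∂r.ν a‖ ≤ K * (r.ν a).real Set.univ :=
    norm_integral_le_of_norm_le_const (ha.mono fun θ hθ => hK θ hθ)
  simpa [mean] using h1

theorem Admissible.emp_isBigO (h : r.Admissible s 𝓕 T R) (hs : s.Smooth) (hF : Continuous F) :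
    r.emp F =O[upTo 𝓕 r.n] fun _ => (1 : ℝ) := by
  obtain ⟨K, hK0, hK⟩ := exists_bound_of_continuous hF (R + 1)
  obtain ⟨K', -, h'⟩ := h.apriori hs
  refine isBigO_one_upTo.2 ⟨K, hK0, ?_⟩
  filter_upwards [h', h.N_pos] with a h1 h2 k hk
  exact abs_emp_le h2 fun m => hK _ (h1.1 k hk m)

theorem Admissible.emp_succ_sub_isBigO (h : r.Admissible s 𝓕 T R) (hs : s.Smooth)
    (hF : ContDiff ℝ 1 F) : (fun p : ι × ℕ => r.emp F (p.1, p.2 + 1) - r.emp F p)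
      =O[before 𝓕 r.n] fun p => (r.β p.1 * r.N p.1)⁻¹ := by
  obtain ⟨K, hK0, hK⟩ := exists_lipschitz_of_contDiff hF (R + 1)
  obtain ⟨K', hK0', h'⟩ := h.apriori hs
  refine isBigO_before (b := fun a => (r.β a * r.N a)⁻¹).2 ⟨K * K', by positivity, ?_⟩
  filter_upwards [h', h.N_pos, h.scale.eventually_ge_atTop 0] with a h1 h2 h3 k hk
  refine abs_emp_sub_le h2 fun m => (hK _ _ (h1.1 k hk.le m) (h1.1 (k + 1) hk m)).trans ?_
  rw [abs_of_nonneg (by positivity), mul_assoc]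
  gcongr
  exact h1.2.2.1 k hk m

theorem Admissible.inv_isBigO (h : r.Admissible s 𝓕 T R) {l : Filter (ι × ℕ)}
    (hl : Tendsto Prod.fst l 𝓕) :
    (fun p => (r.β p.1 * r.N p.1)⁻¹) =O[l] fun p => (r.N p.1 : ℝ)⁻¹ := by
  refine IsBigO.of_bound 1 ?_
  filter_upwards [hl.eventually (h.scale.eventually_ge_atTop 1)] with p hp
  rw [one_mul, mul_inv, norm_mul]
  refine mul_le_of_le_one_left (norm_nonneg _) ?_
  rw [norm_inv, Real.norm_of_nonneg (by linarith)]
  exact inv_le_one_of_one_le₀ hp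

theorem Admissible.slow_emp (h : r.Admissible s 𝓕 T R) (hs : s.Smooth)
    (hF : ContDiff ℝ 1 F) : Slow 𝓕 r.n r.N (r.emp F) :=
  ⟨h.emp_isBigO hs hF.continuous,
    (h.emp_succ_sub_isBigO hs hF).trans (h.inv_isBigO tendsto_fst_before)⟩

/-- Empirical averages move by O(1/(βN)) per step; the output carries an additional factor `β` and
still moves only by O(1/N), which is what summation by parts tolerates. -/
theorem Admissible.slow_out (h : r.Admissible s 𝓕 T R) (hs : s.Smooth) (i : I) :
    Slow 𝓕 r.n r.N (r.out s i) := by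
  constructor
  · obtain ⟨K, hK0, h'⟩ := h.apriori hs
    exact isBigO_one_upTo.2 ⟨K, hK0, h'.mono fun a ha k hk => ha.2.2.2 k hk i⟩
  · have h1 := (isBigO_refl (fun p : ι × ℕ => r.β p.1) (before 𝓕 r.n)).mul
      (h.emp_succ_sub_isBigO hs ((hs.G i).of_le (by norm_num)))
    refine (h1.congr_left fun p => by simp only [out]; ring).trans_eventuallyEq ?_
    filter_upwards [tendsto_fst_before.eventually (h.scale.eventually_gt_atTop 0)] with p hp
    field_simp

/-- Together with `slow_out`, this makes the coefficients of the sampling noise slowly varying. -/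
theorem Admissible.slow_drift (h : r.Admissible s 𝓕 T R) (hs : s.Smooth)
    (hF : ContDiff ℝ 2 F) (i : I) : Slow 𝓕 r.n r.N (r.drift s i F) := by
  refine (h.slow_emp hs (hs.contDiff_P i hF (by norm_num) (by norm_num))).add
    (Slow.sum _ fun j _ => ?_)
  exact (h.slow_emp hs ((hs.B i j).of_le (by norm_num))).mul
    (h.slow_emp hs (MeanField.contDiff_Q i j hF (by norm_num)))

theorem Admissible.driftMean_isBigO (h : r.Admissible s 𝓕 T R) (hs : s.Smooth)
    (hF : ContDiff ℝ 1 F) (i : I) : r.driftMean s i F =O[𝓕] fun _ => (1 : ℝ) := by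
  refine (h.mean_isBigO (hs.contDiff_P (m := 0) i hF (by norm_num) (by norm_num)).continuous).add
    (IsBigO.fun_sum fun j _ => ?_)
  simpa using (h.mean_isBigO (hs.B i j).continuous).mul
    (h.mean_isBigO (MeanField.contDiff_Q (s := s) (m := 0) i j hF (by norm_num)).continuous)

/-- The fluctuations are bounded. -/
theorem Admissible.fluct_isBigO (h : r.Admissible s 𝓕 T R) (hs : s.Smooth)
    (hF : ContDiff ℝ 1 F) : r.fluct F =O[upTo 𝓕 r.n] fun _ => (1 : ℝ) := by
  obtain ⟨K, hK0, hK⟩ := exists_lipschitz_of_contDiff hF (R + 1)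
  obtain ⟨K', hK0', h'⟩ := h.apriori hs
  refine isBigO_one_upTo.2 ⟨1 + K * K', by positivity, ?_⟩
  filter_upwards [h', h.N_pos, h.scale.eventually_ge_atTop 1,
    (h.init F hF.continuous).abs.eventually_le_const (show |(0 : ℝ)| < 1 by simp)]
    with a h1 h2 h3 h4 k hk
  have h3' : 0 < r.β a := by linarith
  have e1 : |r.fluct F (a, 0)| ≤ 1 := by
    rw [abs_mul, abs_of_pos h3'] at h4
    nlinarith [abs_nonneg (r.fluct F (a, 0))]
  -- The particles have moved by O(1/β) since the start, so multiplication by `β` leaves a bounded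
  -- quantity.
  have e2 : |r.emp F (a, k) - r.emp F (a, 0)| ≤ K * (K' * (r.β a)⁻¹) := by
    refine abs_emp_sub_le h2 fun m => (hK _ _ (h1.1 0 (Nat.zero_le _) m) (h1.1 k hk m)).trans ?_
    gcongr
    exact h1.2.1 k hk m
  have e3 : r.fluct F (a, k) = r.fluct F (a, 0) + r.β a * (r.emp F (a, k) - r.emp F (a, 0)) := by
    simp only [fluct]; ring
  rw [e3]
  refine (abs_add_le _ _).trans (add_le_add e1 ?_)
  rw [abs_mul, abs_of_pos h3']
  calc _ ≤ r.β a * (K * (K' * (r.β a)⁻¹)) := by gcongr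
    _ = _ := by field_simp

end MFRun

end DeepNet

namespace DeepNet

open Asymptotics

/-! ### Evolution equations of the fluctuations and their limits -/

namespace MFRun

variable {ι I J E : Type*} [Fintype I] [Fintype J] [NormedAddCommGroup E] [NormedSpace ℝ E]
  [MeasurableSpace E] {r : MFRun ι I E} {s : MeanField I J E} {𝓕 : Filter ι} {T R : ℝ}
  [ProperSpace E] {F : E → ℝ}

/-- The derivative is linear, and the coefficients `⟨B i j⟩` of the common drift do not depend on
the particle. They leave the average over the particles, which turns the mean first order increment
into a combination of the `drift s i F`. -/
theorem emp_fderiv_step {a : ι} {k : ℕ} {c : I → ℝ}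
    {δ : Fin (r.N a) → E} (hδ : ∀ m, δ m = (r.β a * r.N a)⁻¹ •
      ∑ i, c i • (s.p i (r.θ a k m) + ∑ j, r.emp (s.B i j) (a, k) • s.q i j)) :
    (r.N a : ℝ)⁻¹ * ∑ m, fderiv ℝ F (r.θ a k m) (δ m) =
      (r.β a * r.N a)⁻¹ * ∑ i, c i * r.drift s i F (a, k) := by
  have h1 : ∀ m, fderiv ℝ F (r.θ a k m) (δ m) = (r.β a * r.N a)⁻¹ * ∑ i, c i *
      (s.P i F (r.θ a k m) + ∑ j, r.emp (s.B i j) (a, k) * s.Q i j F (r.θ a k m)) := by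
    intro m
    simp only [hδ, map_smul, map_sum, map_add, smul_eq_mul, MeanField.P, MeanField.Q]
  simp only [h1]
  have h2 : ∀ i, r.drift s i F (a, k) = (r.N a : ℝ)⁻¹ * ∑ m, (s.P i F (r.θ a k m) +
      ∑ j, r.emp (s.B i j) (a, k) * s.Q i j F (r.θ a k m)) := by
    intro i
    rw [Finset.sum_add_distrib, mul_add, drift]
    congr 1
    · rw [Finset.sum_comm, Finset.mul_sum]
      refine Finset.sum_congr rfl fun j _ => ?_
      rw [← Finset.mul_sum, mul_left_comm]
      rfl
  simp only [h2]
  rw [← Finset.mul_sum, Finset.sum_comm, mul_left_comm, Finset.mul_sum]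
  congr 1
  refine Finset.sum_congr rfl fun i _ => ?_
  rw [← Finset.mul_sum, mul_left_comm]

/-- Along one step of gradient descent, the fluctuations follow the drift. -/
theorem Admissible.fluct_succ (h : r.Admissible s 𝓕 T R) (hs : s.Smooth) (hF : ContDiff ℝ 2 F) :
    (fun p : ι × ℕ => r.β p.1 * (r.N p.1 * (r.fluct F (p.1, p.2 + 1) - r.fluct F p) -
      ∑ i, r.w p.1 p.2 i * ((s.y i - r.out s i p) * r.drift s i F p)))
      =O[before 𝓕 r.n] fun p => (r.N p.1 : ℝ)⁻¹ := by
  obtain ⟨K, hK0, hK⟩ := exists_taylor_of_contDiff hF (R + 1)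
  obtain ⟨K', hK0', h'⟩ := h.apriori hs
  refine isBigO_before (b := fun a => (r.N a : ℝ)⁻¹).2 ⟨K * K' ^ 2, by positivity, ?_⟩
  filter_upwards [h', h.N_pos, h.scale.eventually_gt_atTop 0, h.step] with a h1 h2 h3 h4 k hk
  have h2' : (0 : ℝ) < r.N a := by exact_mod_cast h2
  have e1 := emp_fderiv_step (r := r) (s := s) (F := F) (a := a) (k := k)
    (c := fun i => r.w a k i * (s.y i - r.out s i (a, k)))
    (δ := fun m => r.θ a (k + 1) m - r.θ a k m) (fun m => by rw [h4 k m, add_sub_cancel_left])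
  -- After subtraction of the linear part only `N` Taylor remainders are left, each O((βN)⁻²).
  -- Multiplied by `β²` their sum is O(1/N).
  have e2 : r.β a * (r.N a * (r.fluct F (a, k + 1) - r.fluct F (a, k)) -
      ∑ i, r.w a k i * ((s.y i - r.out s i (a, k)) * r.drift s i F (a, k))) =
      r.β a ^ 2 * ∑ m, (F (r.θ a (k + 1) m) - F (r.θ a k m) -
        fderiv ℝ F (r.θ a k m) (r.θ a (k + 1) m - r.θ a k m)) := by
    have e3 : ∑ m, fderiv ℝ F (r.θ a k m) (r.θ a (k + 1) m - r.θ a k m) = (r.β a)⁻¹ *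
        ∑ i, r.w a k i * ((s.y i - r.out s i (a, k)) * r.drift s i F (a, k)) := by
      simp only [mul_assoc] at e1
      field_simp at e1 ⊢
      linarith
    rw [Finset.sum_sub_distrib, Finset.sum_sub_distrib, e3]
    simp only [fluct, emp]
    field_simp
    ring
  rw [e2, abs_mul, abs_of_nonneg (by positivity), abs_of_pos (a := (r.N a : ℝ)⁻¹) (by positivity)]
  have e4 : |∑ m, (F (r.θ a (k + 1) m) - F (r.θ a k m) -
        fderiv ℝ F (r.θ a k m) (r.θ a (k + 1) m - r.θ a k m))| ≤
      r.N a * (K * (K' * (r.β a * r.N a)⁻¹) ^ 2) := by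
    refine (Finset.abs_sum_le_sum_abs _ _).trans ((Finset.sum_le_card_nsmul _ _
      (K * (K' * (r.β a * r.N a)⁻¹) ^ 2) fun m _ =>
      (hK _ _ (h1.1 k hk.le m) (h1.1 (k + 1) hk m)).trans ?_).trans ?_)
    · gcongr
      exact h1.2.2.1 k hk m
    · simp
  calc _ ≤ r.β a ^ 2 * (r.N a * (K * (K' * (r.β a * r.N a)⁻¹) ^ 2)) := by gcongr
    _ = _ := by field_simp

theorem Admissible.inv_N_isLittleO (h : r.Admissible s 𝓕 T R) {l : Filter (ι × ℕ)}
    (hl : Tendsto Prod.fst l 𝓕) :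
    (fun p => (r.N p.1 : ℝ)⁻¹) =o[l] fun p => (r.β p.1)⁻¹ := by
  rw [isLittleO_iff_tendsto']
  · refine (h.scale_N.comp hl).congr fun p => ?_
    simp only [Function.comp_apply]
    rw [div_inv_eq_mul, mul_comm, div_eq_mul_inv]
  · filter_upwards [hl.eventually (h.scale.eventually_gt_atTop 0)] with p hp h0
    simp [hp.ne'] at h0

theorem Admissible.isLittleO_one_of_inv (h : r.Admissible s 𝓕 T R) {l : Filter (ι × ℕ)}
    (hl : Tendsto Prod.fst l 𝓕) {X : ι × ℕ → ℝ} (hX : X =o[l] fun p => (r.β p.1)⁻¹) :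
    (fun p => r.β p.1 * X p) =o[l] fun _ => (1 : ℝ) := by
  refine ((isBigO_refl (fun p : ι × ℕ => r.β p.1) l).mul_isLittleO hX).congr' EventuallyEq.rfl ?_
  filter_upwards [hl.eventually (h.scale.eventually_gt_atTop 0)] with p hp
  exact mul_inv_cancel₀ hp.ne'

theorem Admissible.inv_isLittleO_one (h : r.Admissible s 𝓕 T R) {l : Filter (ι × ℕ)}
    (hl : Tendsto Prod.fst l 𝓕) : (fun p => (r.β p.1)⁻¹) =o[l] fun _ => (1 : ℝ) := by
  rw [isLittleO_one_iff]
  exact h.scale.inv_tendsto_atTop.comp hl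

/-- The stochastic evolution of the fluctuations, averaged over the samples. -/
theorem Admissible.fluct_sub_avg (h : r.Admissible s 𝓕 T R) (hs : s.Smooth)
    (hF : ContDiff ℝ 2 F) : (fun p : ι × ℕ => r.β p.1 * r.fluct F p -
      avg r.N (fun p => r.β p.1 * ∑ i, s.π i * ((s.y i - r.out s i p) * r.drift s i F p)) p)
      =o[upTo 𝓕 r.n] fun _ => (1 : ℝ) := by
  set D : ι × ℕ → ℝ := fun p => r.β p.1 * (r.N p.1 * (r.fluct F (p.1, p.2 + 1) - r.fluct F p) -
      ∑ i, r.w p.1 p.2 i * ((s.y i - r.out s i p) * r.drift s i F p)) with hD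
  have h1 : avg r.N D =o[upTo 𝓕 r.n] fun _ => (1 : ℝ) :=
    (avg_isBigO (b := fun a => (r.N a : ℝ)⁻¹) h.N_pos h.n_le h.T_pos.le
      (h.fluct_succ hs hF)).trans_isLittleO
        ((h.inv_N_isLittleO tendsto_fst_upTo).trans (h.inv_isLittleO_one tendsto_fst_upTo))
  -- The samples are replaced by their means. The coefficient (y − out) · drift depends on past
  -- samples, but it varies slowly, so summation by parts reduces everything to the partial sums of
  -- the noise alone, without any conditioning on the past.
  have h2 : ∀ i, (fun p : ι × ℕ => r.β p.1 * avg r.N (fun p => (r.w p.1 p.2 i - s.π i) *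
      ((s.y i - r.out s i p) * r.drift s i F p)) p) =o[upTo 𝓕 r.n] fun _ => (1 : ℝ) := by
    intro i
    have hsl := ((Slow.const (s.y i)).sub (h.slow_out hs i)).mul (h.slow_drift hs hF i)
    exact h.isLittleO_one_of_inv tendsto_fst_upTo
      (avg_mul_isLittleO (b := fun a => (r.β a)⁻¹) h.N_pos h.n_le h.T_pos (h.noise i) hsl.1 hsl.2)
  have h3 : (fun p : ι × ℕ => r.β p.1 * r.fluct F (p.1, 0)) =o[upTo 𝓕 r.n] fun _ => (1 : ℝ) := by
    rw [isLittleO_one_iff]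
    exact (h.init F hF.continuous).comp tendsto_fst_upTo
  refine ((h3.add h1).add (IsLittleO.fun_sum fun i (_ : i ∈ Finset.univ) => h2 i)).congr'
    ?_ EventuallyEq.rfl
  filter_upwards [tendsto_fst_upTo.eventually h.N_pos] with p hp
  have hp' : (r.N p.1 : ℝ) ≠ 0 := by exact_mod_cast hp.ne'
  have e1 : avg r.N D p = r.β p.1 * (r.fluct F p - r.fluct F (p.1, 0)) -
      avg r.N (fun p => r.β p.1 * ∑ i, r.w p.1 p.2 i *
        ((s.y i - r.out s i p) * r.drift s i F p)) p := by
    simp only [hD, mul_sub]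
    rw [avg_sub, avg_sub]
    simp only
    congr 1
    simp only [avg]
    rw [← mul_sub, ← Finset.sum_sub_distrib]
    have : ∀ m, r.β p.1 * (r.N p.1 * r.fluct F (p.1, m + 1)) - r.β p.1 * (r.N p.1 *
      r.fluct F (p.1, m)) = r.β p.1 * r.N p.1 * (r.fluct F (p.1, m + 1) - r.fluct F (p.1, m)) :=
        fun m => by ring
    simp only [this]
    rw [← Finset.mul_sum, Finset.sum_range_sub (fun m => r.fluct F (p.1, m))]
    field_simp
  have e2 : ∑ i, r.β p.1 * avg r.N (fun p => (r.w p.1 p.2 i - s.π i) *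
      ((s.y i - r.out s i p) * r.drift s i F p)) p =
      avg r.N (fun p => r.β p.1 * ∑ i, r.w p.1 p.2 i *
        ((s.y i - r.out s i p) * r.drift s i F p)) p -
      avg r.N (fun p => r.β p.1 * ∑ i, s.π i *
        ((s.y i - r.out s i p) * r.drift s i F p)) p := by
    rw [avg_mul_left r.β, avg_mul_left r.β, avg_sum, avg_sum]
    simp only
    rw [← mul_sub, ← Finset.sum_sub_distrib, Finset.mul_sum]
    refine Finset.sum_congr rfl fun i _ => ?_
    simp only [sub_mul (r.w _ _ _)]
    rw [avg_sub]
  rw [e1, e2]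
  ring

/-- Splitting `y - h` turns the equation for `h` into a linear Volterra equation with constant
source and bounded coefficients. Bounds and Lipschitz constants are thus uniform in the random
initial inner weights. -/
theorem Admissible.unifLip_h (h : r.Admissible s 𝓕 T R) (hs : s.Smooth) (i : I) :
    UnifLip 𝓕 T fun a t => r.h a t i := by
  have hG : ∀ i, ContDiff ℝ 1 (s.G i) := fun i => (hs.G i).of_le (by norm_num)
  refine unifLip_of_volterra h.T_pos.le h.h_continuousOn
    (b := fun a _ i => ∑ j, s.π j * (s.y j * r.driftMean s j (s.G i) a))
    (A := fun i j a => s.π j * r.driftMean s j (s.G i) a) (fun i => ?_) (fun i j => ?_)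
    (fun a t ht i => ?_) i
  · refine UnifLip.const (IsBigO.fun_sum fun j _ => ?_)
    exact ((h.driftMean_isBigO hs (hG i) j).const_mul_left _).const_mul_left _
  · exact (h.driftMean_isBigO hs (hG i) j).const_mul_left _
  · rw [h.h_eq a t ht i, lim]
    congr 1
    funext u
    rw [← Finset.sum_sub_distrib]
    exact Finset.sum_congr rfl fun j _ => by ring

theorem Admissible.unifLip_limIntegrand (h : r.Admissible s 𝓕 T R) (hs : s.Smooth)
    (hF : ContDiff ℝ 1 F) : UnifLip 𝓕 T fun a u =>
      ∑ i, s.π i * ((s.y i - r.h a u i) * r.driftMean s i F a) := by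
  refine UnifLip.sum _ fun i _ => UnifLip.const_mul (isBigO_const_one ℝ _ _) ?_
  exact ((UnifLip.const (isBigO_const_one ℝ _ _)).sub (h.unifLip_h hs i)).mul
    (UnifLip.const (h.driftMean_isBigO hs hF i))

theorem Admissible.unifLip_lim (h : r.Admissible s 𝓕 T R) (hs : s.Smooth)
    (hF : ContDiff ℝ 1 F) : UnifLip 𝓕 T (r.lim s F) :=
  (h.unifLip_limIntegrand hs hF).integral h.T_pos.le

theorem Admissible.unifLip_driftLim (h : r.Admissible s 𝓕 T R) (hs : s.Smooth)
    (hF : ContDiff ℝ 2 F) (i : I) : UnifLip 𝓕 T (r.driftLim s i F) := by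
  refine ((h.unifLip_lim hs (hs.contDiff_P i hF (by norm_num) (by norm_num))).add
    (UnifLip.sum _ fun j _ => ?_)).add (UnifLip.sum _ fun j _ => ?_)
  · exact UnifLip.const_mul (h.mean_isBigO (hs.B i j).continuous)
      (h.unifLip_lim hs (MeanField.contDiff_Q i j hF (by norm_num)))
  · exact (h.unifLip_lim hs ((hs.B i j).of_le (by norm_num))).mul (UnifLip.const
      (h.mean_isBigO (MeanField.contDiff_Q (m := 1) i j hF (by norm_num)).continuous))

/-- The equation for `κ` has the same linear part as that for `h`; its source is built from `h` and
`driftLim`, which are already uniformly Lipschitz. -/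
theorem Admissible.unifLip_κ (h : r.Admissible s 𝓕 T R) (hs : s.Smooth) (i : I) :
    UnifLip 𝓕 T fun a t => r.κ a t i := by
  have hG : ∀ i, ContDiff ℝ 1 (s.G i) := fun i => (hs.G i).of_le (by norm_num)
  have hG' : ∀ i, ContDiff ℝ 2 (s.G i) := fun i => (hs.G i).of_le (by norm_num)
  refine unifLip_of_volterra h.T_pos.le h.κ_continuousOn
    (b := fun a u i => ∑ j, s.π j * ((s.y j - r.h a u j) * r.driftLim s j (s.G i) a u))
    (A := fun i j a => s.π j * r.driftMean s j (s.G i) a) (fun i => ?_) (fun i j => ?_)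
    (fun a t ht i => ?_) i
  · refine UnifLip.sum _ fun j _ => UnifLip.const_mul (isBigO_const_one ℝ _ _) ?_
    exact ((UnifLip.const (isBigO_const_one ℝ _ _)).sub (h.unifLip_h hs j)).mul
      (h.unifLip_driftLim hs (hG' i) j)
  · exact (h.driftMean_isBigO hs (hG i) j).const_mul_left _
  · rw [h.κ_eq a t ht i, lim₂]
    congr 1
    funext u
    rw [← Finset.sum_sub_distrib]
    exact Finset.sum_congr rfl fun j _ => by ring

theorem Admissible.unifLip_lim₂Integrand (h : r.Admissible s 𝓕 T R) (hs : s.Smooth)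
    (hF : ContDiff ℝ 2 F) : UnifLip 𝓕 T fun a u => ∑ i, s.π i *
      ((s.y i - r.h a u i) * r.driftLim s i F a u - r.κ a u i * r.driftMean s i F a) := by
  refine UnifLip.sum _ fun i _ => UnifLip.const_mul (isBigO_const_one ℝ _ _) ?_
  exact (((UnifLip.const (isBigO_const_one ℝ _ _)).sub (h.unifLip_h hs i)).mul
    (h.unifLip_driftLim hs hF i)).sub ((h.unifLip_κ hs i).mul
      (UnifLip.const (h.driftMean_isBigO hs (hF.of_le (by norm_num)) i)))

theorem Admissible.unifLip_lim₂ (h : r.Admissible s 𝓕 T R) (hs : s.Smooth)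
    (hF : ContDiff ℝ 2 F) : UnifLip 𝓕 T (r.lim₂ s F) :=
  (h.unifLip_lim₂Integrand hs hF).integral h.T_pos.le

/-- The second order fluctuations at the steps of gradient descent. -/
noncomputable def fluct₂ (r : MFRun ι I E) (s : MeanField I J E) (F : E → ℝ) (p : ι × ℕ) : ℝ :=
  r.β p.1 * (r.fluct F p - atStep r.N (r.lim s F) p)

/-- The fluctuations of the drift. -/
noncomputable def driftFluct (r : MFRun ι I E) (s : MeanField I J E) (i : I) (F : E → ℝ)
    (p : ι × ℕ) : ℝ :=
  r.β p.1 * (r.drift s i F p - r.driftMean s i F p.1)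

/-- From bq − b₀q₀ = b₀(q − q₀) + (b − b₀)q₀ + (b − b₀)(q − q₀): the fluctuation of the drift is
linear in first order fluctuations, except for a product of two of them, which comes with a factor
`β⁻¹`. -/
theorem driftFluct_eq {i : I} {p : ι × ℕ} (hβ : r.β p.1 ≠ 0) :
    r.driftFluct s i F p = r.fluct (s.P i F) p +
      ∑ j, r.mean (s.B i j) p.1 * r.fluct (s.Q i j F) p +
      ∑ j, r.fluct (s.B i j) p * r.mean (s.Q i j F) p.1 +
      (r.β p.1)⁻¹ * ∑ j, r.fluct (s.B i j) p * r.fluct (s.Q i j F) p := by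
  simp only [driftFluct, drift, driftMean, Finset.mul_sum, mul_sub, mul_add]
  rw [add_sub_add_comm, ← Finset.sum_sub_distrib, add_assoc, add_assoc, ← Finset.sum_add_distrib,
    ← Finset.sum_add_distrib]
  congr 1
  · simp only [fluct]; ring
  · refine Finset.sum_congr rfl fun j _ => ?_
    simp only [fluct]
    field_simp
    ring

theorem Admissible.driftFluct_remainder (h : r.Admissible s 𝓕 T R) (hs : s.Smooth)
    (hF : ContDiff ℝ 2 F) (i : I) :
    (fun p => (r.β p.1)⁻¹ * ∑ j, r.fluct (s.B i j) p * r.fluct (s.Q i j F) p)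
      =o[upTo 𝓕 r.n] fun _ => (1 : ℝ) := by
  have h1 : (fun p => ∑ j, r.fluct (s.B i j) p * r.fluct (s.Q i j F) p) =O[upTo 𝓕 r.n]
      fun _ => (1 : ℝ) := by
    refine IsBigO.fun_sum fun j _ => ?_
    simpa using (h.fluct_isBigO hs ((hs.B i j).of_le (by norm_num))).mul
      (h.fluct_isBigO hs (MeanField.contDiff_Q (s := s) i j hF (by norm_num)))
  simpa using (h.inv_isLittleO_one tendsto_fst_upTo).mul_isBigO h1

theorem Admissible.eventually_β_ne (h : r.Admissible s 𝓕 T R) :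
    ∀ᶠ p in upTo 𝓕 r.n, r.β p.1 ≠ 0 :=
  tendsto_fst_upTo.eventually ((h.scale.eventually_gt_atTop 0).mono fun _ ha => ha.ne')

theorem comp_fst_isBigO {c : ι → ℝ} (hc : c =O[𝓕] fun _ => (1 : ℝ)) {n : ι → ℕ} :
    (fun p : ι × ℕ => c p.1) =O[upTo 𝓕 n] fun _ => (1 : ℝ) :=
  hc.comp_tendsto tendsto_fst_upTo

theorem Admissible.driftFluct_isBigO (h : r.Admissible s 𝓕 T R) (hs : s.Smooth)
    (hF : ContDiff ℝ 2 F) (i : I) : r.driftFluct s i F =O[upTo 𝓕 r.n] fun _ => (1 : ℝ) := by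
  have hQ : ∀ j, ContDiff ℝ 1 (s.Q i j F) := fun j => MeanField.contDiff_Q i j hF (by norm_num)
  have h1 := h.fluct_isBigO hs (hs.contDiff_P (m := 1) i hF (by norm_num) (by norm_num))
  have h2 : (fun p => ∑ j, r.mean (s.B i j) p.1 * r.fluct (s.Q i j F) p) =O[upTo 𝓕 r.n]
      fun _ => (1 : ℝ) := by
    refine IsBigO.fun_sum fun j _ => ?_
    simpa using (comp_fst_isBigO (h.mean_isBigO (hs.B i j).continuous)).mul
      (h.fluct_isBigO hs (hQ j))
  have h3 : (fun p => ∑ j, r.fluct (s.B i j) p * r.mean (s.Q i j F) p.1) =O[upTo 𝓕 r.n]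
      fun _ => (1 : ℝ) := by
    refine IsBigO.fun_sum fun j _ => ?_
    simpa using (h.fluct_isBigO hs ((hs.B i j).of_le (by norm_num))).mul
      (comp_fst_isBigO (h.mean_isBigO (hQ j).continuous))
  refine (((h1.add h2).add h3).add (h.driftFluct_remainder hs hF i).isBigO).congr' ?_
    EventuallyEq.rfl
  filter_upwards [h.eventually_β_ne] with p hp
  exact (driftFluct_eq hp).symm

/-- The output and `h` are the fluctuation and the limit of the same observable `G i`. The error of
the output is therefore one of the unknowns, and no new quantity enters the equations. -/
theorem Admissible.out_sub_h (h : r.Admissible s 𝓕 T R) (i : I) :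
    ∀ᶠ p in upTo 𝓕 r.n, r.β p.1 * (r.out s i p - atStep r.N (fun a t => r.h a t i) p) =
      r.fluct₂ s (s.G i) p := by
  refine eventually_upTo.2 ?_
  filter_upwards [h.N_pos, h.n_le] with a h1 h2 k hk
  simp only [fluct₂, atStep, out_eq_fluct h, h.h_eq a _ (step_mem_Icc h1 h2 hk)]

theorem avg_congr {X Y : ι × ℕ → ℝ} {N n : ι → ℕ} (hXY : ∀ᶠ p in before 𝓕 n, X p = Y p) :
    ∀ᶠ p in upTo 𝓕 n, avg N X p = avg N Y p := by
  refine eventually_upTo.2 ((eventually_before.1 hXY).mono fun a ha k hk => ?_)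
  simp only [avg]
  congr 1
  exact Finset.sum_congr rfl fun m hm => ha m ((Finset.mem_range.1 hm).trans_le hk)

theorem Admissible.integral_sub_avg (h : r.Admissible s 𝓕 T R) {X : ι → ℝ → ℝ}
    (hX : UnifLip 𝓕 T X) : (fun p : ι × ℕ => r.β p.1 *
      (atStep r.N (fun a t => ∫ u in (0 : ℝ)..t, X a u) p - avg r.N (atStep r.N X) p))
      =o[upTo 𝓕 r.n] fun _ => (1 : ℝ) :=
  h.isLittleO_one_of_inv tendsto_fst_upTo ((hX.integral_sub_avg_isBigO h.T_pos.le h.N_pos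
    h.n_le).trans_isLittleO (h.inv_N_isLittleO tendsto_fst_upTo))

/-- The evolution of the second order fluctuations. -/
theorem Admissible.fluct₂_sub_avg (h : r.Admissible s 𝓕 T R) (hs : s.Smooth)
    (hF : ContDiff ℝ 2 F) : (fun p : ι × ℕ => r.fluct₂ s F p -
      avg r.N (fun p => ∑ i, s.π i * ((s.y i - r.out s i p) * r.driftFluct s i F p -
        r.fluct₂ s (s.G i) p * r.driftMean s i F p.1)) p)
      =o[upTo 𝓕 r.n] fun _ => (1 : ℝ) := by
  set X : ι → ℝ → ℝ := fun a u => ∑ i, s.π i * ((s.y i - r.h a u i) * r.driftMean s i F a)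
    with hX
  have h1 := h.fluct_sub_avg hs hF
  have h2 := h.integral_sub_avg (h.unifLip_limIntegrand hs (hF.of_le (by norm_num)))
  -- Uses (y − out) drift − (y − h) driftMean = (y − out)(drift − driftMean) − (out − h) driftMean,
  -- multiplied by `β`.
  have h3 : ∀ᶠ p in before 𝓕 r.n, r.β p.1 * ∑ i, s.π i * ((s.y i - r.out s i p) *
      r.drift s i F p) - r.β p.1 * atStep r.N X p =
      ∑ i, s.π i * ((s.y i - r.out s i p) * r.driftFluct s i F p -
        r.fluct₂ s (s.G i) p * r.driftMean s i F p.1) := by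
    filter_upwards [eventually_all.2 fun i => before_le_upTo (h.out_sub_h i)] with p hp
    rw [← mul_sub]
    simp only [atStep, hX] at hp ⊢
    rw [← Finset.sum_sub_distrib, Finset.mul_sum]
    refine Finset.sum_congr rfl fun i _ => ?_
    rw [← hp i]
    simp only [driftFluct]
    ring
  refine (h1.sub h2).congr' ?_ EventuallyEq.rfl
  filter_upwards [avg_congr (N := r.N) h3] with p hp
  rw [← hp, avg_sub, avg_mul_left r.β (atStep r.N X)]
  have : r.lim s F = fun a t => ∫ u in (0 : ℝ)..t, X a u := rfl
  simp only [fluct₂, this]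
  ring

/-- The second order fluctuations are bounded. -/
theorem Admissible.fluct₂_isBigO (h : r.Admissible s 𝓕 T R) (hs : s.Smooth)
    (hF : ContDiff ℝ 2 F) : r.fluct₂ s F =O[upTo 𝓕 r.n] fun _ => (1 : ℝ) := by
  have h1 : ∀ {F : E → ℝ}, ContDiff ℝ 2 F → (avg r.N fun p => ∑ i, s.π i *
      ((s.y i - r.out s i p) * r.driftFluct s i F p)) =O[upTo 𝓕 r.n] fun _ => (1 : ℝ) := by
    intro F hF
    refine avg_isBigO (b := fun _ => 1) h.N_pos h.n_le h.T_pos.le ?_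
    refine IsBigO.mono (IsBigO.fun_sum fun i _ => IsBigO.const_mul_left ?_ _) before_le_upTo
    simpa using (((Slow.const (s.y i)).sub (h.slow_out hs i)).1).mul (h.driftFluct_isBigO hs hF i)
  -- The term with `driftFluct` is bounded and counts as part of the source; what remains is linear
  -- in the unknowns `fluct₂ s (s.G i)`.
  have h2 : ∀ {F : E → ℝ}, ContDiff ℝ 2 F → (fun p => r.fluct₂ s F p -
      avg r.N (fun p => ∑ i, (-(s.π i * r.driftMean s i F p.1)) * r.fluct₂ s (s.G i) p) p)
        =O[upTo 𝓕 r.n] fun _ => (1 : ℝ) := by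
    intro F hF
    refine ((h.fluct₂_sub_avg hs hF).isBigO.add (h1 hF)).congr_left fun p => ?_
    rw [sub_add, ← congrFun (avg_sub _ _) p]
    congr 3
    funext p
    rw [← Finset.sum_sub_distrib]
    exact Finset.sum_congr rfl fun i _ => by ring
  have hG : ∀ i, ContDiff ℝ 2 (s.G i) := fun i => (hs.G i).of_le (by norm_num)
  have hc : ∀ {F : E → ℝ}, ContDiff ℝ 2 F → ∀ j, (fun p : ι × ℕ => -(s.π j *
      r.driftMean s j F p.1)) =O[upTo 𝓕 r.n] fun _ => (1 : ℝ) := fun hF j =>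
    (comp_fst_isBigO ((h.driftMean_isBigO hs (hF.of_le (by norm_num)) j).const_mul_left _)).neg_left
  -- For `F = G i` the recursion is closed, and Gronwall applies. For a general `F` the bounds for
  -- the `G i` are then inserted, with no further Gronwall argument.
  have h3 : ∀ i, r.fluct₂ s (s.G i) =O[upTo 𝓕 r.n] fun _ => (1 : ℝ) := fun i =>
    gronwall_isBigO (e := fun i => r.fluct₂ s (s.G i))
      (c := fun i j p => -(s.π j * r.driftMean s j (s.G i) p.1)) h.N_pos h.n_le
      (fun i j => (hc (hG i) j).mono before_le_upTo)
      (fun i => Eventually.of_forall fun p => (sub_add_cancel _ _).symm) (fun i => h2 (hG i)) i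
  refine ((h2 hF).add (avg_isBigO (b := fun _ => 1) h.N_pos h.n_le h.T_pos.le
    (IsBigO.mono (IsBigO.fun_sum fun i _ => ?_) before_le_upTo))).congr_left
      fun p => sub_add_cancel _ _
  simpa using (hc hF i).mul (h3 i)

/-- A bounded second order fluctuation divided by `β`: first order convergence is a by-product, and
it feeds the second round of the argument. -/
theorem Admissible.fluct_sub_lim (h : r.Admissible s 𝓕 T R) (hs : s.Smooth)
    (hF : ContDiff ℝ 2 F) :
    (fun p => r.fluct F p - atStep r.N (r.lim s F) p) =o[upTo 𝓕 r.n] fun _ => (1 : ℝ) := by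
  have h1 := (h.inv_isLittleO_one (tendsto_fst_upTo (n := r.n))).mul_isBigO (h.fluct₂_isBigO hs hF)
  simp only [one_mul] at h1
  refine h1.congr' ?_ EventuallyEq.rfl
  filter_upwards [h.eventually_β_ne] with p hp
  simp only [fluct₂]
  field_simp

/-- This is where the third derivative of `F` is spent: `P` and `Q` consume one, and first order
convergence of the resulting observables needs two. -/
theorem Admissible.driftFluct_sub_driftLim (h : r.Admissible s 𝓕 T R) (hs : s.Smooth)
    (hF : ContDiff ℝ 3 F) (i : I) :
    (fun p => r.driftFluct s i F p - atStep r.N (r.driftLim s i F) p)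
      =o[upTo 𝓕 r.n] fun _ => (1 : ℝ) := by
  have hQ : ∀ j, ContDiff ℝ 2 (s.Q i j F) := fun j => MeanField.contDiff_Q i j hF (by norm_num)
  have h1 := h.fluct_sub_lim hs (hs.contDiff_P (m := 2) i hF (by norm_num) (by norm_num))
  have h2 : (fun p => ∑ j, r.mean (s.B i j) p.1 * (r.fluct (s.Q i j F) p -
      atStep r.N (r.lim s (s.Q i j F)) p)) =o[upTo 𝓕 r.n] fun _ => (1 : ℝ) := by
    refine IsLittleO.fun_sum fun j _ => ?_
    simpa using (comp_fst_isBigO (h.mean_isBigO (hs.B i j).continuous)).mul_isLittleO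
      (h.fluct_sub_lim hs (hQ j))
  have h3 : (fun p => ∑ j, (r.fluct (s.B i j) p - atStep r.N (r.lim s (s.B i j)) p) *
      r.mean (s.Q i j F) p.1) =o[upTo 𝓕 r.n] fun _ => (1 : ℝ) := by
    refine IsLittleO.fun_sum fun j _ => ?_
    simpa using (h.fluct_sub_lim hs ((hs.B i j).of_le (by norm_num))).mul_isBigO
      (comp_fst_isBigO (h.mean_isBigO (hQ j).continuous))
  refine (((h1.add h2).add h3).add (h.driftFluct_remainder hs (hF.of_le (by norm_num)) i)).congr'
    ?_ EventuallyEq.rfl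
  filter_upwards [h.eventually_β_ne] with p hp
  rw [driftFluct_eq hp]
  simp only [atStep, driftLim, mul_sub, sub_mul, Finset.sum_sub_distrib]
  ring

theorem Admissible.out_sub_h_isLittleO (h : r.Admissible s 𝓕 T R) (hs : s.Smooth) (i : I) :
    (fun p => r.out s i p - atStep r.N (fun a t => r.h a t i) p)
      =o[upTo 𝓕 r.n] fun _ => (1 : ℝ) := by
  refine (h.fluct_sub_lim hs ((hs.G i).of_le (by norm_num))).congr' ?_ EventuallyEq.rfl
  filter_upwards [h.out_sub_h i, h.eventually_β_ne] with p h1 h2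
  exact (mul_left_cancel₀ h2 h1).symm

/-- The limit of the second order fluctuations at the steps of gradient descent. -/
theorem Admissible.fluct₂_sub_lim₂ (h : r.Admissible s 𝓕 T R) (hs : s.Smooth)
    (hF : ContDiff ℝ 3 F) :
    (fun p => r.fluct₂ s F p - atStep r.N (r.lim₂ s F) p) =o[upTo 𝓕 r.n] fun _ => (1 : ℝ) := by
  have hc : ∀ {F : E → ℝ}, ContDiff ℝ 3 F → ∀ j, (fun p : ι × ℕ => -(s.π j *
      r.driftMean s j F p.1)) =O[upTo 𝓕 r.n] fun _ => (1 : ℝ) := fun hF j =>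
    (comp_fst_isBigO ((h.driftMean_isBigO hs (hF.of_le (by norm_num)) j).const_mul_left _)).neg_left
  have h2 : ∀ {F : E → ℝ}, ContDiff ℝ 3 F →
      (fun p => (r.fluct₂ s F p - atStep r.N (r.lim₂ s F) p) -
        avg r.N (fun p => ∑ i, (-(s.π i * r.driftMean s i F p.1)) *
          (r.fluct₂ s (s.G i) p - atStep r.N (r.lim₂ s (s.G i)) p)) p)
        =o[upTo 𝓕 r.n] fun _ => (1 : ℝ) := by
    intro F hF
    have hF2 : ContDiff ℝ 2 F := hF.of_le (by norm_num)
    set X : ι → ℝ → ℝ := fun a u => ∑ i, s.π i * ((s.y i - r.h a u i) * r.driftLim s i F a u -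
      r.κ a u i * r.driftMean s i F a) with hX
    have e1 := h.fluct₂_sub_avg hs hF2
    have e2 : (fun p : ι × ℕ => atStep r.N (r.lim₂ s F) p - avg r.N (atStep r.N X) p)
        =o[upTo 𝓕 r.n] fun _ => (1 : ℝ) :=
      ((h.unifLip_lim₂Integrand hs hF2).integral_sub_avg_isBigO h.T_pos.le h.N_pos
        h.n_le).trans_isLittleO
        ((h.inv_N_isLittleO tendsto_fst_upTo).trans (h.inv_isLittleO_one tendsto_fst_upTo))
    -- The difference (y − out) driftFluct − (y − h) driftLim, written as two products in each of
    -- which one factor is o(1) and the other bounded.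
    have e3 : (avg r.N fun p => ∑ i, s.π i * ((s.y i - r.out s i p) * (r.driftFluct s i F p -
        atStep r.N (r.driftLim s i F) p) - (r.out s i p - atStep r.N (fun a t => r.h a t i) p) *
          atStep r.N (r.driftLim s i F) p)) =o[upTo 𝓕 r.n] fun _ => (1 : ℝ) := by
      refine avg_isLittleO (b := fun _ => 1) h.N_pos h.n_le h.T_pos
        (IsLittleO.mono (IsLittleO.fun_sum fun i _ => IsLittleO.const_mul_left
          (IsLittleO.sub ?_ ?_) _) before_le_upTo)
      · simpa using (((Slow.const (s.y i)).sub (h.slow_out hs i)).1).mul_isLittleO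
          (h.driftFluct_sub_driftLim hs hF i)
      · simpa using (h.out_sub_h_isLittleO hs i).mul_isBigO
          ((h.unifLip_driftLim hs hF2 i).atStep_isBigO h.N_pos h.n_le)
    have e4 : ∀ᶠ p in before 𝓕 r.n, (∑ i, s.π i * ((s.y i - r.out s i p) * r.driftFluct s i F p -
        r.fluct₂ s (s.G i) p * r.driftMean s i F p.1)) - atStep r.N X p -
        (∑ i, s.π i * ((s.y i - r.out s i p) * (r.driftFluct s i F p -
        atStep r.N (r.driftLim s i F) p) - (r.out s i p - atStep r.N (fun a t => r.h a t i) p) *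
          atStep r.N (r.driftLim s i F) p)) = ∑ i, (-(s.π i * r.driftMean s i F p.1)) *
          (r.fluct₂ s (s.G i) p - atStep r.N (r.lim₂ s (s.G i)) p) := by
      refine before_le_upTo (eventually_upTo.2 ?_)
      filter_upwards [h.N_pos, h.n_le] with a h1 h2 k hk
      simp only [atStep, hX]
      rw [← Finset.sum_sub_distrib, ← Finset.sum_sub_distrib]
      refine Finset.sum_congr rfl fun i _ => ?_
      rw [← h.κ_eq a _ (step_mem_Icc h1 h2 hk)]
      ring
    refine ((e1.sub e2).add e3).congr' ?_ EventuallyEq.rfl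
    filter_upwards [avg_congr (N := r.N) e4] with p hp
    rw [← hp, avg_sub, avg_sub]
    ring
  have hG := hs.G
  have h3 : ∀ i, (fun p => r.fluct₂ s (s.G i) p - atStep r.N (r.lim₂ s (s.G i)) p)
      =o[upTo 𝓕 r.n] fun _ => (1 : ℝ) := fun i =>
    gronwall_isLittleO (e := fun i p => r.fluct₂ s (s.G i) p - atStep r.N (r.lim₂ s (s.G i)) p)
      (c := fun i j p => -(s.π j * r.driftMean s j (s.G i) p.1)) h.N_pos h.n_le
      (fun i j => (hc (hG i) j).mono before_le_upTo)
      (fun i => Eventually.of_forall fun p => (sub_add_cancel _ _).symm) (fun i => h2 (hG i)) i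
  refine ((h2 hF).add (avg_isLittleO (b := fun _ => 1) h.N_pos h.n_le h.T_pos
    (IsLittleO.mono (IsLittleO.fun_sum fun i _ => ?_) before_le_upTo))).congr_left
      fun p => sub_add_cancel _ _
  simpa using (hc hF i).mul_isLittleO (h3 i)

end MFRun

end DeepNet

namespace DeepNet

open Asymptotics

namespace MFRun

variable {ι I J E : Type*} [Fintype I] [Fintype J] [NormedAddCommGroup E] [NormedSpace ℝ E]
  [MeasurableSpace E] {r : MFRun ι I E} {s : MeanField I J E} {𝓕 : Filter ι} {T R : ℝ}
  [ProperSpace E] {F G : E → ℝ}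

/-- The second order fluctuations converge, uniformly in time. -/
theorem Admissible.eventually_abs_sub_lim₂_le (h : r.Admissible s 𝓕 T R) (hs : s.Smooth)
    (hn : ∀ a, r.n a = ⌊(r.N a : ℝ) * T⌋₊) (hF : ContDiff ℝ 3 F) {δ : ℝ} (hδ : 0 < δ) :
    ∀ᶠ a in 𝓕, ∀ t ∈ Set.Icc 0 T,
      |r.β a * (r.fluct F (a, ⌊(r.N a : ℝ) * t⌋₊) - r.lim s F a t) - r.lim₂ s F a t| ≤ δ := by
  obtain ⟨K, hK0, hK⟩ := h.unifLip_lim hs (hF.of_le (by norm_num))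
  obtain ⟨K', hK0', hK'⟩ := h.unifLip_lim₂ hs (hF.of_le (by norm_num))
  have h1 := isLittleO_one_upTo.1 (h.fluct₂_sub_lim₂ hs hF) (δ / 2) (by positivity)
  have h2 : Tendsto (fun a => (K + K') * (r.β a / r.N a)) 𝓕 (𝓝 0) := by
    simpa using h.scale_N.const_mul (K + K')
  filter_upwards [hK, hK', h1, h2.eventually_le_const (show 0 < δ / 2 by positivity), h.N_pos,
    h.scale.eventually_ge_atTop 1, h.n_le] with a e1 e2 e3 e4 e5 e6 e7 t ht
  have hN' : (0 : ℝ) < r.N a := by exact_mod_cast e5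
  set k := ⌊(r.N a : ℝ) * t⌋₊ with hk
  have hkn : k ≤ r.n a := by
    rw [hn a]
    exact Nat.floor_mono (by have := ht.2; gcongr)
  have hmem := step_mem_Icc e5 e7 hkn
  have hNt : 0 ≤ (r.N a : ℝ) * t := mul_nonneg hN'.le ht.1
  have hdist : |(k : ℝ) / r.N a - t| ≤ (r.N a : ℝ)⁻¹ := by
    have a1 : (k : ℝ) / r.N a ≤ t := by
      rw [div_le_iff₀ hN', mul_comm]; exact Nat.floor_le hNt
    have a2 : t - (k : ℝ) / r.N a ≤ (r.N a : ℝ)⁻¹ := by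
      have := (Nat.lt_floor_add_one ((r.N a : ℝ) * t)).le
      rw [← hk] at this
      have : t ≤ (k + 1 : ℝ) / r.N a := by rw [le_div_iff₀ hN', mul_comm]; exact this
      rw [add_div] at this
      simp only [one_div] at this
      linarith
    rw [abs_sub_comm, abs_of_nonneg (by linarith)]
    exact a2
  have b1 := (e1 _ hmem).2 t ht
  have b2 := (e2 _ hmem).2 t ht
  have b3 := e3 k hkn
  simp only [fluct₂, atStep] at b3
  have c1 : |r.β a * (r.lim s F a (k / r.N a) - r.lim s F a t)| ≤ K * (r.β a / r.N a) := by
    rw [abs_mul, abs_of_pos (by linarith)]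
    calc _ ≤ r.β a * (K * (r.N a : ℝ)⁻¹) := by
          gcongr
          exact b1.trans (by gcongr)
      _ = _ := by ring
  have c2 : |r.lim₂ s F a (k / r.N a) - r.lim₂ s F a t| ≤ K' * (r.β a / r.N a) := by
    refine b2.trans ?_
    gcongr
    refine hdist.trans ?_
    rw [div_eq_mul_inv]
    exact le_mul_of_one_le_left (by positivity) e6
  have e : r.β a * (r.fluct F (a, k) - r.lim s F a t) - r.lim₂ s F a t =
      (r.β a * (r.fluct F (a, k) - r.lim s F a (k / r.N a)) - r.lim₂ s F a (k / r.N a)) +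
      (r.β a * (r.lim s F a (k / r.N a) - r.lim s F a t)) +
      (r.lim₂ s F a (k / r.N a) - r.lim₂ s F a t) := by ring
  rw [e]
  refine (abs_add_three _ _ _).trans ?_
  linarith

/-! ### Linearity in the test function -/

variable {a : ι} {t : ℝ}

theorem driftMean_add (hint : ∀ F : E → ℝ, Continuous F → Integrable F (r.ν a)) (hs : s.Smooth)
    (hF : ContDiff ℝ 1 F) (hG : ContDiff ℝ 1 G) (i : I) :
    r.driftMean s i (fun θ => F θ + G θ) a = r.driftMean s i F a + r.driftMean s i G a := by
  have h1 : ∀ θ, fderiv ℝ (fun θ => F θ + G θ) θ = fderiv ℝ F θ + fderiv ℝ G θ := fun θ =>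
    fderiv_fun_add (hF.differentiable one_ne_zero θ) (hG.differentiable one_ne_zero θ)
  have hP : ∀ {F : E → ℝ}, ContDiff ℝ 1 F → Integrable (s.P i F) (r.ν a) := fun hF =>
    hint _ (hs.contDiff_P (m := 0) i hF (by norm_num) (by norm_num)).continuous
  have hQ : ∀ {F : E → ℝ}, ContDiff ℝ 1 F → ∀ j, Integrable (s.Q i j F) (r.ν a) := fun hF j =>
    hint _ (MeanField.contDiff_Q (m := 0) i j hF (by norm_num)).continuous
  have e1 : r.mean (s.P i fun θ => F θ + G θ) a = r.mean (s.P i F) a + r.mean (s.P i G) a := by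
    rw [mean, mean, mean, ← integral_add (hP hF) (hP hG)]
    simp [MeanField.P, h1]
  have e2 : ∀ j, r.mean (s.Q i j fun θ => F θ + G θ) a =
      r.mean (s.Q i j F) a + r.mean (s.Q i j G) a := by
    intro j
    rw [mean, mean, mean, ← integral_add (hQ hF j) (hQ hG j)]
    simp [MeanField.Q, h1]
  simp only [driftMean, e1, e2, mul_add, Finset.sum_add_distrib]
  ring

theorem driftMean_const_mul (hF : ContDiff ℝ 1 F) (c : ℝ) (i : I) :
    r.driftMean s i (fun θ => c * F θ) a = c * r.driftMean s i F a := by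
  have h1 : ∀ θ, fderiv ℝ (fun θ => c * F θ) θ = c • fderiv ℝ F θ := fun θ =>
    fderiv_const_mul (hF.differentiable one_ne_zero θ) c
  have e1 : r.mean (s.P i fun θ => c * F θ) a = c * r.mean (s.P i F) a := by
    rw [mean, mean, ← integral_const_mul]
    simp [MeanField.P, h1]
  have e2 : ∀ j, r.mean (s.Q i j fun θ => c * F θ) a = c * r.mean (s.Q i j F) a := by
    intro j
    rw [mean, mean, ← integral_const_mul]
    simp [MeanField.Q, h1]
  simp only [driftMean, e1, e2, mul_add, Finset.mul_sum]
  congr 1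
  exact Finset.sum_congr rfl fun j _ => by ring

theorem lim_const_mul (hF : ContDiff ℝ 1 F) (c : ℝ) :
    r.lim s (fun θ => c * F θ) a t = c * r.lim s F a t := by
  rw [lim, lim, ← intervalIntegral.integral_const_mul]
  congr 1
  funext u
  rw [Finset.mul_sum]
  exact Finset.sum_congr rfl fun i _ => by rw [driftMean_const_mul hF]; ring

theorem intervalIntegrable_lim (hh : ∀ i, ContinuousOn (fun t => r.h a t i) (Set.Icc 0 t))
    (ht : 0 ≤ t) : IntervalIntegrable (fun u => ∑ i, s.π i * ((s.y i - r.h a u i) *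
      r.driftMean s i F a)) volume 0 t := by
  refine ContinuousOn.intervalIntegrable ?_
  rw [Set.uIcc_of_le ht]
  fun_prop

theorem lim_add (hint : ∀ F : E → ℝ, Continuous F → Integrable F (r.ν a)) (hs : s.Smooth)
    (hh : ∀ i, ContinuousOn (fun t => r.h a t i) (Set.Icc 0 t)) (ht : 0 ≤ t)
    (hF : ContDiff ℝ 1 F) (hG : ContDiff ℝ 1 G) :
    r.lim s (fun θ => F θ + G θ) a t = r.lim s F a t + r.lim s G a t := by
  rw [lim, lim, lim, ← intervalIntegral.integral_add (intervalIntegrable_lim hh ht)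
    (intervalIntegrable_lim hh ht)]
  congr 1
  funext u
  rw [← Finset.sum_add_distrib]
  exact Finset.sum_congr rfl fun i _ => by rw [driftMean_add hint hs hF hG]; ring

theorem lim_sum (hint : ∀ F : E → ℝ, Continuous F → Integrable F (r.ν a)) (hs : s.Smooth)
    (hh : ∀ i, ContinuousOn (fun t => r.h a t i) (Set.Icc 0 t)) (ht : 0 ≤ t)
    {L : Type*} (A : Finset L) {F : L → E → ℝ} (hF : ∀ l, ContDiff ℝ 1 (F l)) :
    r.lim s (fun θ => ∑ l ∈ A, F l θ) a t = ∑ l ∈ A, r.lim s (F l) a t := by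
  classical
  induction A using Finset.induction_on with
  | empty =>
    simp only [Finset.sum_empty]
    have := lim_const_mul (r := r) (s := s) (a := a) (t := t) (F := fun _ => (0 : ℝ))
      contDiff_const 0
    simpa using this
  | insert l A hl ih =>
    simp only [Finset.sum_insert hl]
    rw [lim_add hint hs hh ht (hF l) (ContDiff.sum fun l _ => hF l), ih]

end MFRun

end DeepNet

namespace DeepNet

open Asymptotics

namespace Model

variable {d N₁ M : ℕ} (m : Model d N₁ M)

/-- The scaling factor of the weights of the inner layer. -/
noncomputable def innerScale : ℝ := 1 / (N₁ : ℝ) ^ (1 - m.γ₁)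

/-- Gradient descent as a mean-field particle system. -/
noncomputable def meanField : MeanField (Fin M) (Fin N₁) (Theta d N₁) where
  p i θ := (m.σ (m.Z (m.x i) θ), fun j => m.innerScale *
    (θ.1 * deriv m.σ (m.Z (m.x i) θ) * m.σ (inner ℝ (θ.2.2 j) (m.x i))), 0)
  q i j := (0, 0, Pi.single j (m.innerScale • m.x i))
  B i j := m.B₃ j (m.x i)
  G i θ := θ.1 * m.σ (m.Z (m.x i) θ)
  y := m.y
  π _ := (M : ℝ)⁻¹

section smooth

variable {m} {n : WithTop ℕ∞} {x x' : Vec d}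

theorem contDiff_inner_weight (j : Fin N₁) (x : Vec d) :
    ContDiff ℝ n fun θ : Theta d N₁ => inner ℝ (θ.2.2 j) x := by
  have : ContDiff ℝ n fun θ : Theta d N₁ => θ.2.2 j := by fun_prop
  exact this.inner ℝ contDiff_const

theorem contDiff_Z (hσ : ContDiff ℝ n m.σ) : ContDiff ℝ n (m.Z (N₁ := N₁) x) := by
  refine contDiff_const.mul (ContDiff.sum fun j _ => ?_)
  have : ContDiff ℝ n fun θ : Theta d N₁ => θ.2.1 j := by fun_prop
  exact this.mul (hσ.comp (contDiff_inner_weight j x))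

theorem contDiff_B₁ (hσ : ContDiff ℝ n m.σ) : ContDiff ℝ n (m.B₁ x x') :=
  (hσ.comp (contDiff_Z hσ)).mul (hσ.comp (contDiff_Z hσ))

theorem contDiff_B₂ (hσ : ContDiff ℝ n m.σ) (hσ' : ContDiff ℝ n (deriv m.σ)) (j : Fin N₁) :
    ContDiff ℝ n (m.B₂ j x x') := by
  have h1 : ContDiff ℝ n fun θ : Theta d N₁ => θ.1 := contDiff_fst
  exact ((((h1.pow 2).mul (hσ'.comp (contDiff_Z hσ))).mul (hσ'.comp (contDiff_Z hσ))).mul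
    (hσ.comp (contDiff_inner_weight j x'))).mul (hσ.comp (contDiff_inner_weight j x))

theorem contDiff_B₃ (hσ : ContDiff ℝ n m.σ) (hσ' : ContDiff ℝ n (deriv m.σ)) (j : Fin N₁) :
    ContDiff ℝ n (m.B₃ j x) := by
  have h1 : ContDiff ℝ n fun θ : Theta d N₁ => θ.1 := contDiff_fst
  have h2 : ContDiff ℝ n fun θ : Theta d N₁ => θ.2.1 j := by fun_prop
  exact ((h1.mul h2).mul (hσ'.comp (contDiff_inner_weight j x))).mul (hσ'.comp (contDiff_Z hσ))

theorem contDiff_G (hσ : ContDiff ℝ n m.σ) : ContDiff ℝ n fun θ => θ.1 * m.σ (m.Z x θ) :=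
  contDiff_fst.mul (hσ.comp (contDiff_Z hσ))

theorem smooth_meanField (hσ : ContDiff ℝ 3 m.σ) (hσ' : ContDiff ℝ 3 (deriv m.σ)) :
    m.meanField.Smooth where
  p i := by
    refine (hσ.comp (contDiff_Z hσ)).prodMk (ContDiff.prodMk (contDiff_pi.2 fun j => ?_)
      contDiff_const)
    exact contDiff_const.mul ((contDiff_fst.mul (hσ'.comp (contDiff_Z hσ))).mul
      (hσ.comp (contDiff_inner_weight j _)))
  B i j := contDiff_B₃ hσ hσ' j
  G i := contDiff_G hσ

end smooth

theorem P_eq (i : Fin M) (F : Theta d N₁ → ℝ) (θ : Theta d N₁) :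
    m.meanField.P i F θ = m.driftC F (m.x i) θ + m.innerScale * m.driftW₂ F (m.x i) θ := by
  have h1 : m.meanField.p i θ = m.σ (m.Z (m.x i) θ) • ((1, 0, 0) : Theta d N₁) +
      ∑ j, (m.innerScale * (θ.1 * deriv m.σ (m.Z (m.x i) θ) * m.σ (inner ℝ (θ.2.2 j) (m.x i)))) •
        ((0, Pi.single j 1, 0) : Theta d N₁) := by
    have h2 : ∀ c : Fin N₁ → ℝ, ∑ j, c j • ((0, Pi.single j 1, 0) : Theta d N₁) = (0, c, 0) := by
      intro c
      refine Prod.ext ?_ (Prod.ext ?_ ?_)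
      · simp [Prod.fst_sum]
      · funext k
        simp [Prod.fst_sum, Prod.snd_sum, Finset.sum_apply, Pi.single_apply]
      · simp [Prod.snd_sum]
    rw [h2]
    simp [meanField]
  simp only [MeanField.P, h1, map_add, map_smul, map_sum, smul_eq_mul, driftC, driftW₂, dC, dW₂,
    Finset.mul_sum]
  congr 1
  · ring
  · exact Finset.sum_congr rfl fun j _ => by ring

theorem Q_eq (i : Fin M) (j : Fin N₁) (F : Theta d N₁ → ℝ) (θ : Theta d N₁) :
    m.meanField.Q i j F θ = m.innerScale * dW₁ j (m.x i) F θ := by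
  have h1 : m.meanField.q i j = m.innerScale • ((0, 0, Pi.single j (m.x i)) : Theta d N₁) := by
    simp [meanField, Pi.single_smul]
  simp only [MeanField.Q, h1, map_smul, smul_eq_mul, dW₁]

section derivatives

variable {m} {x : Vec d} {θ : Theta d N₁}

theorem hasFDerivAt_inner_weight (j : Fin N₁) (x : Vec d) (θ v : Theta d N₁) :
    HasFDerivAt (fun θ : Theta d N₁ => inner ℝ (θ.2.2 j) x)
      (fderiv ℝ (fun θ : Theta d N₁ => inner ℝ (θ.2.2 j) x) θ) θ ∧
    fderiv ℝ (fun θ : Theta d N₁ => inner ℝ (θ.2.2 j) x) θ v = inner ℝ (v.2.2 j) x := by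
  let L : Theta d N₁ →L[ℝ] ℝ := (innerSL ℝ x).comp ((ContinuousLinearMap.proj j).comp
    ((ContinuousLinearMap.snd ℝ (Fin N₁ → ℝ) (Fin N₁ → Vec d)).comp
      (ContinuousLinearMap.snd ℝ ℝ ((Fin N₁ → ℝ) × (Fin N₁ → Vec d)))))
  have hL : (fun θ : Theta d N₁ => inner ℝ (θ.2.2 j) x) = L := by
    funext θ
    simp [L, real_inner_comm]
  rw [hL]
  refine ⟨by simpa using L.hasFDerivAt, ?_⟩
  rw [L.fderiv]
  simp [L, real_inner_comm]

theorem fderiv_Z (hσ : Differentiable ℝ m.σ) (v : Theta d N₁) :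
    DifferentiableAt ℝ (m.Z x) θ ∧ fderiv ℝ (m.Z x) θ v = 1 / (N₁ : ℝ) ^ m.γ₁ *
      ∑ j, (v.2.1 j * m.σ (inner ℝ (θ.2.2 j) x) +
        θ.2.1 j * (deriv m.σ (inner ℝ (θ.2.2 j) x) * inner ℝ (v.2.2 j) x)) := by
  have h1 : ∀ j, HasFDerivAt (fun θ : Theta d N₁ => θ.2.1 j)
      ((ContinuousLinearMap.proj j).comp
      ((ContinuousLinearMap.fst ℝ (Fin N₁ → ℝ) (Fin N₁ → Vec d)).comp
        (ContinuousLinearMap.snd ℝ ℝ ((Fin N₁ → ℝ) × (Fin N₁ → Vec d))))) θ := fun j =>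
    ((ContinuousLinearMap.proj (R := ℝ) (φ := fun _ : Fin N₁ => ℝ) j).comp
      ((ContinuousLinearMap.fst ℝ (Fin N₁ → ℝ) (Fin N₁ → Vec d)).comp
        (ContinuousLinearMap.snd ℝ ℝ ((Fin N₁ → ℝ) × (Fin N₁ → Vec d))))).hasFDerivAt
  have h2 : ∀ j, HasFDerivAt (fun θ : Theta d N₁ => m.σ (inner ℝ (θ.2.2 j) x)) _ θ := fun j =>
    (hσ (inner ℝ (θ.2.2 j) x)).hasDerivAt.comp_hasFDerivAt θ
      (hasFDerivAt_inner_weight j x θ 0).1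
  have h3 := (HasFDerivAt.fun_sum (u := Finset.univ) fun j _ => (h1 j).mul (h2 j)).const_mul
    (1 / (N₁ : ℝ) ^ m.γ₁)
  have h4 : HasFDerivAt (m.Z x) _ θ := h3
  refine ⟨h4.differentiableAt, ?_⟩
  rw [h4.fderiv]
  simp only [smul_apply, sum_apply, add_apply, smul_eq_mul, (hasFDerivAt_inner_weight _ x θ v).2]
  congr 1
  refine Finset.sum_congr rfl fun j _ => ?_
  simp
  ring

theorem fderiv_G (hσ : Differentiable ℝ m.σ) (v : Theta d N₁) :
    fderiv ℝ (fun θ => θ.1 * m.σ (m.Z x θ)) θ v = v.1 * m.σ (m.Z x θ) +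
      θ.1 * (deriv m.σ (m.Z x θ) * fderiv ℝ (m.Z x) θ v) := by
  have h1 : HasFDerivAt (fun θ : Theta d N₁ => θ.1)
      (ContinuousLinearMap.fst ℝ ℝ ((Fin N₁ → ℝ) × (Fin N₁ → Vec d))) θ :=
    (ContinuousLinearMap.fst ℝ ℝ ((Fin N₁ → ℝ) × (Fin N₁ → Vec d))).hasFDerivAt
  have h2 : HasFDerivAt (fun θ => m.σ (m.Z x θ)) _ θ :=
    (hσ (m.Z x θ)).hasDerivAt.comp_hasFDerivAt θ (fderiv_Z (x := x) hσ 0).1.hasFDerivAt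
  have h3 : HasFDerivAt (fun θ => θ.1 * m.σ (m.Z x θ)) _ θ := h1.mul h2
  rw [h3.fderiv]
  simp
  ring

theorem dC_G (hσ : Differentiable ℝ m.σ) :
    dC (fun θ => θ.1 * m.σ (m.Z x θ)) θ = m.σ (m.Z x θ) := by
  rw [dC, fderiv_G hσ, (fderiv_Z hσ _).2]
  simp

theorem dW₂_G (hσ : Differentiable ℝ m.σ) (j : Fin N₁) :
    dW₂ j (fun θ => θ.1 * m.σ (m.Z x θ)) θ = 1 / (N₁ : ℝ) ^ m.γ₁ *
      (θ.1 * deriv m.σ (m.Z x θ) * m.σ (inner ℝ (θ.2.2 j) x)) := by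
  rw [dW₂, fderiv_G hσ, (fderiv_Z hσ _).2]
  simp [Pi.single_apply]
  ring

theorem dW₁_G (hσ : Differentiable ℝ m.σ) (j : Fin N₁) (x' : Vec d) :
    dW₁ j x' (fun θ => θ.1 * m.σ (m.Z x θ)) θ = 1 / (N₁ : ℝ) ^ m.γ₁ *
      (inner ℝ x x' * m.B₃ j x θ) := by
  rw [dW₁, fderiv_G hσ, (fderiv_Z hσ _).2, Finset.sum_eq_single j]
  · simp [B₃, real_inner_comm]
    ring
  · intro k _ hk
    simp [Pi.single_eq_of_ne hk]
  · simp

theorem innerScale_mul (hN₁ : 0 < N₁) : m.innerScale * (1 / (N₁ : ℝ) ^ m.γ₁) = 1 / N₁ := by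
  have : (0 : ℝ) < N₁ := by exact_mod_cast hN₁
  rw [innerScale, div_mul_div_comm, one_mul, ← Real.rpow_add this]
  simp

theorem P_G (hN₁ : 0 < N₁) (hσ : Differentiable ℝ m.σ) (i j : Fin M) :
    m.meanField.P j (m.meanField.G i) = fun θ => m.B₁ (m.x i) (m.x j) θ +
      1 / (N₁ : ℝ) * ∑ k, m.B₂ k (m.x i) (m.x j) θ := by
  funext θ
  rw [P_eq]
  have hG : m.meanField.G i = fun θ => θ.1 * m.σ (m.Z (m.x i) θ) := rfl
  rw [hG, driftC, dC_G hσ, driftW₂, ← innerScale_mul (m := m) hN₁, B₁]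
  congr 1
  · ring
  · rw [mul_assoc, Finset.mul_sum (s := Finset.univ) (a := 1 / (N₁ : ℝ) ^ m.γ₁)]
    congr 1
    refine Finset.sum_congr rfl fun k _ => ?_
    rw [dW₂_G hσ, B₂]
    ring

theorem Q_G (hN₁ : 0 < N₁) (hσ : Differentiable ℝ m.σ) (i j : Fin M) (k : Fin N₁) :
    m.meanField.Q j k (m.meanField.G i) = fun θ => (1 / (N₁ : ℝ) * inner ℝ (m.x i) (m.x j)) *
      m.B₃ k (m.x i) θ := by
  funext θ
  rw [Q_eq]
  have hG : m.meanField.G i = fun θ => θ.1 * m.σ (m.Z (m.x i) θ) := rfl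
  rw [hG, dW₁_G hσ, ← innerScale_mul (m := m) hN₁]
  ring

end derivatives

end Model

end DeepNet

namespace DeepNet

open Asymptotics

variable {d N₁ M : ℕ} {m : Model d N₁ M} {Ω : Type*} [MeasurableSpace Ω] {P : Measure Ω}
  {W : Noise d N₁ Ω}

namespace Assumptions

variable [IsProbabilityMeasure P]

theorem prob_C (hW : Assumptions P m W) : IsProbabilityMeasure m.μC := by
  rw [← hW.law_C 0]
  exact Measure.isProbabilityMeasure_map (hW.measurable_C 0).aemeasurable

theorem prob_W₂ (hW : Assumptions P m W) (hN₁ : 0 < N₁) : IsProbabilityMeasure m.μW₂ := by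
  rw [← hW.law_W₂ ⟨0, hN₁⟩ 0]
  exact Measure.isProbabilityMeasure_map (hW.measurable_W₂ ⟨0, hN₁⟩ 0).aemeasurable

theorem prob_γ₀ (hW : Assumptions P m W) (hN₁ : 0 < N₁) (w : Fin N₁ → Vec d) :
    IsProbabilityMeasure (m.γ₀ w) := by
  have := hW.prob_C
  have := hW.prob_W₂ hN₁
  unfold Model.γ₀
  infer_instance

/-- The parameters are bounded. -/
theorem exists_bound (hW : Assumptions P m W) : ∃ R, 0 ≤ R ∧ (∀ᵐ c ∂m.μC, ‖c‖ ≤ R) ∧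
    (∀ᵐ w ∂m.μW₂, ‖w‖ ≤ R) ∧ ∀ᵐ w ∂m.μW₁, ‖w‖ ≤ R := by
  obtain ⟨S, hS, h1⟩ := hW.compact_C
  obtain ⟨S', hS', h2⟩ := hW.compact_W₂
  obtain ⟨S'', hS'', h3⟩ := hW.compact_W₁
  obtain ⟨R, hR⟩ := hS.isBounded.exists_norm_le
  obtain ⟨R', hR'⟩ := hS'.isBounded.exists_norm_le
  obtain ⟨R'', hR''⟩ := hS''.isBounded.exists_norm_le
  refine ⟨max 0 (max R (max R' R'')), le_max_left _ _, h1.mono fun c hc => ?_,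
    h2.mono fun c hc => ?_, h3.mono fun c hc => ?_⟩
  · exact (hR c hc).trans (by simp)
  · exact (hR' c hc).trans (by simp)
  · exact (hR'' c hc).trans (by simp)

theorem ae_γ₀ (hW : Assumptions P m W) (hN₁ : 0 < N₁) {R : ℝ} (hR : 0 ≤ R)
    (h1 : ∀ᵐ c ∂m.μC, ‖c‖ ≤ R) (h2 : ∀ᵐ w ∂m.μW₂, ‖w‖ ≤ R) {w : Fin N₁ → Vec d}
    (hw : ‖w‖ ≤ R) : ∀ᵐ θ ∂m.γ₀ w, ‖θ‖ ≤ R := by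
  have := hW.prob_C
  have := hW.prob_W₂ hN₁
  unfold Model.γ₀
  have a1 := (Measure.quasiMeasurePreserving_fst (μ := m.μC)
    (ν := (Measure.pi fun _ : Fin N₁ => m.μW₂).prod (Measure.dirac w))).ae h1
  have a2 : ∀ᵐ v ∂(Measure.pi fun _ : Fin N₁ => m.μW₂), ‖v‖ ≤ R := by
    have : ∀ᵐ v ∂(Measure.pi fun _ : Fin N₁ => m.μW₂), ∀ j, ‖v j‖ ≤ R :=
      ae_all_iff.2 fun j => (Measure.quasiMeasurePreserving_eval (fun _ : Fin N₁ => m.μW₂) j).ae h2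
    exact this.mono fun v hv => (pi_norm_le_iff_of_nonneg hR).2 hv
  have a3 : ∀ᵐ v ∂(Measure.dirac w : Measure (Fin N₁ → Vec d)), ‖v‖ ≤ R :=
    (ae_dirac_iff (measurableSet_le measurable_norm measurable_const)).2 hw
  have a4 := (Measure.quasiMeasurePreserving_snd (μ := m.μC)
    (ν := (Measure.pi fun _ : Fin N₁ => m.μW₂).prod (Measure.dirac w))).ae
    (((Measure.quasiMeasurePreserving_fst (μ := Measure.pi fun _ : Fin N₁ => m.μW₂)
      (ν := Measure.dirac w)).ae a2).and ((Measure.quasiMeasurePreserving_snd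
        (μ := Measure.pi fun _ : Fin N₁ => m.μW₂) (ν := Measure.dirac w)).ae a3))
  filter_upwards [a1, a4] with θ e1 e2
  exact norm_prod_le_iff.2 ⟨e1, norm_prod_le_iff.2 e2⟩

theorem integrable_γ₀ (hW : Assumptions P m W) (hN₁ : 0 < N₁) (w : Fin N₁ → Vec d)
    {F : Theta d N₁ → ℝ} (hF : Continuous F) : Integrable F (m.γ₀ w) := by
  have := hW.prob_γ₀ hN₁ w
  obtain ⟨R, hR, h1, h2, -⟩ := hW.exists_bound
  have h3 := hW.ae_γ₀ hN₁ (R := max R ‖w‖) (hR.trans (le_max_left _ _))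
    (h1.mono fun _ h => h.trans (le_max_left _ _)) (h2.mono fun _ h => h.trans (le_max_left _ _))
    (le_max_right _ _)
  obtain ⟨K, hK0, hK⟩ := exists_bound_of_continuous hF (max R ‖w‖)
  exact Integrable.of_bound hF.aestronglyMeasurable K (h3.mono fun θ hθ => hK θ hθ)

theorem integral_G (hW : Assumptions P m W) (hN₁ : 0 < N₁) (w : Fin N₁ → Vec d) (i : Fin M) :
    ∫ θ, m.meanField.G i θ ∂m.γ₀ w = 0 := by
  have := hW.prob_C
  have := hW.prob_W₂ hN₁
  refine (integral_prod_mul (μ := m.μC) (ν := (Measure.pi fun _ : Fin N₁ => m.μW₂).prod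
    (Measure.dirac w)) (fun c => c) fun v : (Fin N₁ → ℝ) × (Fin N₁ → Vec d) =>
      m.σ (m.Z (m.x i) ((0, v) : Theta d N₁))).trans ?_
  rw [hW.mean_C, zero_mul]

theorem contDiff_σ (hW : Assumptions P m W) : ContDiff ℝ 3 m.σ :=
  contDiff_infty.1 hW.activation.1 3

theorem contDiff_deriv_σ (hW : Assumptions P m W) : ContDiff ℝ 3 (deriv m.σ) :=
  contDiff_infty.1 (contDiff_infty_iff_deriv.1 hW.activation.1).2 3

theorem smooth (hW : Assumptions P m W) : m.meanField.Smooth :=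
  Model.smooth_meanField hW.contDiff_σ hW.contDiff_deriv_σ

end Assumptions

namespace Model

open Classical in
/-- The weight of the `i`-th data point at the sample `z`. -/
noncomputable def dataWeight (m : Model d N₁ M) (i : Fin M) (z : Vec d × ℝ) : ℝ :=
  if (m.x i, m.y i) = z then
    ((Finset.univ.filter fun j => (m.x j, m.y j) = z).card : ℝ)⁻¹ else 0

/-- Gradient descent as a family of runs of a mean-field particle system, indexed by the width
of the network and the random input. -/
noncomputable def sgdRun (m : Model d N₁ M) (W : Noise d N₁ Ω) (φ T : ℝ) :
    MFRun (ℕ × Ω) (Fin M) (Theta d N₁) where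
  N a := a.1
  n a := ⌊(a.1 : ℝ) * T⌋₊
  β a := (a.1 : ℝ) ^ φ
  θ a k i := ((m.sgd (W.init a.1 a.2) (fun k => W.z k a.2) k).C i,
    fun j => (m.sgd (W.init a.1 a.2) (fun k => W.z k a.2) k).W₂ j i,
    (m.sgd (W.init a.1 a.2) (fun k => W.z k a.2) k).W₁)
  w a k i := m.dataWeight i (W.z k a.2)
  ν a := m.γ₀ fun j => W.W₁ j a.2
  h a t i := m.h (m.γ₀ fun j => W.W₁ j a.2) t (m.x i)
  κ a t i := m.K (m.γ₀ fun j => W.W₁ j a.2) t (m.x i)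

variable [IsProbabilityMeasure P] {φ T : ℝ} {a : ℕ × Ω} {t : ℝ} {F : Theta d N₁ → ℝ}

theorem continuousOn_sgdRun_h (i : Fin M) (t : ℝ) :
    ContinuousOn (fun t => (m.sgdRun W φ T).h a t i) (Set.Icc 0 t) :=
  ((m.h_spec _).1 _).mono Set.Icc_subset_Ici_self

theorem driftMean_eq (hW : Assumptions P m W) (hN₁ : 0 < N₁) (hF : ContDiff ℝ 1 F) (i : Fin M) :
    (m.sgdRun W φ T).driftMean m.meanField i F a =
      ∫ θ, m.Cf ((m.sgdRun W φ T).ν a) F (m.x i) θ ∂(m.sgdRun W φ T).ν a := by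
  have hs := hW.smooth
  have hP : Integrable (m.meanField.P i F) ((m.sgdRun W φ T).ν a) := hW.integrable_γ₀ hN₁ _
    (hs.contDiff_P (m := 0) i hF (by norm_num) (by norm_num)).continuous
  have hQ : ∀ j, Integrable (m.meanField.Q i j F) ((m.sgdRun W φ T).ν a) := fun j =>
    hW.integrable_γ₀ hN₁ _ (MeanField.contDiff_Q (m := 0) i j hF (by norm_num)).continuous
  simp only [MFRun.driftMean, MFRun.mean]
  simp only [← integral_const_mul]
  rw [← integral_finsetSum _ fun j _ => (hQ j).const_mul _, ← integral_add hP
    (integrable_finsetSum _ fun j _ => (hQ j).const_mul _)]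
  congr 1
  funext θ
  rw [P_eq, Cf, driftW₁, ← innerScale, Finset.mul_sum]
  congr 1
  refine Finset.sum_congr rfl fun j _ => ?_
  rw [Q_eq, meanB₃, mul_left_comm]
  rfl

theorem lOf_eq_lim (hW : Assumptions P m W) (hN₁ : 0 < N₁) (hF : ContDiff ℝ 1 F) :
    m.lOf ((m.sgdRun W φ T).ν a) (m.h ((m.sgdRun W φ T).ν a)) t F =
      (m.sgdRun W φ T).lim m.meanField F a t := by
  rw [lOf, MFRun.lim]
  congr 1
  funext u
  rw [integral_π, Finset.mul_sum]
  exact Finset.sum_congr rfl fun i _ => by rw [driftMean_eq hW hN₁ hF]; rfl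

theorem A_eq (hW : Assumptions P m W) (hN₁ : 0 < N₁) (i j : Fin M) :
    m.A ((m.sgdRun W φ T).ν a) (m.x i) (m.x j) =
      (m.sgdRun W φ T).driftMean m.meanField j (m.meanField.G i) a := by
  have hσ : Differentiable ℝ m.σ := hW.contDiff_σ.differentiable (by norm_num)
  have hi : ∀ {F}, Continuous F → Integrable F ((m.sgdRun W φ T).ν a) := fun hF =>
    hW.integrable_γ₀ hN₁ _ hF
  simp only [MFRun.driftMean, P_G hN₁ hσ, Q_G hN₁ hσ, MFRun.mean]
  rw [integral_add (hi (contDiff_B₁ hW.contDiff_σ).continuous)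
    ((integrable_finsetSum _ fun k _ => hi
      (contDiff_B₂ hW.contDiff_σ hW.contDiff_deriv_σ k).continuous).const_mul _),
    integral_const_mul, integral_finsetSum _ fun k _ => hi
      (contDiff_B₂ hW.contDiff_σ hW.contDiff_deriv_σ k).continuous]
  simp only [integral_const_mul]
  rw [A, Finset.sum_add_distrib, mul_add, ← add_assoc]
  congr 1
  rw [Finset.mul_sum]
  refine Finset.sum_congr rfl fun k _ => ?_
  simp only [meanField]
  ring

theorem sgdRun_h_eq (hW : Assumptions P m W) (hN₁ : 0 < N₁) (ht : 0 ≤ t) (i : Fin M) :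
    (m.sgdRun W φ T).h a t i = (m.sgdRun W φ T).lim m.meanField (m.meanField.G i) a t := by
  refine ((m.h_spec _).2 t ht (m.x i)).trans ?_
  rw [MFRun.lim]
  congr 1
  funext u
  rw [integral_π, Finset.mul_sum]
  refine Finset.sum_congr rfl fun j _ => ?_
  rw [← A_eq hW hN₁]
  rfl

theorem lim_P_G (hW : Assumptions P m W) (hN₁ : 0 < N₁) (ht : 0 ≤ t) (i j : Fin M) :
    (m.sgdRun W φ T).lim m.meanField (m.meanField.P j (m.meanField.G i)) a t =
      (m.sgdRun W φ T).lim m.meanField (m.B₁ (m.x i) (m.x j)) a t +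
      1 / (N₁ : ℝ) * ∑ k, (m.sgdRun W φ T).lim m.meanField (m.B₂ k (m.x i) (m.x j)) a t := by
  have hσ : Differentiable ℝ m.σ := hW.contDiff_σ.differentiable (by norm_num)
  have hint : ∀ F : Theta d N₁ → ℝ, Continuous F → Integrable F ((m.sgdRun W φ T).ν a) :=
    fun F hF => hW.integrable_γ₀ hN₁ _ hF
  have h1 : ContDiff ℝ 1 (m.B₁ (m.x i) (m.x j)) :=
    (contDiff_B₁ hW.contDiff_σ).of_le (by norm_num)
  have h2 : ∀ k, ContDiff ℝ 1 (m.B₂ k (m.x i) (m.x j)) := fun k =>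
    (contDiff_B₂ hW.contDiff_σ hW.contDiff_deriv_σ k).of_le (by norm_num)
  have hh := fun i => continuousOn_sgdRun_h (m := m) (W := W) (φ := φ) (T := T) (a := a) i t
  rw [P_G hN₁ hσ, MFRun.lim_add hint hW.smooth hh ht h1
    (contDiff_const.mul (ContDiff.sum fun k _ => h2 k)),
    MFRun.lim_const_mul (ContDiff.sum fun k _ => h2 k),
    MFRun.lim_sum hint hW.smooth hh ht _ h2]

theorem continuousOn_lOf (ν : Measure (Theta d N₁)) (F : Theta d N₁ → ℝ) (t : ℝ) :
    ContinuousOn (fun u => m.lOf ν (m.h ν) u F) (Set.Icc 0 t) :=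
  (m.lOf_continuousOn ν (m.h_spec ν).1 F).mono Set.Icc_subset_Ici_self

theorem sgdRun_κ_eq (hW : Assumptions P m W) (hN₁ : 0 < N₁) (ht : 0 ≤ t) (i : Fin M) :
    (m.sgdRun W φ T).κ a t i = (m.sgdRun W φ T).lim₂ m.meanField (m.meanField.G i) a t := by
  set ν := (m.sgdRun W φ T).ν a with hν
  have hσ : Differentiable ℝ m.σ := hW.contDiff_σ.differentiable (by norm_num)
  have hh : ∀ x, ContinuousOn (fun u => m.h ν u x) (Set.Icc 0 t) := fun x =>
    ((m.h_spec ν).1 x).mono Set.Icc_subset_Ici_self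
  have hK : ∀ x, ContinuousOn (fun u => m.K ν u x) (Set.Icc 0 t) := fun x =>
    ((m.K_spec ν).1 x).mono Set.Icc_subset_Ici_self
  have hl := fun F => continuousOn_lOf (m := m) ν F t
  have ii : ∀ {X : ℝ → ℝ}, ContinuousOn X (Set.Icc 0 t) → IntervalIntegrable X volume 0 t :=
    fun hX => by rw [← Set.uIcc_of_le ht] at hX; exact hX.intervalIntegrable
  refine ((m.K_spec ν).2 t ht (m.x i)).trans ?_
  simp only [integral_π]
  rw [← intervalIntegral.integral_finsetSum fun j _ => ii (by fun_prop),
    ← intervalIntegral.integral_finsetSum fun j _ => ii (by fun_prop),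
    ← intervalIntegral.integral_const_mul, ← intervalIntegral.integral_const_mul,
    ← intervalIntegral.integral_add (ii (by fun_prop)) (ii (by fun_prop)),
    ← intervalIntegral.integral_add (ii (by fun_prop)) (ii (by fun_prop)),
    ← intervalIntegral.integral_sub (ii (by fun_prop)) (ii (by fun_prop)), MFRun.lim₂]
  refine intervalIntegral.integral_congr fun u hu => ?_
  rw [Set.uIcc_of_le ht] at hu
  have hB₁ : ∀ i j, ContDiff ℝ 1 (m.B₁ (m.x i) (m.x j)) := fun i j =>
    (contDiff_B₁ hW.contDiff_σ).of_le (by norm_num)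
  have hB₂ : ∀ i j k, ContDiff ℝ 1 (m.B₂ k (m.x i) (m.x j)) := fun i j k =>
    (contDiff_B₂ hW.contDiff_σ hW.contDiff_deriv_σ k).of_le (by norm_num)
  have hB₃ : ∀ i k, ContDiff ℝ 1 (m.B₃ k (m.x i)) := fun i k =>
    (contDiff_B₃ hW.contDiff_σ hW.contDiff_deriv_σ k).of_le (by norm_num)
  have hd : ∀ j, (m.sgdRun W φ T).driftLim m.meanField j (m.meanField.G i) a u =
      (m.lOf ν (m.h ν) u (m.B₁ (m.x i) (m.x j)) +
        1 / (N₁ : ℝ) * ∑ k, m.lOf ν (m.h ν) u (m.B₂ k (m.x i) (m.x j))) +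
      ∑ k, 1 / (N₁ : ℝ) * (inner ℝ (m.x i) (m.x j) * m.lOf ν (m.h ν) u (m.B₃ k (m.x i)) *
        m.meanB₃ ν (m.x j) k) +
      ∑ k, 1 / (N₁ : ℝ) * (inner ℝ (m.x i) (m.x j) * m.meanB₃ ν (m.x i) k *
        m.lOf ν (m.h ν) u (m.B₃ k (m.x j))) := by
    intro j
    rw [MFRun.driftLim, lim_P_G hW hN₁ hu.1, hν]
    simp only [lOf_eq_lim hW hN₁ (hB₁ _ _), lOf_eq_lim hW hN₁ (hB₂ _ _ _),
      lOf_eq_lim hW hN₁ (hB₃ _ _), Q_G hN₁ hσ]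
    congr 1
    · congr 1
      refine Finset.sum_congr rfl fun k _ => ?_
      rw [MFRun.lim_const_mul (hB₃ _ _)]
      simp only [meanB₃, MFRun.mean, meanField]
      ring
    · refine Finset.sum_congr rfl fun k _ => ?_
      simp only [MFRun.mean, integral_const_mul, meanB₃, meanField]
      ring
  simp only [hd]
  have e1 : ∀ Y : Fin N₁ → Fin M → ℝ, 1 / (N₁ : ℝ) * ∑ k, (M : ℝ)⁻¹ * ∑ j, Y k j =
      ∑ j, (M : ℝ)⁻¹ * ∑ k, 1 / (N₁ : ℝ) * Y k j := by
    intro Y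
    simp only [Finset.mul_sum]
    rw [Finset.sum_comm]
    exact Finset.sum_congr rfl fun j _ => Finset.sum_congr rfl fun k _ => by ring
  rw [e1, e1, Finset.mul_sum, Finset.mul_sum, ← Finset.sum_add_distrib, ← Finset.sum_add_distrib,
    ← Finset.sum_sub_distrib]
  refine Finset.sum_congr rfl fun j _ => ?_
  rw [← A_eq hW hN₁]
  have e2 : ∀ (c : ℝ) (Y : Fin N₁ → ℝ), ∑ k, 1 / (N₁ : ℝ) * (c * inner ℝ (m.x i) (m.x j) * Y k) =
      c * ∑ k, 1 / (N₁ : ℝ) * (inner ℝ (m.x i) (m.x j) * Y k) := fun c Y => by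
    rw [Finset.mul_sum]
    exact Finset.sum_congr rfl fun k _ => by ring
  change _ = (M : ℝ)⁻¹ * ((m.y j - m.h ν u (m.x j)) * _ - m.K ν u (m.x j) * m.A ν (m.x i) (m.x j))
  simp only [mul_assoc (_ * inner ℝ (m.x i) (m.x j)), mul_assoc (inner ℝ (m.x i) (m.x j)), e2]
  ring

theorem L_eq_lim₂ (hW : Assumptions P m W) (hN₁ : 0 < N₁) (ht : 0 ≤ t) (hF : ContDiff ℝ 2 F) :
    m.L ((m.sgdRun W φ T).ν a) F t = (m.sgdRun W φ T).lim₂ m.meanField F a t := by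
  set ν := (m.sgdRun W φ T).ν a with hν
  have hF1 : ContDiff ℝ 1 F := hF.of_le (by norm_num)
  have hh : ∀ x, ContinuousOn (fun u => m.h ν u x) (Set.Icc 0 t) := fun x =>
    ((m.h_spec ν).1 x).mono Set.Icc_subset_Ici_self
  have hK : ∀ x, ContinuousOn (fun u => m.K ν u x) (Set.Icc 0 t) := fun x =>
    ((m.K_spec ν).1 x).mono Set.Icc_subset_Ici_self
  have hl := fun F => continuousOn_lOf (m := m) ν F t
  have ii : ∀ {X : ℝ → ℝ}, ContinuousOn X (Set.Icc 0 t) → IntervalIntegrable X volume 0 t :=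
    fun hX => by rw [← Set.uIcc_of_le ht] at hX; exact hX.intervalIntegrable
  have hint : ∀ F : Theta d N₁ → ℝ, Continuous F → Integrable F ν :=
    fun F hF => hW.integrable_γ₀ hN₁ _ hF
  have hB₃ : ∀ i k, ContDiff ℝ 1 (m.B₃ k (m.x i)) := fun i k =>
    (contDiff_B₃ hW.contDiff_σ hW.contDiff_deriv_σ k).of_le (by norm_num)
  have hdC : ContDiff ℝ 1 (dC F) := (hF.fderiv_right (by norm_num)).clm_apply contDiff_const
  have hdW₂ : ∀ j, ContDiff ℝ 1 (dW₂ j F) := fun j =>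
    (hF.fderiv_right (by norm_num)).clm_apply contDiff_const
  have hdW₁ : ∀ j x, ContDiff ℝ 1 (dW₁ j x F) := fun j x =>
    (hF.fderiv_right (by norm_num)).clm_apply contDiff_const
  have hσ : ContDiff ℝ 1 m.σ := hW.contDiff_σ.of_le (by norm_num)
  have hσ' : ContDiff ℝ 1 (deriv m.σ) := hW.contDiff_deriv_σ.of_le (by norm_num)
  have hDC : ∀ x, ContDiff ℝ 1 (m.driftC F x) := fun x => hdC.mul (hσ.comp (contDiff_Z hσ))
  have hDW₂ : ∀ x, ContDiff ℝ 1 (m.driftW₂ F x) := fun x => ContDiff.sum fun j _ =>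
    ((contDiff_fst.mul (hσ'.comp (contDiff_Z hσ))).mul
      (hσ.comp (contDiff_inner_weight j x))).mul (hdW₂ j)
  have hDW₁ : ∀ b x, ContDiff ℝ 1 (driftW₁ b F x) := fun b x => ContDiff.sum fun j _ =>
    contDiff_const.mul (hdW₁ j x)
  have hmean : ∀ (b : Fin N₁ → ℝ) x, ∫ θ, driftW₁ b F x θ ∂ν = ∑ j, b j * ∫ θ, dW₁ j x F θ ∂ν := by
    intro b x
    simp only [driftW₁]
    rw [integral_finsetSum _ fun j _ => (hint _ (hdW₁ j x).continuous).const_mul _]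
    simp only [integral_const_mul]
  unfold L l
  simp only [hmean, integral_π]
  rw [← intervalIntegral.integral_const_mul, ← intervalIntegral.integral_const_mul,
    ← intervalIntegral.integral_const_mul,
    ← intervalIntegral.integral_add (ii (by fun_prop)) (ii (by fun_prop)),
    ← intervalIntegral.integral_add (ii (by fun_prop)) (ii (by fun_prop)),
    ← intervalIntegral.integral_add (ii (by fun_prop)) (ii (by fun_prop)),
    ← intervalIntegral.integral_sub (ii (by fun_prop)) (ii (by fun_prop)), MFRun.lim₂]
  refine intervalIntegral.integral_congr fun u hu => ?_
  rw [Set.uIcc_of_le ht] at hu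
  have hhr := fun i => continuousOn_sgdRun_h (m := m) (W := W) (φ := φ) (T := T) (a := a) i u
  have hQ : ∀ i j, m.meanField.Q i j F = fun θ => m.innerScale * dW₁ j (m.x i) F θ := fun i j =>
    funext (Q_eq m i j F)
  have hd : ∀ i, (m.sgdRun W φ T).driftLim m.meanField i F a u =
      m.lOf ν (m.h ν) u (m.driftC F (m.x i)) + m.innerScale *
        m.lOf ν (m.h ν) u (m.driftW₂ F (m.x i)) +
      m.innerScale * m.lOf ν (m.h ν) u (driftW₁ (m.meanB₃ ν (m.x i)) F (m.x i)) +
      m.innerScale * ∑ j, m.lOf ν (m.h ν) u (m.B₃ j (m.x i)) * ∫ θ, dW₁ j (m.x i) F θ ∂ν := by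
    intro i
    have e1 : m.meanField.P i F = fun θ => m.driftC F (m.x i) θ + m.innerScale *
      m.driftW₂ F (m.x i) θ := funext (P_eq m i F)
    have e2 : (m.sgdRun W φ T).lim m.meanField (driftW₁ (m.meanB₃ ν (m.x i)) F (m.x i)) a u =
        ∑ j, m.meanB₃ ν (m.x i) j * (m.sgdRun W φ T).lim m.meanField (dW₁ j (m.x i) F) a u := by
      unfold driftW₁
      rw [MFRun.lim_sum hint hW.smooth hhr hu.1 _ fun j => contDiff_const.mul (hdW₁ j _)]
      exact Finset.sum_congr rfl fun j _ => MFRun.lim_const_mul (hdW₁ j _) _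
    rw [hν, lOf_eq_lim hW hN₁ (hDC _), lOf_eq_lim hW hN₁ (hDW₂ _), lOf_eq_lim hW hN₁ (hDW₁ _ _),
      e2, MFRun.driftLim, e1, MFRun.lim_add hint hW.smooth hhr hu.1 (hDC _)
        (contDiff_const.mul (hDW₂ _)), MFRun.lim_const_mul (hDW₂ _), Finset.mul_sum,
      Finset.mul_sum]
    congr 1
    · congr 1
      refine Finset.sum_congr rfl fun j _ => ?_
      rw [hQ, MFRun.lim_const_mul (hdW₁ j _)]
      simp only [meanB₃, MFRun.mean, meanField]
      ring
    · refine Finset.sum_congr rfl fun j _ => ?_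
      rw [hQ, lOf_eq_lim hW hN₁ (hB₃ _ _)]
      simp only [MFRun.mean, integral_const_mul, meanField]
      ring
  simp only [hd]
  rw [← innerScale]
  simp only [Finset.mul_sum (s := (Finset.univ : Finset (Fin M)))]
  rw [← Finset.sum_add_distrib, ← Finset.sum_add_distrib, ← Finset.sum_add_distrib,
    ← Finset.sum_sub_distrib]
  refine Finset.sum_congr rfl fun i _ => ?_
  rw [driftMean_eq hW hN₁ hF1]
  change _ = (M : ℝ)⁻¹ * ((m.y i - m.h ν u (m.x i)) * _ - m.K ν u (m.x i) *
    ∫ θ, m.Cf ν F (m.x i) θ ∂ν)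
  ring

end Model

end DeepNet

namespace DeepNet

open Asymptotics

variable {d N₁ M : ℕ} {m : Model d N₁ M} {Ω : Type*} [MeasurableSpace Ω] {P : Measure Ω}
  {W : Noise d N₁ Ω}

/-! ### Steps of gradient descent -/

namespace Model

theorem sum_dataWeight_smul {V : Type*} [AddCommGroup V] [Module ℝ V] (Ψ : Vec d × ℝ → V)
    {z : Vec d × ℝ} (hz : ∃ i, (m.x i, m.y i) = z) :
    ∑ i, m.dataWeight i z • Ψ (m.x i, m.y i) = Ψ z := by
  classical
  have h1 : ∀ i, m.dataWeight i z • Ψ (m.x i, m.y i) = if (m.x i, m.y i) = z then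
      ((Finset.univ.filter fun j => (m.x j, m.y j) = z).card : ℝ)⁻¹ • Ψ z else 0 := by
    intro i
    unfold dataWeight
    split_ifs with h
    · rw [h]
    · simp
  obtain ⟨i, hi⟩ := hz
  have hpos : 0 < (Finset.univ.filter fun j => (m.x j, m.y j) = z).card :=
    Finset.card_pos.2 ⟨i, by simp [hi]⟩
  rw [Finset.sum_congr rfl fun i _ => h1 i, ← Finset.sum_filter, Finset.sum_const,
    ← Nat.cast_smul_eq_nsmul ℝ, smul_smul, mul_inv_cancel₀ (by positivity), one_smul]

theorem dataWeight_mem_Icc (i : Fin M) (z : Vec d × ℝ) : m.dataWeight i z ∈ Set.Icc (0 : ℝ) 1 := by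
  classical
  unfold dataWeight
  split_ifs with h
  · have hpos : 0 < (Finset.univ.filter fun j => (m.x j, m.y j) = z).card :=
      Finset.card_pos.2 ⟨i, by simp [h]⟩
    refine ⟨by positivity, inv_le_one_of_one_le₀ ?_⟩
    convert (Nat.one_le_cast (α := ℝ)).2 hpos
  · simp

theorem measurable_dataWeight (i : Fin M) : Measurable (m.dataWeight i) := by
  classical
  have h : m.dataWeight i = fun z => if z = (m.x i, m.y i) then
      m.dataWeight i (m.x i, m.y i) else 0 := by
    funext z
    split_ifs with h
    · rw [h]
    · exact if_neg (Ne.symm h)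
  rw [h]
  exact Measurable.ite (measurableSet_singleton _) measurable_const measurable_const

theorem integral_dataWeight (i : Fin M) : ∫ z, m.dataWeight i z ∂m.π = (M : ℝ)⁻¹ := by
  classical
  rw [integral_π]
  have h1 : ∀ j, m.dataWeight i (m.x j, m.y j) = if (m.x j, m.y j) = (m.x i, m.y i) then
      ((Finset.univ.filter fun j => (m.x j, m.y j) = (m.x i, m.y i)).card : ℝ)⁻¹ else 0 := by
    intro j
    unfold dataWeight
    split_ifs with h h' h'
    · rw [h]
    · exact absurd h.symm h'
    · exact absurd h'.symm h
    · rfl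
  have hpos : 0 < (Finset.univ.filter fun j => (m.x j, m.y j) = (m.x i, m.y i)).card :=
    Finset.card_pos.2 ⟨i, by simp⟩
  rw [Finset.sum_congr rfl fun j _ => h1 j, ← Finset.sum_filter, Finset.sum_const, nsmul_eq_mul,
    mul_inv_cancel₀ (by positivity), mul_one]

variable {φ T : ℝ} {a : ℕ × Ω}

theorem integral_empirical {n : ℕ} (p : Params d N₁ n) (F : Theta d N₁ → ℝ) :
    ∫ θ, F θ ∂p.empirical = (n : ℝ)⁻¹ * ∑ i, F (p.C i, fun j => p.W₂ j i, p.W₁) := by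
  unfold Params.empirical
  rw [integral_smul_measure, integral_finsetSum_measure fun i _ => integrable_dirac (by simp)]
  simp

theorem lPre_eq_fluct (F : Theta d N₁ → ℝ) (a : ℕ × Ω) (t : ℝ) :
    m.lPre W φ F a.1 a.2 t = (m.sgdRun W φ T).fluct F (a, ⌊(a.1 : ℝ) * t⌋₊) := by
  rw [lPre, γ, integral_empirical]
  rfl

theorem rpow_output {n : ℕ} (hn : 0 < n) (hφ : φ = 1 - m.γ₂) :
    (n : ℝ) ^ φ * (n : ℝ)⁻¹ = 1 / (n : ℝ) ^ m.γ₂ := by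
  have : (0 : ℝ) < n := by exact_mod_cast hn
  rw [hφ, Real.rpow_sub this, Real.rpow_one]
  field_simp

theorem rpow_C {n : ℕ} (hn : 0 < n) (hφ : φ = 1 - m.γ₂) :
    m.αC n / (n : ℝ) ^ m.γ₂ = ((n : ℝ) ^ φ * n)⁻¹ := by
  have h : (0 : ℝ) < n := by exact_mod_cast hn
  rw [αC, div_div, ← Real.rpow_add h, one_div]
  congr 1
  nth_rewrite 3 [← Real.rpow_one (n : ℝ)]
  rw [← Real.rpow_add h, hφ]
  congr 1
  ring

theorem rpow_inner (hN₁ : 0 < N₁) :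
    1 / ((N₁ : ℝ) ^ (1 - 2 * m.γ₁)) / (N₁ : ℝ) ^ m.γ₁ = m.innerScale := by
  have h : (0 : ℝ) < N₁ := by exact_mod_cast hN₁
  rw [div_div, ← Real.rpow_add h, innerScale]
  congr 2
  ring

theorem rpow_W₂ (hN₁ : 0 < N₁) {n : ℕ} (hn : 0 < n) (hφ : φ = 1 - m.γ₂) :
    m.αW₂ n / ((N₁ : ℝ) ^ m.γ₁ * (n : ℝ) ^ m.γ₂) = ((n : ℝ) ^ φ * n)⁻¹ * m.innerScale := by
  rw [← rpow_C hn hφ, ← rpow_inner hN₁, αW₂, αC]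
  ring

theorem rpow_W₁ (hN₁ : 0 < N₁) {n : ℕ} (hn : 0 < n) (hφ : φ = 1 - m.γ₂) :
    m.αW₁ n / (N₁ : ℝ) ^ m.γ₁ * (1 / (n : ℝ) ^ m.γ₂) =
      ((n : ℝ) ^ φ * n)⁻¹ * m.innerScale * (n : ℝ)⁻¹ := by
  have h : (0 : ℝ) < n := by exact_mod_cast hn
  have e : (n : ℝ) ^ (3 - 2 * m.γ₂) = (n : ℝ) ^ (2 - 2 * m.γ₂) * n := by
    nth_rewrite 3 [← Real.rpow_one (n : ℝ)]
    rw [← Real.rpow_add h]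
    congr 1
    ring
  rw [← rpow_C hn hφ, ← rpow_inner hN₁, αW₁, αC, e]
  ring

theorem out_eq_output (hφ : φ = 1 - m.γ₂) (ha : 0 < a.1) (i : Fin M) (k : ℕ) :
    (m.sgdRun W φ T).out m.meanField i (a, k) =
      m.output (m.sgd (W.init a.1 a.2) (fun k => W.z k a.2) k) (m.x i) := by
  rw [output, ← rpow_output ha hφ, mul_assoc]
  rfl

/-- The steps of gradient descent are those of a mean-field particle system. -/
theorem sgdRun_step (hN₁ : 0 < N₁) (hφ : φ = 1 - m.γ₂) (ha : 0 < a.1)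
    (hz : ∀ k, ∃ i, (m.x i, m.y i) = W.z k a.2) (k : ℕ) (l : Fin a.1) :
    (m.sgdRun W φ T).θ a (k + 1) l = (m.sgdRun W φ T).θ a k l +
      ((m.sgdRun W φ T).β a * (m.sgdRun W φ T).N a)⁻¹ •
      ∑ i, ((m.sgdRun W φ T).w a k i * (m.meanField.y i -
        (m.sgdRun W φ T).out m.meanField i (a, k))) •
      (m.meanField.p i ((m.sgdRun W φ T).θ a k l) +
        ∑ j, (m.sgdRun W φ T).emp (m.meanField.B i j) (a, k) • m.meanField.q i j) := by
  set p := m.sgd (W.init a.1 a.2) (fun k => W.z k a.2) k with hp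
  set z := W.z k a.2 with hzdef
  let θ : Fin a.1 → Theta d N₁ := fun l => (p.C l, fun j => p.W₂ j l, p.W₁)
  let Ψ : Vec d × ℝ → Theta d N₁ := fun z => (z.2 - m.output p z.1) •
    ((m.σ (m.Z z.1 (θ l)), fun j => m.innerScale *
      ((θ l).1 * deriv m.σ (m.Z z.1 (θ l)) * m.σ (inner ℝ ((θ l).2.2 j) z.1)),
      fun j => (((a.1 : ℝ)⁻¹ * ∑ l, m.B₃ j z.1 (θ l)) * m.innerScale) • z.1) : Theta d N₁)
  have h1 : ∀ i, ((m.sgdRun W φ T).w a k i * (m.meanField.y i -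
        (m.sgdRun W φ T).out m.meanField i (a, k))) •
      (m.meanField.p i ((m.sgdRun W φ T).θ a k l) +
        ∑ j, (m.sgdRun W φ T).emp (m.meanField.B i j) (a, k) • m.meanField.q i j) =
      m.dataWeight i z • Ψ (m.x i, m.y i) := by
    intro i
    rw [out_eq_output hφ ha, mul_smul]
    change m.dataWeight i z • ((m.y i - m.output p (m.x i)) • _) =
      m.dataWeight i z • ((m.y i - m.output p (m.x i)) • _)
    congr 2
    have h2 : ∀ c : Fin N₁ → ℝ, ∑ j, c j • m.meanField.q i j =
        (0, 0, fun j => (c j * m.innerScale) • m.x i) := by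
      intro c
      refine Prod.ext ?_ (Prod.ext ?_ ?_)
      · simp [Prod.fst_sum, meanField]
      · simp [Prod.fst_sum, Prod.snd_sum, meanField]
      · funext k
        simp [Prod.snd_sum, Finset.sum_apply, meanField, Pi.single_apply, smul_smul]
    rw [h2]
    refine Prod.ext ?_ (Prod.ext ?_ ?_)
    · exact add_zero _
    · exact add_zero _
    · exact zero_add _
  rw [Finset.sum_congr rfl fun i _ => h1 i, sum_dataWeight_smul Ψ (hz k)]
  have hβ : (m.sgdRun W φ T).β a * (m.sgdRun W φ T).N a = (a.1 : ℝ) ^ φ * a.1 := rfl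
  rw [hβ]
  refine Prod.ext ?_ (Prod.ext ?_ ?_)
  · change p.C l + m.αC a.1 / (a.1 : ℝ) ^ m.γ₂ * (z.2 - m.output p z.1) * m.H₂ p l z.1 =
      p.C l + ((a.1 : ℝ) ^ φ * a.1)⁻¹ * ((z.2 - m.output p z.1) * m.H₂ p l z.1)
    rw [rpow_C ha hφ]
    ring
  · funext j
    change p.W₂ j l + m.αW₂ a.1 / ((N₁ : ℝ) ^ m.γ₁ * (a.1 : ℝ) ^ m.γ₂) *
      (z.2 - m.output p z.1) * p.C l * deriv m.σ (m.Z₂ p l z.1) * m.H₁ p j z.1 =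
      p.W₂ j l + ((a.1 : ℝ) ^ φ * a.1)⁻¹ * ((z.2 - m.output p z.1) * (m.innerScale *
        (p.C l * deriv m.σ (m.Z₂ p l z.1) * m.H₁ p j z.1)))
    rw [rpow_W₂ hN₁ ha hφ]
    ring
  · funext j
    change p.W₁ j + (m.αW₁ a.1 / (N₁ : ℝ) ^ m.γ₁ * (z.2 - m.output p z.1) *
      (1 / (a.1 : ℝ) ^ m.γ₂ * ∑ i, p.C i * deriv m.σ (m.Z₂ p i z.1) * p.W₂ j i) *
      deriv m.σ (inner ℝ (p.W₁ j) z.1)) • z.1 =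
      p.W₁ j + ((a.1 : ℝ) ^ φ * a.1)⁻¹ • ((z.2 - m.output p z.1) •
        ((((a.1 : ℝ)⁻¹ * ∑ i, m.B₃ j z.1 (θ i)) * m.innerScale) • z.1))
    have h3 : ∑ i, m.B₃ j z.1 (θ i) = (∑ i, p.C i * deriv m.σ (m.Z₂ p i z.1) * p.W₂ j i) *
        deriv m.σ (inner ℝ (p.W₁ j) z.1) := by
      rw [Finset.sum_mul]
      refine Finset.sum_congr rfl fun i _ => ?_
      change p.C i * p.W₂ j i * deriv m.σ (inner ℝ (p.W₁ j) z.1) * deriv m.σ (m.Z₂ p i z.1) = _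
      ring
    rw [h3, smul_smul, smul_smul]
    congr 2
    have := rpow_W₁ (m := m) hN₁ ha hφ
    linear_combination (z.2 - m.output p z.1) * (∑ i, p.C i * deriv m.σ (m.Z₂ p i z.1) * p.W₂ j i) *
      deriv m.σ (inner ℝ (p.W₁ j) z.1) * this

end Model

/-! ### Convergence in probability as convergence along a filter -/

/-- The filter of the events whose probability tends to one. -/
def inProb {Ω : Type*} [MeasurableSpace Ω] (P : Measure Ω) : Filter (ℕ × Ω) where
  sets := {A | Tendsto (fun n => P {ω | (n, ω) ∉ A}) atTop (𝓝 0)}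
  univ_sets := by simp
  sets_of_superset {A B} hA hAB := by
    refine tendsto_of_tendsto_of_tendsto_of_le_of_le tendsto_const_nhds hA (fun _ => zero_le)
      fun n => measure_mono fun ω hω h => hω (hAB h)
  inter_sets {A B} hA hB := by
    have := Tendsto.add hA hB
    rw [add_zero] at this
    refine tendsto_of_tendsto_of_tendsto_of_le_of_le tendsto_const_nhds this (fun _ => zero_le)
      fun n => (measure_mono fun ω hω => ?_).trans (measure_union_le _ _)
    by_contra h
    simp only [Set.mem_union, Set.mem_ofPred_eq, not_or, not_not] at h
    exact hω ⟨h.1, h.2⟩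

theorem eventually_inProb {p : ℕ × Ω → Prop} :
    (∀ᶠ a in inProb P, p a) ↔ Tendsto (fun n => P {ω | ¬p (n, ω)}) atTop (𝓝 0) :=
  Iff.rfl

theorem tendsto_fst_inProb : Tendsto Prod.fst (inProb P) atTop := fun s hs => by
  refine eventually_inProb (p := fun a => a.1 ∈ s).2 (tendsto_const_nhds.congr' ?_)
  filter_upwards [hs] with n hn
  simp [show n ∈ s from hn]

theorem eventually_inProb_of_ae {p : Ω → Prop} (h : ∀ᵐ ω ∂P, p ω) : ∀ᶠ a in inProb P, p a.2 :=
  eventually_inProb (p := fun a => p a.2).2 (tendsto_const_nhds.congr fun _ => h.symm)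

theorem eventually_inProb_of_le {p : ℕ × Ω → Prop} {b : ℕ → ℝ} (hb : Tendsto b atTop (𝓝 0))
    (h : ∀ᶠ n in atTop, P {ω | ¬p (n, ω)} ≤ ENNReal.ofReal (b n)) : ∀ᶠ a in inProb P, p a := by
  refine eventually_inProb.2 (tendsto_of_tendsto_of_tendsto_of_le_of_le' tendsto_const_nhds
    ?_ (Eventually.of_forall fun _ => zero_le) h)
  simpa using ENNReal.tendsto_ofReal hb

end DeepNet

namespace DeepNet

open Asymptotics

/-! ### Probability estimates -/

theorem measurable_pi_of_forall {α ι : Type*} {_ : MeasurableSpace α} {β : ι → Type*}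
    [∀ i, MeasurableSpace (β i)] {f : α → ∀ i, β i} (h : ∀ i, Measurable fun a => f a i) :
    Measurable f :=
  measurable_pi_lambda f h

section Probability

variable {Ω : Type*} [MeasurableSpace Ω] {P : Measure Ω} [IsProbabilityMeasure P]

/-- A maximal form of Hoeffding's inequality. -/
theorem measure_exists_lt_abs_sum_le {X : ℕ → Ω → ℝ} (hind : iIndepFun X P)
    (hm : ∀ k, Measurable (X k)) (hb : ∀ k ω, X k ω ∈ Set.Icc (-1 : ℝ) 1)
    (h0 : ∀ k, ∫ ω, X k ω ∂P = 0) {ε : ℝ} (hε : 0 ≤ ε) (n : ℕ) :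
    P {ω | ∃ k ≤ n, ε < |∑ m ∈ Finset.range k, X m ω|} ≤
      ENNReal.ofReal ((n + 1) * (2 * Real.exp (-ε ^ 2 / (2 * n)))) := by
  have hsub : ∀ k, HasSubgaussianMGF (X k) 1 P := by
    intro k
    have h := hasSubgaussianMGF_of_mem_Icc_of_integral_eq_zero (hm k).aemeasurable
      (Eventually.of_forall (hb k)) (h0 k)
    have e : ((‖(1 : ℝ) - -1‖₊ / 2) ^ 2 : NNReal) = 1 := by
      have : ‖(1 : ℝ) - -1‖₊ = 2 := by
        ext
        simp
        norm_num
      rw [this]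
      norm_num
    rwa [e] at h
  have hind' : iIndepFun (fun k => -X k) P :=
    hind.comp (fun _ x => -x) fun _ => measurable_neg
  have key : ∀ k ≤ n, P {ω | ε < |∑ m ∈ Finset.range k, X m ω|} ≤
      ENNReal.ofReal (2 * Real.exp (-ε ^ 2 / (2 * n))) := by
    intro k hk
    rcases Nat.eq_zero_or_pos k with rfl | hk0
    · simp [not_lt.2 hε]
    have hexp : Real.exp (-ε ^ 2 / (2 * k * (1 : NNReal))) ≤ Real.exp (-ε ^ 2 / (2 * n)) := by
      refine Real.exp_le_exp.2 ?_
      rw [neg_div, neg_div, neg_le_neg_iff]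
      simp only [NNReal.coe_one, mul_one]
      have : (0 : ℝ) < k := by exact_mod_cast hk0
      gcongr
    have h1 := HasSubgaussianMGF.measure_sum_range_ge_le_of_iIndepFun hind (n := k)
      (fun i _ => hsub i) hε
    have h2 := HasSubgaussianMGF.measure_sum_range_ge_le_of_iIndepFun hind' (n := k)
      (fun i _ => (hsub i).neg) hε
    have h3 : {ω | ε < |∑ m ∈ Finset.range k, X m ω|} ⊆
        {ω | ε ≤ ∑ m ∈ Finset.range k, X m ω} ∪ {ω | ε ≤ ∑ m ∈ Finset.range k, (-X m) ω} := by
      intro ω hω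
      have hω' : ε < |∑ m ∈ Finset.range k, X m ω| := hω
      rcases lt_abs.1 hω' with h | h
      · exact Or.inl h.le
      · right
        change ε ≤ ∑ m ∈ Finset.range k, -X m ω
        rw [Finset.sum_neg_distrib]
        exact h.le
    have h4 : P.real {ω | ε < |∑ m ∈ Finset.range k, X m ω|} ≤
        2 * Real.exp (-ε ^ 2 / (2 * n)) := by
      refine (measureReal_mono h3).trans ((measureReal_union_le _ _).trans ?_)
      linarith
    rw [← ofReal_measureReal]
    exact ENNReal.ofReal_le_ofReal h4
  have hU : {ω | ∃ k ≤ n, ε < |∑ m ∈ Finset.range k, X m ω|} =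
      ⋃ k ∈ Finset.range (n + 1), {ω | ε < |∑ m ∈ Finset.range k, X m ω|} := by
    ext ω
    simp
  rw [hU]
  refine (measure_biUnion_finset_le _ _).trans ((Finset.sum_le_card_nsmul _ _ _ fun k hk =>
    key k (Nat.lt_succ_iff.1 (Finset.mem_range.1 hk))).trans ?_)
  rw [Finset.card_range, nsmul_eq_mul, show ((n : ℝ) + 1) = ((n + 1 : ℕ) : ℝ) by push_cast; rfl,
    ENNReal.ofReal_mul (Nat.cast_nonneg _), ENNReal.ofReal_natCast]

/-- Chebyshev's inequality for sums of bounded uncorrelated random variables. -/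
theorem measure_le_abs_sum_le {X : ℕ → Ω → ℝ} (hm : ∀ k, Measurable (X k)) {K : ℝ}
    (hb : ∀ k ω, |X k ω| ≤ K) (h0 : ∀ k l, k ≠ l → ∫ ω, X k ω * X l ω ∂P = 0) {ε : ℝ}
    (hε : 0 < ε) (n : ℕ) : P {ω | ε ≤ |∑ k ∈ Finset.range n, X k ω|} ≤
      ENNReal.ofReal (n * K ^ 2 / ε ^ 2) := by
  have hint : ∀ k l, Integrable (fun ω => X k ω * X l ω) P := fun k l =>
    Integrable.of_bound ((hm k).mul (hm l)).aestronglyMeasurable (K * K)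
      (Eventually.of_forall fun ω => by
        rw [norm_mul]
        exact mul_le_mul (hb k ω) (hb l ω) (norm_nonneg _) ((abs_nonneg _).trans (hb k ω)))
  have hsq : ∀ ω, (∑ k ∈ Finset.range n, X k ω) ^ 2 =
      ∑ k ∈ Finset.range n, ∑ l ∈ Finset.range n, X k ω * X l ω := fun ω => by
    rw [sq, Finset.sum_mul_sum]
  have hI : Integrable (fun ω => (∑ k ∈ Finset.range n, X k ω) ^ 2) P := by
    simp only [hsq]
    exact integrable_finsetSum _ fun k _ => integrable_finsetSum _ fun l _ => hint k l
  have hE : ∫ ω, (∑ k ∈ Finset.range n, X k ω) ^ 2 ∂P ≤ n * K ^ 2 := by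
    simp only [hsq]
    rw [integral_finsetSum _ fun k _ => integrable_finsetSum _ fun l _ => hint k l]
    refine (Finset.sum_le_card_nsmul _ _ (K ^ 2) fun k hk => ?_).trans_eq (by simp)
    rw [integral_finsetSum _ fun l _ => hint k l, Finset.sum_eq_single_of_mem k hk
      fun l _ hl => h0 k l hl.symm]
    have : ∫ ω, X k ω * X k ω ∂P ≤ ∫ _, K ^ 2 ∂P := by
      refine integral_mono (hint k k) (integrable_const _) fun ω => ?_
      change X k ω * X k ω ≤ K ^ 2
      rw [← sq, ← sq_abs]
      exact pow_le_pow_left₀ (abs_nonneg _) (hb k ω) 2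
    simpa using this
  have hM := mul_meas_ge_le_integral_of_nonneg (Eventually.of_forall fun ω => sq_nonneg _) hI
    (ε ^ 2)
  have hset : {ω | ε ≤ |∑ k ∈ Finset.range n, X k ω|} =
      {ω | ε ^ 2 ≤ (∑ k ∈ Finset.range n, X k ω) ^ 2} := by
    ext ω
    change ε ≤ |_| ↔ ε ^ 2 ≤ _
    rw [← sq_abs (∑ k ∈ Finset.range n, X k ω)]
    exact (pow_le_pow_iff_left₀ hε.le (abs_nonneg _) two_ne_zero).symm
  rw [hset, ← ofReal_measureReal]
  refine ENNReal.ofReal_le_ofReal ?_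
  rw [le_div_iff₀ (by positivity), mul_comm]
  exact hM.trans hE

/-- Conditionally centred functions of independent, identically distributed random variables are
uncorrelated. -/
theorem integral_mul_eq_zero_of_indep {U V : Type*} [MeasurableSpace U] [MeasurableSpace V]
    {ξ ξ' : Ω → U} {ζ : Ω → V} {ρ : Measure U} [IsProbabilityMeasure ρ] (hξ : Measurable ξ)
    (hξ' : Measurable ξ') (hζ : Measurable ζ) (hρ : P.map ξ = ρ) (hρ' : P.map ξ' = ρ)
    (h1 : IndepFun ξ ξ' P) (h2 : IndepFun (fun ω => (ξ ω, ξ' ω)) ζ P) {H : U × V → ℝ}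
    (hH : Measurable H) {K : ℝ} (hK : ∀ x, |H x| ≤ K) (h0 : ∀ v, ∫ u, H (u, v) ∂ρ = 0) :
    ∫ ω, H (ξ ω, ζ ω) * H (ξ' ω, ζ ω) ∂P = 0 := by
  have hζ' : IsProbabilityMeasure (P.map ζ) := Measure.isProbabilityMeasure_map hζ.aemeasurable
  have e1 : P.map (fun ω => ((ξ ω, ξ' ω), ζ ω)) = (ρ.prod ρ).prod (P.map ζ) := by
    rw [(indepFun_iff_map_prod_eq_prod_map_map (hξ.prodMk hξ').aemeasurable hζ.aemeasurable).1 h2,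
      (indepFun_iff_map_prod_eq_prod_map_map hξ.aemeasurable hξ'.aemeasurable).1 h1, hρ, hρ']
  have hm : Measurable fun x : (U × U) × V => H (x.1.1, x.2) * H (x.1.2, x.2) := by fun_prop
  have e2 : ∫ ω, H (ξ ω, ζ ω) * H (ξ' ω, ζ ω) ∂P =
      ∫ x, H (x.1.1, x.2) * H (x.1.2, x.2) ∂((ρ.prod ρ).prod (P.map ζ)) := by
    rw [← e1, integral_map ((hξ.prodMk hξ').prodMk hζ).aemeasurable hm.aestronglyMeasurable]
  rw [e2, integral_prod_symm]
  · have : ∀ v, ∫ x : U × U, H (x.1, v) * H (x.2, v) ∂(ρ.prod ρ) = 0 := by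
      intro v
      rw [integral_prod_mul (fun u => H (u, v)) (fun u => H (u, v)), h0, zero_mul]
    simp [this]
  · refine Integrable.of_bound hm.aestronglyMeasurable (K * K) (Eventually.of_forall fun x => ?_)
    rw [norm_mul]
    exact mul_le_mul (hK _) (hK _) (norm_nonneg _) ((abs_nonneg _).trans (hK (x.1.1, x.2)))

end Probability

variable {d N₁ M : ℕ} {m : Model d N₁ M} {Ω : Type*} [MeasurableSpace Ω] {P : Measure Ω}
  [IsProbabilityMeasure P] {W : Noise d N₁ Ω}

namespace Assumptions

theorem sigma_le (hW : Assumptions P m W) (k : NoiseIndex N₁) :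
    W.sigma k ≤ (inferInstance : MeasurableSpace Ω) := by
  cases k with
  | C i => exact (hW.measurable_C i).comap_le
  | W₂ j i => exact (hW.measurable_W₂ j i).comap_le
  | W₁ j => exact (hW.measurable_W₁ j).comap_le
  | z k => exact (hW.measurable_z k).comap_le

theorem indepFun_of_disjoint (hW : Assumptions P m W) {S S' : Set (NoiseIndex N₁)}
    (hS : Disjoint S S') {U V : Type*} [mU : MeasurableSpace U] [mV : MeasurableSpace V]
    {f : Ω → U} {g : Ω → V} (hf : Measurable[⨆ k ∈ S, W.sigma k] f)
    (hg : Measurable[⨆ k ∈ S', W.sigma k] g) : IndepFun f g P := by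
  rw [IndepFun_iff_Indep]
  exact indep_of_indep_of_le_left (indep_of_indep_of_le_right
    (indep_iSup_of_disjoint hW.sigma_le hW.independent hS) hg.comap_le) hf.comap_le

end Assumptions

namespace Noise

variable (W)

/-- The initial parameters of the `i`-th unit. -/
def unit (i : ℕ) (ω : Ω) : ℝ × (Fin N₁ → ℝ) := (W.C i ω, fun j => W.W₂ j i ω)

/-- The names of the initial parameters of the `i`-th unit. -/
def unitIndex (N₁ : ℕ) (i : ℕ) : Set (NoiseIndex N₁) :=
  insert (.C i) (Set.range fun j => .W₂ j i)

theorem measurable_of_mem {S : Set (NoiseIndex N₁)} {k : NoiseIndex N₁} (hk : k ∈ S)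
    {U : Type*} [MeasurableSpace U] {f : Ω → U} (hf : Measurable[W.sigma k] f) :
    Measurable[⨆ k ∈ S, W.sigma k] f :=
  hf.mono (le_iSup₂_of_le k hk le_rfl) le_rfl

theorem measurable_unit_iSup {S : Set (NoiseIndex N₁)} {i : ℕ} (h : unitIndex N₁ i ⊆ S) :
    Measurable[⨆ k ∈ S, W.sigma k] (W.unit i) := by
  refine Measurable.prodMk ?_ (measurable_pi_of_forall fun j => ?_)
  · exact W.measurable_of_mem (h (Set.mem_insert _ _)) (comap_measurable (W.C i))
  · exact W.measurable_of_mem (h (Set.mem_insert_of_mem _ ⟨j, rfl⟩)) (comap_measurable (W.W₂ j i))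

theorem measurable_W₁_iSup :
    Measurable[⨆ k ∈ Set.range (NoiseIndex.W₁ (N₁ := N₁)), W.sigma k] fun ω j => W.W₁ j ω := by
  refine measurable_pi_of_forall fun j => ?_
  exact W.measurable_of_mem (Set.mem_range_self j) (comap_measurable (W.W₁ j))

end Noise

namespace Assumptions

theorem measurable_unit (hW : Assumptions P m W) (i : ℕ) : Measurable (W.unit i) :=
  (hW.measurable_C i).prodMk (measurable_pi_lambda _ fun j => hW.measurable_W₂ j i)

theorem indepFun_unit (hW : Assumptions P m W) {i k : ℕ} (hik : i ≠ k) :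
    IndepFun (W.unit i) (W.unit k) P := by
  refine hW.indepFun_of_disjoint (S := Noise.unitIndex N₁ i) (S' := Noise.unitIndex N₁ k) ?_
    (W.measurable_unit_iSup le_rfl) (W.measurable_unit_iSup le_rfl)
  rw [Set.disjoint_left]
  rintro _ (rfl | ⟨j, rfl⟩) <;> simp [Noise.unitIndex, hik, hik.symm]

theorem indepFun_unit_W₁ (hW : Assumptions P m W) (i k : ℕ) :
    IndepFun (fun ω => (W.unit i ω, W.unit k ω)) (fun ω j => W.W₁ j ω) P := by
  refine hW.indepFun_of_disjoint (S := Noise.unitIndex N₁ i ∪ Noise.unitIndex N₁ k)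
    (S' := Set.range NoiseIndex.W₁) ?_ ((W.measurable_unit_iSup Set.subset_union_left).prodMk
      (W.measurable_unit_iSup Set.subset_union_right)) W.measurable_W₁_iSup
  rw [Set.disjoint_left]
  rintro _ ((rfl | ⟨j, rfl⟩) | (rfl | ⟨j, rfl⟩)) <;> simp

theorem law_unit (hW : Assumptions P m W) (i : ℕ) :
    P.map (W.unit i) = m.μC.prod (Measure.pi fun _ : Fin N₁ => m.μW₂) := by
  have h1 : IndepFun (W.C i) (fun ω j => W.W₂ j i ω) P := by
    have hC : Measurable[⨆ k ∈ ({.C i} : Set (NoiseIndex N₁)), W.sigma k] (W.C i) :=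
      W.measurable_of_mem (k := .C i) (Set.mem_singleton _) (comap_measurable (W.C i))
    have hW₂ : Measurable[⨆ k ∈ Set.range fun j : Fin N₁ => NoiseIndex.W₂ j i, W.sigma k]
        fun ω j => W.W₂ j i ω := measurable_pi_of_forall fun j =>
      W.measurable_of_mem (Set.mem_range_self j) (comap_measurable (W.W₂ j i))
    exact hW.indepFun_of_disjoint (by simp) hC hW₂
  have h2 : iIndepFun (fun j => W.W₂ j i) P := by
    rw [iIndepFun_iff_iIndep]
    exact hW.independent.precomp (g := fun j : Fin N₁ => NoiseIndex.W₂ j i)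
      (fun j k h => by simpa using h)
  have h3 := (iIndepFun_iff_map_fun_eq_pi_map
    (fun j => (hW.measurable_W₂ j i).aemeasurable)).1 h2
  unfold Noise.unit
  rw [(indepFun_iff_map_prod_eq_prod_map_map (hW.measurable_C i).aemeasurable
    (measurable_pi_lambda _ fun j => hW.measurable_W₂ j i).aemeasurable).1 h1, h3, hW.law_C]
  simp only [hW.law_W₂]

theorem integral_γ₀ (hW : Assumptions P m W) (hN₁ : 0 < N₁) (w : Fin N₁ → Vec d)
    {F : Theta d N₁ → ℝ} (hF : Continuous F) :
    ∫ θ, F θ ∂m.γ₀ w = ∫ u, F (u.1, u.2, w) ∂m.μC.prod (Measure.pi fun _ : Fin N₁ => m.μW₂) := by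
  have := hW.prob_C
  have := hW.prob_W₂ hN₁
  have h1 : m.γ₀ w = (m.μC.prod (Measure.pi fun _ : Fin N₁ => m.μW₂)).map
      (Prod.map id fun v => (v, w)) := by
    rw [← Measure.map_prod_map _ _ measurable_id (by fun_prop), Measure.map_id, Model.γ₀,
      Measure.prod_dirac]
  rw [h1, integral_map (by fun_prop) hF.aestronglyMeasurable]
  rfl

variable {φ T : ℝ}

theorem tendsto_natCast_rpow_zero {s : ℝ} (hs : s < 0) :
    Tendsto (fun n : ℕ => (n : ℝ) ^ s) atTop (𝓝 0) := by
  have := (tendsto_rpow_neg_atTop (y := -s) (by linarith)).comp tendsto_natCast_atTop_atTop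
  simpa [Function.comp_def] using this

/-- The initial fluctuations, for bounded test functions. -/
theorem tendsto_fluct_zero_of_bounded (hW : Assumptions P m W) (hN₁ : 0 < N₁) (hφ : φ < 1 / 4)
    {F : Theta d N₁ → ℝ} (hF : Continuous F) {K : ℝ} (hK : ∀ θ, |F θ| ≤ K) :
    Tendsto (fun a : ℕ × Ω => (m.sgdRun W φ T).β a * (m.sgdRun W φ T).fluct F (a, 0))
      (inProb P) (𝓝 0) := by
  have := hW.prob_C
  have := hW.prob_W₂ hN₁
  set ρ := m.μC.prod (Measure.pi fun _ : Fin N₁ => m.μW₂) with hρ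
  set H : (ℝ × (Fin N₁ → ℝ)) × (Fin N₁ → Vec d) → ℝ := fun x =>
    F (x.1.1, x.1.2, x.2) - ∫ u, F (u.1, u.2, x.2) ∂ρ with hH
  have hc : Continuous fun x : (ℝ × (Fin N₁ → ℝ)) × (Fin N₁ → Vec d) => F (x.1.1, x.1.2, x.2) := by
    fun_prop
  have hi : ∀ v, Integrable (fun u : ℝ × (Fin N₁ → ℝ) => F (u.1, u.2, v)) ρ := fun v =>
    Integrable.of_bound (Continuous.aestronglyMeasurable (by fun_prop)) K
      (Eventually.of_forall fun u => hK _)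
  have hHm : Measurable H := by
    refine hc.measurable.sub ?_
    have h1 : StronglyMeasurable fun v : Fin N₁ → Vec d => ∫ u, F (u.1, u.2, v) ∂ρ :=
      StronglyMeasurable.integral_prod_left (f := fun (u : ℝ × (Fin N₁ → ℝ)) v => F (u.1, u.2, v))
        hc.stronglyMeasurable
    exact h1.measurable.comp measurable_snd
  have hHK : ∀ x, |H x| ≤ 2 * K := by
    intro x
    have h1 : ‖∫ u, F (u.1, u.2, x.2) ∂ρ‖ ≤ K * ρ.real Set.univ :=
      norm_integral_le_of_norm_le_const (Eventually.of_forall fun u => hK _)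
    simp only [probReal_univ, mul_one] at h1
    refine (abs_sub _ _).trans ?_
    linarith [hK (x.1.1, x.1.2, x.2), show |∫ u, F (u.1, u.2, x.2) ∂ρ| ≤ K from h1]
  have hH0 : ∀ v, ∫ u, H (u, v) ∂ρ = 0 := by
    intro v
    simp only [hH]
    rw [integral_sub (hi v) (integrable_const _)]
    simp
  set X : ℕ → Ω → ℝ := fun i ω => H (W.unit i ω, fun j => W.W₁ j ω) with hX
  have hζm : Measurable fun ω j => W.W₁ j ω := measurable_pi_lambda _ hW.measurable_W₁
  have hXm : ∀ i, Measurable (X i) := fun i => hHm.comp ((hW.measurable_unit i).prodMk hζm)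
  have hX0 : ∀ i k, i ≠ k → ∫ ω, X i ω * X k ω ∂P = 0 := fun i k hik =>
    integral_mul_eq_zero_of_indep (hW.measurable_unit i) (hW.measurable_unit k) hζm
      (hW.law_unit i) (hW.law_unit k) (hW.indepFun_unit hik) (hW.indepFun_unit_W₁ i k) hHm hHK hH0
  have hfl : ∀ a : ℕ × Ω, 0 < a.1 → (m.sgdRun W φ T).β a * (m.sgdRun W φ T).fluct F (a, 0) =
      (a.1 : ℝ) ^ (2 * φ - 1) * ∑ i ∈ Finset.range a.1, X i a.2 := by
    intro a ha
    have ha' : (0 : ℝ) < a.1 := by exact_mod_cast ha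
    have e1 : (m.sgdRun W φ T).fluct F (a, 0) = (a.1 : ℝ) ^ φ * ((a.1 : ℝ)⁻¹ *
        ∑ i : Fin a.1, F (W.C i a.2, fun j => W.W₂ j i a.2, fun j => W.W₁ j a.2) -
          ∫ θ, F θ ∂m.γ₀ fun j => W.W₁ j a.2) := rfl
    have e2 : (m.sgdRun W φ T).β a = (a.1 : ℝ) ^ φ := rfl
    rw [e1, e2, hW.integral_γ₀ hN₁ _ hF, ← hρ, Fin.sum_univ_eq_sum_range (fun i =>
      F (W.C i a.2, fun j => W.W₂ j i a.2, fun j => W.W₁ j a.2))]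
    have e3 : ∑ i ∈ Finset.range a.1, X i a.2 = ∑ i ∈ Finset.range a.1,
        F (W.C i a.2, fun j => W.W₂ j i a.2, fun j => W.W₁ j a.2) -
          a.1 * ∫ u, F (u.1, u.2, fun j => W.W₁ j a.2) ∂ρ := by
      simp [hX, hH, Noise.unit]
    have e4 : (a.1 : ℝ) ^ (2 * φ - 1) = (a.1 : ℝ) ^ φ * (a.1 : ℝ) ^ φ * (a.1 : ℝ)⁻¹ := by
      rw [Real.rpow_sub ha', two_mul, Real.rpow_add ha', Real.rpow_one, div_eq_mul_inv]
    rw [e3, e4]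
    field_simp
  rw [Metric.tendsto_nhds]
  intro δ hδ
  refine eventually_inProb_of_le (b := fun n => ((2 * K) ^ 2 / δ ^ 2) * (n : ℝ) ^ (4 * φ - 1)) ?_ ?_
  · simpa using (tendsto_natCast_rpow_zero (s := 4 * φ - 1) (by linarith)).const_mul
      ((2 * K) ^ 2 / δ ^ 2)
  · filter_upwards [eventually_gt_atTop 0] with n hn
    have hn' : (0 : ℝ) < n := by exact_mod_cast hn
    have hpos : (0 : ℝ) < (n : ℝ) ^ (2 * φ - 1) := Real.rpow_pos_of_pos hn' _
    refine (measure_mono fun ω hω => ?_).trans ((measure_le_abs_sum_le hXm (fun k ω => hHK _) hX0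
      (ε := δ / (n : ℝ) ^ (2 * φ - 1)) (by positivity) n).trans (ENNReal.ofReal_le_ofReal ?_))
    · have hω' : ¬ dist ((m.sgdRun W φ T).β (n, ω) * (m.sgdRun W φ T).fluct F ((n, ω), 0)) 0 < δ :=
        hω
      rw [hfl (n, ω) hn, not_lt, Real.dist_eq, sub_zero, abs_mul, abs_of_pos hpos] at hω'
      change δ / (n : ℝ) ^ (2 * φ - 1) ≤ |∑ i ∈ Finset.range n, X i ω|
      rw [div_le_iff₀ hpos, mul_comm]
      exact hω'
    · have e5 : (n : ℝ) ^ (4 * φ - 1) = n * ((n : ℝ) ^ (2 * φ - 1)) ^ 2 := by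
        rw [← Real.rpow_natCast ((n : ℝ) ^ (2 * φ - 1)) 2, ← Real.rpow_mul hn'.le]
        nth_rewrite 2 [← Real.rpow_one (n : ℝ)]
        rw [← Real.rpow_add hn']
        congr 1
        push_cast
        ring
      rw [e5]
      apply le_of_eq
      field_simp

/-- The fluctuations of the samples. -/
theorem noise_isLittleO (hW : Assumptions P m W) (hφ : φ < 1 / 2) (hT : 0 < T) (i : Fin M) :
    (avg (m.sgdRun W φ T).N fun p => (m.sgdRun W φ T).w p.1 p.2 i - m.meanField.π i)
      =o[upTo (inProb P) (m.sgdRun W φ T).n] fun p => ((m.sgdRun W φ T).β p.1)⁻¹ := by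
  set X : ℕ → Ω → ℝ := fun k ω => m.dataWeight i (W.z k ω) - (M : ℝ)⁻¹ with hX
  have hm0 : Measurable fun z => m.dataWeight i z - (M : ℝ)⁻¹ :=
    (Model.measurable_dataWeight i).sub_const _
  have hind : iIndepFun X P := by
    have h1 : iIndepFun W.z P := by
      rw [iIndepFun_iff_iIndep]
      exact hW.independent.precomp (g := fun k : ℕ => NoiseIndex.z k)
        (fun j k h => by simpa using h)
    exact h1.comp (fun _ z => m.dataWeight i z - (M : ℝ)⁻¹) fun _ => hm0
  have hXm : ∀ k, Measurable (X k) := fun k => hm0.comp (hW.measurable_z k)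
  have hM : 1 ≤ (M : ℝ) := by exact_mod_cast Nat.succ_le_of_lt (Fin.pos i)
  have hXb : ∀ k ω, X k ω ∈ Set.Icc (-1 : ℝ) 1 := by
    intro k ω
    have h1 := Model.dataWeight_mem_Icc (m := m) i (W.z k ω)
    have h2 : 0 ≤ (M : ℝ)⁻¹ := by positivity
    have h3 : (M : ℝ)⁻¹ ≤ 1 := inv_le_one_of_one_le₀ hM
    exact ⟨by linarith [h1.1], by linarith [h1.2]⟩
  have hX0 : ∀ k, ∫ ω, X k ω ∂P = 0 := by
    intro k
    have h1 : ∫ ω, m.dataWeight i (W.z k ω) ∂P = (M : ℝ)⁻¹ := by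
      rw [← Model.integral_dataWeight (m := m) i, ← hW.law_z k,
        integral_map (hW.measurable_z k).aemeasurable
          (Model.measurable_dataWeight i).aestronglyMeasurable]
    have h2 : Integrable (fun ω => m.dataWeight i (W.z k ω)) P :=
      Integrable.of_bound ((Model.measurable_dataWeight i).comp
        (hW.measurable_z k)).aestronglyMeasurable 1 (Eventually.of_forall fun ω => by
          have := Model.dataWeight_mem_Icc (m := m) i (W.z k ω)
          rw [Real.norm_of_nonneg this.1]
          exact this.2)
    rw [integral_sub h2 (integrable_const _), h1]
    simp
  refine isLittleO_upTo (b := fun a => ((m.sgdRun W φ T).β a)⁻¹).2 fun δ hδ => ?_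
  set c := δ ^ 2 / (2 * T) with hcdef
  have hc : 0 < c := by positivity
  refine eventually_inProb_of_le (b := fun n => (n * T + 1) *
    (2 * Real.exp (-c * (n : ℝ) ^ (1 - 2 * φ)))) ?_ ?_
  · have hs : 0 < 1 - 2 * φ := by linarith
    have h1 : Tendsto (fun n : ℕ => (n : ℝ) ^ (1 - 2 * φ)) atTop atTop :=
      (tendsto_rpow_atTop hs).comp tendsto_natCast_atTop_atTop
    have h2 := (tendsto_rpow_mul_exp_neg_mul_atTop_nhds_zero (1 / (1 - 2 * φ)) c hc).comp h1
    have h3 := (tendsto_rpow_mul_exp_neg_mul_atTop_nhds_zero 0 c hc).comp h1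
    have h4 := (h2.const_mul (2 * T)).add (h3.const_mul 2)
    simp only [mul_zero, add_zero] at h4
    refine h4.congr fun n => ?_
    simp only [Function.comp_apply, Real.rpow_zero]
    rw [← Real.rpow_mul (Nat.cast_nonneg n), mul_one_div_cancel hs.ne', Real.rpow_one]
    ring
  · filter_upwards [eventually_gt_atTop 0, tendsto_natCast_atTop_atTop.eventually_ge_atTop
      (1 / T)] with n hn hnT
    have hn' : (0 : ℝ) < n := by exact_mod_cast hn
    rw [div_le_iff₀ hT] at hnT
    set ε := δ * (n : ℝ) ^ (1 - φ) with hε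
    have hε0 : 0 < ε := by positivity
    refine (measure_mono fun ω hω => ?_).trans ((measure_exists_lt_abs_sum_le hind hXm hXb hX0
      hε0.le ⌊(n : ℝ) * T⌋₊).trans (ENNReal.ofReal_le_ofReal ?_))
    · have hω' : ¬ ∀ k ≤ ⌊(n : ℝ) * T⌋₊, |(n : ℝ)⁻¹ * ∑ m ∈ Finset.range k, X m ω| ≤
          δ * |((n : ℝ) ^ φ)⁻¹| := hω
      push Not at hω'
      obtain ⟨k, hk, hlt⟩ := hω'
      refine ⟨k, hk, ?_⟩
      rw [abs_mul, abs_of_pos (a := ((n : ℝ) ^ φ)⁻¹) (by positivity),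
        abs_of_pos (a := (n : ℝ)⁻¹) (by positivity),
        lt_inv_mul_iff₀ hn'] at hlt
      refine lt_of_eq_of_lt ?_ hlt
      rw [hε, Real.rpow_sub hn', Real.rpow_one]
      field_simp
    · have hfl : (⌊(n : ℝ) * T⌋₊ : ℝ) ≤ n * T := Nat.floor_le (by positivity)
      have h0 : (0 : ℝ) < ⌊(n : ℝ) * T⌋₊ := by exact_mod_cast Nat.floor_pos.2 hnT
      gcongr
      rw [neg_div, neg_mul, neg_le_neg_iff]
      calc c * (n : ℝ) ^ (1 - 2 * φ) = ε ^ 2 / (2 * (n * T)) := by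
            have e : (n : ℝ) ^ (1 - 2 * φ) * n = ((n : ℝ) ^ (1 - φ)) ^ 2 := by
              rw [← Real.rpow_natCast ((n : ℝ) ^ (1 - φ)) 2, ← Real.rpow_mul hn'.le]
              nth_rewrite 2 [← Real.rpow_one (n : ℝ)]
              rw [← Real.rpow_add hn']
              congr 1
              push_cast
              ring
            rw [hε, hcdef, mul_pow, ← e]
            field_simp
        _ ≤ ε ^ 2 / (2 * ⌊(n : ℝ) * T⌋₊) := by gcongr

end Assumptions

end DeepNet

namespace DeepNet

open Asymptotics

/-! ### Paths in the Skorokhod space -/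

section Skorokhod

variable {T : ℝ}

theorem isCadlag_of_continuousOn {x : ℝ → ℝ} (hx : ContinuousOn x (Set.Icc 0 T)) :
    IsCadlag fun t : Set.Icc (0 : ℝ) T => x t := fun t => by
  have hc : Continuous fun t : Set.Icc (0 : ℝ) T => x t :=
    continuousOn_iff_continuous_domRestrict.1 hx
  exact ⟨hc.continuousWithinAt, x t, hc.continuousAt.mono_left nhdsWithin_le_nhds⟩

theorem IsCadlag.const_mul {x : Set.Icc (0 : ℝ) T → ℝ} (hx : IsCadlag x) (c : ℝ) :
    IsCadlag fun t => c * x t := fun t => by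
  obtain ⟨h1, l, h2⟩ := hx t
  exact ⟨continuousWithinAt_const.mul h1, c * l, h2.const_mul c⟩

theorem IsCadlag.sub {x y : Set.Icc (0 : ℝ) T → ℝ} (hx : IsCadlag x) (hy : IsCadlag y) :
    IsCadlag fun t => x t - y t := fun t => by
  obtain ⟨h1, l, h2⟩ := hx t
  obtain ⟨h3, l', h4⟩ := hy t
  exact ⟨h1.sub h3, l - l', h2.sub h4⟩

theorem isCadlag_floor (n : ℕ) (g : ℕ → ℝ) :
    IsCadlag fun t : Set.Icc (0 : ℝ) T => g ⌊(n : ℝ) * t⌋₊ := by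
  rcases Nat.eq_zero_or_pos n with rfl | hn
  · simp only [Nat.cast_zero, zero_mul]
    exact isCadlag_of_continuousOn continuousOn_const
  have hn' : (0 : ℝ) < n := by exact_mod_cast hn
  intro t
  have hc : ContinuousAt (fun t : Set.Icc (0 : ℝ) T => (n : ℝ) * t) t := by fun_prop
  have h1 : Tendsto (fun t : Set.Icc (0 : ℝ) T => (n : ℝ) * t) (𝓝[≥] t) (𝓝[≥] ((n : ℝ) * t)) :=
    hc.continuousWithinAt.tendsto_nhdsWithin fun s hs =>
      mul_le_mul_of_nonneg_left (Subtype.coe_le_coe.2 hs) hn'.le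
  have h2 : Tendsto (fun t : Set.Icc (0 : ℝ) T => (n : ℝ) * t) (𝓝[<] t) (𝓝[<] ((n : ℝ) * t)) :=
    hc.continuousWithinAt.tendsto_nhdsWithin fun s hs =>
      mul_lt_mul_of_pos_left (Subtype.coe_lt_coe.2 hs) hn'
  simp only [← Int.floor_toNat]
  refine ⟨tendsto_const_nhds.congr' ?_, g (⌈(n : ℝ) * t⌉ - 1).toNat, tendsto_const_nhds.congr' ?_⟩
  · filter_upwards [tendsto_pure.1 ((tendsto_floor_right_pure_floor _).comp h1)] with s hs
    simp only [Function.comp_apply] at hs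
    rw [hs]
  · filter_upwards [tendsto_pure.1 ((tendsto_floor_left_pure_ceil_sub_one _).comp h2)] with s hs
    simp only [Function.comp_apply] at hs
    rw [hs]

theorem skorokhodDist_le {x y : Set.Icc (0 : ℝ) T → ℝ} {δ : ℝ} (h : ∀ t, |x t - y t| ≤ δ) :
    skorokhodDist x y ≤ ENNReal.ofReal δ := by
  refine iInf_le_of_le (OrderIso.refl _) (max_le (iSup_le fun t => by simp) (iSup_le fun t => ?_))
  rw [edist_dist, Real.dist_eq]
  exact ENNReal.ofReal_le_ofReal (h t)

/-- Uniform convergence in probability implies convergence in probability in the Skorokhod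
space. -/
theorem tendstoInProbabilityD_of_eventually {Ω : Type*} [MeasurableSpace Ω] {P : Measure Ω}
    {X : ℕ → Ω → ℝ → ℝ} {Y : Ω → ℝ → ℝ}
    (hX : ∀ n ω, IsCadlag fun t : Set.Icc (0 : ℝ) T => X n ω t)
    (hY : ∀ ω, IsCadlag fun t : Set.Icc (0 : ℝ) T => Y ω t)
    (h : ∀ δ > 0, ∀ᶠ a in inProb P, ∀ t ∈ Set.Icc 0 T, |X a.1 a.2 t - Y a.2 t| ≤ δ) :
    TendstoInProbabilityD P T X Y := by
  refine ⟨hX, hY, fun ε hε => ?_⟩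
  obtain ⟨δ, hδ, hδε⟩ := ENNReal.lt_iff_exists_nnreal_btwn.1 hε
  have h1 := eventually_inProb.1 (h δ (by exact_mod_cast hδ))
  refine tendsto_of_tendsto_of_tendsto_of_le_of_le tendsto_const_nhds h1 (fun _ => zero_le)
    fun n => measure_mono fun ω hω hle => ?_
  have h2 := skorokhodDist_le (x := fun t : Set.Icc (0 : ℝ) T => X n ω t)
    (y := fun t : Set.Icc (0 : ℝ) T => Y ω t) fun t => hle t t.2
  rw [ENNReal.ofReal_coe_nnreal] at h2
  exact absurd (hω.trans h2) (not_le.2 hδε)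

end Skorokhod

namespace MFRun

variable {ι I J E : Type*} [Fintype I] [Fintype J] [NormedAddCommGroup E] [NormedSpace ℝ E]
  [MeasurableSpace E] {r : MFRun ι I E} {s : MeanField I J E} {a : ι} {T : ℝ}

theorem continuousOn_lim (hT : 0 ≤ T) (hh : ∀ i, ContinuousOn (fun t => r.h a t i) (Set.Icc 0 T))
    (F : E → ℝ) : ContinuousOn (r.lim s F a) (Set.Icc 0 T) := by
  rw [← Set.uIcc_of_le hT] at hh ⊢
  refine intervalIntegral.continuousOn_primitive_interval
    (ContinuousOn.integrableOn_compact isCompact_uIcc ?_)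
  fun_prop

theorem continuousOn_driftLim (hT : 0 ≤ T)
    (hh : ∀ i, ContinuousOn (fun t => r.h a t i) (Set.Icc 0 T)) (i : I) (F : E → ℝ) :
    ContinuousOn (r.driftLim s i F a) (Set.Icc 0 T) :=
  ((continuousOn_lim hT hh _).add (continuousOn_finsetSum _ fun _ _ =>
    continuousOn_const.mul (continuousOn_lim hT hh _))).add (continuousOn_finsetSum _ fun _ _ =>
    (continuousOn_lim hT hh _).mul continuousOn_const)

theorem continuousOn_lim₂ (hT : 0 ≤ T) (hh : ∀ i, ContinuousOn (fun t => r.h a t i) (Set.Icc 0 T))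
    (hκ : ∀ i, ContinuousOn (fun t => r.κ a t i) (Set.Icc 0 T)) (F : E → ℝ) :
    ContinuousOn (r.lim₂ s F a) (Set.Icc 0 T) := by
  have hc : ContinuousOn (fun u => ∑ i, s.π i *
      ((s.y i - r.h a u i) * r.driftLim s i F a u - r.κ a u i * r.driftMean s i F a))
      (Set.Icc 0 T) := continuousOn_finsetSum _ fun i _ => continuousOn_const.mul
    (((continuousOn_const.sub (hh i)).mul (continuousOn_driftLim hT hh i F)).sub
      ((hκ i).mul continuousOn_const))
  rw [← Set.uIcc_of_le hT] at hc ⊢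
  exact intervalIntegral.continuousOn_primitive_interval
    (hc.integrableOn_compact isCompact_uIcc)

end MFRun

variable {d N₁ M : ℕ} {m : Model d N₁ M} {Ω : Type*} [MeasurableSpace Ω] {P : Measure Ω}
  [IsProbabilityMeasure P] {W : Noise d N₁ Ω} {φ T : ℝ}

namespace Model

theorem ae_π : ∀ᵐ z ∂m.π, ∃ i, (m.x i, m.y i) = z := by
  unfold π
  refine Measure.ae_smul_measure ?_ _
  rw [ae_iff, Measure.finsetSum_apply]
  refine Finset.sum_eq_zero fun i _ => ?_
  rw [Measure.dirac_apply]
  simp only [Set.indicator_apply_eq_zero]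
  exact fun h => absurd ⟨i, rfl⟩ h

end Model

namespace Assumptions

theorem ae_sample (hW : Assumptions P m W) : ∀ᵐ ω ∂P, ∀ k, ∃ i, (m.x i, m.y i) = W.z k ω :=
  ae_all_iff.2 fun k => ae_of_ae_map (hW.measurable_z k).aemeasurable (by
    rw [hW.law_z k]
    exact Model.ae_π)

theorem ae_init (hW : Assumptions P m W) {R : ℝ} (h1 : ∀ᵐ c ∂m.μC, ‖c‖ ≤ R)
    (h2 : ∀ᵐ w ∂m.μW₂, ‖w‖ ≤ R) (h3 : ∀ᵐ w ∂m.μW₁, ‖w‖ ≤ R) :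
    ∀ᵐ ω ∂P, (∀ i, ‖W.C i ω‖ ≤ R) ∧ (∀ j i, ‖W.W₂ j i ω‖ ≤ R) ∧ ∀ j, ‖W.W₁ j ω‖ ≤ R := by
  have a1 : ∀ᵐ ω ∂P, ∀ i, ‖W.C i ω‖ ≤ R := ae_all_iff.2 fun i =>
    ae_of_ae_map (hW.measurable_C i).aemeasurable (by rwa [hW.law_C i])
  have a2 : ∀ᵐ ω ∂P, ∀ j i, ‖W.W₂ j i ω‖ ≤ R := ae_all_iff.2 fun j => ae_all_iff.2 fun i =>
    ae_of_ae_map (hW.measurable_W₂ j i).aemeasurable (by rwa [hW.law_W₂ j i])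
  have a3 : ∀ᵐ ω ∂P, ∀ j, ‖W.W₁ j ω‖ ≤ R := ae_all_iff.2 fun j =>
    ae_of_ae_map (hW.measurable_W₁ j).aemeasurable (by rwa [hW.law_W₁ j])
  filter_upwards [a1, a2, a3] with ω b1 b2 b3 using ⟨b1, b2, b3⟩

/-- The initial fluctuations. -/
theorem tendsto_fluct_zero (hW : Assumptions P m W) (hN₁ : 0 < N₁) (hφ : φ < 1 / 4) {R : ℝ}
    (hinit : ∀ᶠ a in inProb P, ∀ i, ‖(m.sgdRun W φ T).θ a 0 i‖ ≤ R)
    (hsupp : ∀ᶠ a in inProb P, ∀ᵐ θ ∂(m.sgdRun W φ T).ν a, ‖θ‖ ≤ R)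
    {F : Theta d N₁ → ℝ} (hF : Continuous F) :
    Tendsto (fun a : ℕ × Ω => (m.sgdRun W φ T).β a * (m.sgdRun W φ T).fluct F (a, 0))
      (inProb P) (𝓝 0) := by
  obtain ⟨K, hK0, hK⟩ := exists_bound_of_continuous hF R
  have hle : ∀ θ, |max (-K) (min K (F θ))| ≤ K := fun θ =>
    abs_le.2 ⟨le_max_left _ _, max_le (by linarith) (min_le_left _ _)⟩
  have heq : ∀ θ, ‖θ‖ ≤ R → max (-K) (min K (F θ)) = F θ := fun θ hθ => by
    have := abs_le.1 (hK θ hθ)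
    rw [min_eq_right this.2, max_eq_right this.1]
  refine (hW.tendsto_fluct_zero_of_bounded hN₁ hφ (T := T) (F := fun θ => max (-K) (min K (F θ)))
    (by fun_prop) hle).congr' ?_
  filter_upwards [hinit, hsupp] with a h1 h2
  have e1 : (m.sgdRun W φ T).mean (fun θ => max (-K) (min K (F θ))) a =
      (m.sgdRun W φ T).mean F a := integral_congr_ae (h2.mono heq)
  have e2 : (m.sgdRun W φ T).emp (fun θ => max (-K) (min K (F θ))) (a, 0) =
      (m.sgdRun W φ T).emp F (a, 0) := by
    unfold MFRun.emp
    congr 1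
    exact Finset.sum_congr rfl fun i _ => heq _ (h1 i)
  rw [MFRun.fluct, MFRun.fluct, e1, e2]

/-- Stochastic gradient descent is an admissible family of mean-field particle systems. -/
theorem exists_admissible (hW : Assumptions P m W) (hN₁ : 0 < N₁) (hφ : φ = 1 - m.γ₂)
    (hφ0 : 0 < φ) (hφ1 : φ < 1 / 4) (hT : 0 < T) :
    ∃ R, (m.sgdRun W φ T).Admissible m.meanField (inProb P) T R := by
  obtain ⟨R, hR, h1, h2, h3⟩ := hW.exists_bound
  have hae := eventually_inProb_of_ae (hW.ae_init h1 h2 h3)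
  have hpos : ∀ᶠ a in inProb P, 0 < a.1 := tendsto_fst_inProb.eventually (eventually_gt_atTop 0)
  have hinit : ∀ᶠ a in inProb P, ∀ i, ‖(m.sgdRun W φ T).θ a 0 i‖ ≤ R := by
    filter_upwards [hae] with a ha i
    exact norm_prod_le_iff.2 ⟨ha.1 i, norm_prod_le_iff.2
      ⟨(pi_norm_le_iff_of_nonneg hR).2 fun j => ha.2.1 j i,
        (pi_norm_le_iff_of_nonneg hR).2 fun j => ha.2.2 j⟩⟩
  have hsupp : ∀ᶠ a in inProb P, ∀ᵐ θ ∂(m.sgdRun W φ T).ν a, ‖θ‖ ≤ R := by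
    filter_upwards [hae] with a ha
    exact hW.ae_γ₀ hN₁ hR h1 h2 ((pi_norm_le_iff_of_nonneg hR).2 fun j => ha.2.2 j)
  refine ⟨R, ⟨hT, ?_, ?_, hpos, ?_, hinit, fun a => hW.prob_γ₀ hN₁ _,
    hsupp, ?_, ?_, ?_, ?_, ?_, ?_, ?_, ?_, ?_⟩⟩
  · exact ((tendsto_rpow_atTop hφ0).comp tendsto_natCast_atTop_atTop).comp tendsto_fst_inProb
  · refine ((tendsto_natCast_rpow_zero (s := φ - 1) (by linarith)).comp
      tendsto_fst_inProb).congr' ?_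
    filter_upwards [hpos] with a ha
    simp only [Function.comp_apply]
    rw [Real.rpow_sub (by exact_mod_cast ha), Real.rpow_one]
    rfl
  · exact Eventually.of_forall fun a => Nat.floor_le (by positivity)
  · exact fun a i => hW.integral_G hN₁ _ i
  · refine Eventually.of_forall fun a k i => ?_
    have := Model.dataWeight_mem_Icc (m := m) i (W.z k a.2)
    exact abs_le.2 ⟨neg_one_lt_zero.le.trans this.1, this.2⟩
  · filter_upwards [hpos, eventually_inProb_of_ae hW.ae_sample] with a ha hz k l
    exact Model.sgdRun_step hN₁ hφ ha hz k l
  · exact fun F hF => hW.tendsto_fluct_zero hN₁ hφ1 hinit hsupp hF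
  · exact fun i => hW.noise_isLittleO (by linarith) hT i
  · exact fun a i => Model.continuousOn_sgdRun_h i T
  · exact fun a t ht i => Model.sgdRun_h_eq hW hN₁ ht.1 i
  · exact fun a i => ((m.K_spec _).1 _).mono Set.Icc_subset_Ici_self
  · exact fun a t ht i => Model.sgdRun_κ_eq hW hN₁ ht.1 i

end Assumptions

namespace Model

theorem isCadlag_LPre (ζ : ℝ) (F : Theta d N₁ → ℝ) (n : ℕ) (ω : Ω) :
    IsCadlag fun t : Set.Icc (0 : ℝ) T => m.LPre W φ ζ F n ω t := by
  unfold LPre l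
  refine IsCadlag.const_mul (IsCadlag.sub ?_ (isCadlag_of_continuousOn
    (x := fun t => m.lOf (m.γ₀ fun j => W.W₁ j ω) (m.h (m.γ₀ fun j => W.W₁ j ω)) t F)
      (continuousOn_lOf _ _ _))) _
  have e : ∀ t, m.lPre W φ F n ω t = _ := lPre_eq_fluct (T := T) F (n, ω)
  simp only [e]
  exact isCadlag_floor n fun k => (m.sgdRun W φ T).fluct F ((n, ω), k)

theorem LPre_eq (hW : Assumptions P m W) (hN₁ : 0 < N₁) {F : Theta d N₁ → ℝ}
    (hF : ContDiff ℝ 1 F) (ζ : ℝ) {a : ℕ × Ω} (ha : 0 < a.1) (t : ℝ) :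
    m.LPre W φ ζ F a.1 a.2 t = (a.1 : ℝ) ^ (ζ - 2 * φ) * ((m.sgdRun W φ T).β a *
      ((m.sgdRun W φ T).fluct F (a, ⌊((m.sgdRun W φ T).N a : ℝ) * t⌋₊) -
        (m.sgdRun W φ T).lim m.meanField F a t)) := by
  have e1 : (a.1 : ℝ) ^ (ζ - φ) = (a.1 : ℝ) ^ (ζ - 2 * φ) * (m.sgdRun W φ T).β a := by
    change _ = _ * (a.1 : ℝ) ^ φ
    rw [← Real.rpow_add (by exact_mod_cast ha)]
    congr 1
    ring
  rw [LPre, lPre_eq_fluct (T := T) F a t, ← mul_assoc, ← e1, ← lOf_eq_lim hW hN₁ hF]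
  rfl

end Model

end DeepNet

theorem mainTheorem4 {d N₁ M : ℕ} (hN₁ : 0 < N₁) (m : Model d N₁ M)
    {Ω : Type*} [MeasurableSpace Ω] (P : Measure Ω) [IsProbabilityMeasure P]
    (W : Noise d N₁ Ω) (hW : Assumptions P m W)
    (hγ₁ : m.γ₁ ∈ Set.Icc (1 / 2 : ℝ) 1) (hγ₂ : m.γ₂ ∈ Set.Ioo (3 / 4 : ℝ) 1)
    (φ : ℝ) (hφ : φ = 1 - m.γ₂) (f : Theta d N₁ → ℝ) (hf : IsCb 3 f)
    (ζ : ℝ) (hζ : ζ ≤ 2 * φ) (T : ℝ) (hT : 0 < T) :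
    (ζ < 2 * φ →
      TendstoInProbabilityD P T (m.LPre W φ ζ f) (fun _ _ => 0)) ∧
    (ζ = 2 * φ →
      TendstoInProbabilityD P T (m.LPre W φ ζ f)
        (fun ω => m.L (m.γ₀ fun j => W.W₁ j ω) f)) := by
  have hf1 : ContDiff ℝ 1 f := hf.1.of_le (by norm_num)
  have hf2 : ContDiff ℝ 2 f := hf.1.of_le (by norm_num)
  obtain ⟨R, hadm⟩ := hW.exists_admissible (T := T) hN₁ hφ (by linarith [hγ₂.2])
    (by linarith [hγ₂.1]) hT
  have hpos : ∀ᶠ a in inProb P, 0 < a.1 := tendsto_fst_inProb.eventually (eventually_gt_atTop 0)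
  have hmain := fun δ (hδ : (0 : ℝ) < δ) =>
    hadm.eventually_abs_sub_lim₂_le hW.smooth (fun _ => rfl) hf.1 hδ
  refine ⟨fun hlt => ?_, fun heq => ?_⟩
  · refine tendstoInProbabilityD_of_eventually (fun n ω => Model.isCadlag_LPre ζ f n ω)
      (fun ω => isCadlag_of_continuousOn continuousOn_const) fun δ hδ => ?_
    obtain ⟨K, hK0, hK⟩ := hadm.unifLip_lim₂ hW.smooth hf2
    have hsmall : Tendsto (fun a : ℕ × Ω => (a.1 : ℝ) ^ (ζ - 2 * φ) * (1 + K)) (inProb P)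
        (𝓝 0) := by
      simpa using ((Assumptions.tendsto_natCast_rpow_zero (s := ζ - 2 * φ) (by linarith)).comp
        tendsto_fst_inProb).mul_const (1 + K)
    filter_upwards [hpos, hmain 1 one_pos, hK, hsmall.eventually_le_const hδ] with
      a ha h1 h2 h3 t ht
    rw [sub_zero, Model.LPre_eq (T := T) hW hN₁ hf1 ζ ha, abs_mul,
      abs_of_nonneg (Real.rpow_nonneg (Nat.cast_nonneg _) _)]
    refine le_trans (mul_le_mul_of_nonneg_left ?_ (Real.rpow_nonneg (Nat.cast_nonneg _) _)) h3
    have h4 := abs_le.1 (h1 t ht)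
    have h5 := abs_le.1 (h2 t ht).1
    exact abs_le.2 ⟨by linarith [h4.1, h5.1], by linarith [h4.2, h5.2]⟩
  · have hL : ∀ (a : ℕ × Ω), ∀ t ∈ Set.Icc 0 T, m.L (m.γ₀ fun j => W.W₁ j a.2) f t =
        (m.sgdRun W φ T).lim₂ m.meanField f a t := fun a t ht =>
      Model.L_eq_lim₂ hW hN₁ ht.1 hf2
    refine tendstoInProbabilityD_of_eventually (fun n ω => Model.isCadlag_LPre ζ f n ω)
      (fun ω => isCadlag_of_continuousOn ?_) fun δ hδ => ?_
    · exact (MFRun.continuousOn_lim₂ hT.le (hadm.h_continuousOn (0, ω))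
        (hadm.κ_continuousOn (0, ω)) f).congr fun t ht => hL (0, ω) t ht
    · filter_upwards [hpos, hmain δ hδ] with a ha h1 t ht
      rw [Model.LPre_eq (T := T) hW hN₁ hf1 ζ ha, hL a t ht, heq, sub_self, Real.rpow_zero,
        one_mul]
      exact h1 t ht
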